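/- **Hypergeometric sum.** Let $\mathbb F_q$ be a finite field with $q$ elements, $\gcd(q,30)=1$. Fix a non-trivial additive character $\psi$ of $\mathbb F_q$ and a generator $\omega$ of the group of characters $\mathbb F_q^\times\to\mathbb C^\times$, and put $g(m)=\sum_{x\in\mathbb F_q^\times}\omega(x)^m\psi(x)$ for $m\in\mathbb Z$. Let $$\boldsymbol\alpha=\left(\tfrac1{30},\tfrac7{30},\tfrac{11}{30},\tfrac{13}{30},\tfrac{17}{30},\tfrac{19}{30},\tfrac{23}{30},\tfrac{29}{30}\right),\qquad \boldsymbol\beta=\left(\tfrac15,\tfrac13,\tfrac25,\tfrac12,\tfrac35,\tfrac23,\tfrac45,1\right),$$ so that $$\prod_{j=1}^8\frac{X-e^{2\pi i\alpha_j}}{X-e^{2\pi i\beta_j}}=\frac{(X^{30}-1)(X-1)}{(X^{15}-1)(X^{10}-1)(X^6-1)}.$$ Let $D(X)$ be the greatest common divisor of $(X^{30}-1)(X-1)$ and $(X^{15}-1)(X^{10}-1)(X^6-1)$ in $\mathbb C[X]$, let $s(m)$ be the multiplicity of $e^{2\pi i m/(q-1)}$ as a zero of $D$, and let $M=30^{30}/(15^{15}10^{10}6^6)=2^{14}3^95^5$.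 For $t\in\mathbb F_q^\times$ define $$H_q(\boldsymbol\alpha,\boldsymbol\beta|t)=\frac{(-1)^{5}}{1-q}\sum_{m=0}^{q-2}q^{s(m)-s(0)}\,g(30m)g(m)g(-15m)g(-10m)g(-6m)\;\omega\!\left((-1)^{31}M^{-1}t\right)^m.$$ **The surface and its completion.** For $\lambda\in\mathbb F_q^\times$ let $S_\lambda$ be the affine surface $y^2-xyz+x^3+z^5-\lambda^{-1}=0$ over $\mathbb F_q$, and let $V_\lambda\subset S_\lambda$ be the open part $xyz\neq0$, a closed subvariety of the torus $\mathbb G_m^3$ with coordinates $x,y,z$. In $\mathbb Z^3$ put $$\rho_{11}=(0,1,0),\ \rho_{12}=(1,0,0),\ \rho_{13}=(0,0,1),\ \rho_{21}=(-5,-7,-3),\ \rho_{22}=(-3,-5,-2),\ \rho_{23}=(-2,-3,-1).$$ Let $\Sigma'$ be the set of all cones spanned by $\{\rho_{ij}:(i,j)\in C\}$, where $C$ runs over the subsets of $\{1,2\}\times\{1,2,3\}$ that are totally ordered for the componentwise order and do not project onto both $\{1,2\}$ and $\{1,2,3\}$. Then $\Sigma'$ is a complete simplicial fan. Let $\overline{S_\lambda}$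 be the closure of $V_\lambda$ in the toric threefold of $\Sigma'$; that is, the scheme glued along the faces of the cones $\sigma\in\Sigma'$ from the open affine charts $\operatorname{Spec}A_\sigma$, where $A_\sigma$ is the subalgebra of the coordinate ring of $V_\lambda$ generated by the monomials $x^ay^bz^c$ with $(a,b,c)\in\mathbb Z^3$ in the dual cone of $\sigma$. **Theorem.** Let $\gcd(q,30)=1$. 1. If $\lambda\in\mathbb F_q^\times$ and $2^{14}3^95^5\lambda\ne1$ in $\mathbb F_q$, then $\overline{S_\lambda}$ exists, is proper over $\mathbb F_q$ and contains $S_\lambda$ as a dense open subscheme (compatibly with the inclusions of $V_\lambda$), and $$|\overline{S_\lambda}(\mathbb F_q)|=q^2+3q+1+q\,H_q(\boldsymbol\alpha,\boldsymbol\beta|2^{14}3^95^5\lambda).$$ 2. For every $t\in\mathbb F_q^\times$ the value $H_q(\boldsymbol\alpha,\boldsymbol\beta|t)$ is a rational integer. -/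

import Mathlib

open Polynomial CategoryTheory AlgebraicGeometry

universe u

namespace FiniteHypergeometric

/-! ### Finite hypergeometric sums defined over the rationals -/

/-- The root of unity `exp (2πi a)` attached to a rational number `a`. -/
noncomputable def rootOfUnity (a : ℚ) : ℂ :=
  Complex.exp (2 * Real.pi * Complex.I * (a : ℂ))

/-- Data showing that the parameter multisets `α`, `β` are defined over `ℚ`: positive integers
`p₁, …, p_r` and `q₁, …, q_s` with
`∏ (X - e^{2πi α_j}) / ∏ (X - e^{2πi β_j}) = ∏ (X ^ p_i - 1) / ∏ (X ^ q_j - 1)`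
(written without denominators). -/
structure RationalData (α β : Multiset ℚ) where
  p : List ℕ
  q : List ℕ
  p_pos : ∀ n ∈ p, 0 < n
  q_pos : ∀ n ∈ q, 0 < n
  prod_eq :
    (α.map fun a => (X - C (rootOfUnity a) : ℂ[X])).prod * (q.map fun n => (X ^ n - 1 : ℂ[X])).prod =
      (β.map fun b => (X - C (rootOfUnity b) : ℂ[X])).prod *
        (p.map fun n => (X ^ n - 1 : ℂ[X])).prod

namespace RationalData

variable {α β : Multiset ℚ} (D : RationalData α β)

open Classical in
/-- The polynomial `D(X) = gcd (∏ (X ^ p_i - 1), ∏ (X ^ q_j - 1))`. -/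
noncomputable def commonDivisor : ℂ[X] :=
  EuclideanDomain.gcd (D.p.map fun n => (X ^ n - 1 : ℂ[X])).prod
    (D.q.map fun n => (X ^ n - 1 : ℂ[X])).prod

/-- `s(m)`: the multiplicity of `e^{2πi m / (Q - 1)}` as a zero of `D(X)`, where `Q` is the
cardinality of the finite field. -/
noncomputable def mult (Q m : ℕ) : ℕ :=
  D.commonDivisor.rootMultiplicity (rootOfUnity ((m : ℚ) / ((Q : ℚ) - 1)))

/-- The image in `F` of `M = ∏ p_i ^ p_i / ∏ q_j ^ q_j`. -/
def scale (F : Type u) [Field F] : F :=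
  (D.p.map fun n : ℕ => (n : F) ^ n).prod / (D.q.map fun n : ℕ => (n : F) ^ n).prod

/-- The sign `ε = (-1) ^ (∑ q_j)`, as an element of `F`. -/
def sign (F : Type u) [Field F] : F := (-1) ^ D.q.sum

/-- The finite hypergeometric sum
`H_Q(α, β | t) = (-1)^{r+s} / (1 - Q) *
  ∑_{m=0}^{Q-2} Q^{s(m) - s(0)} ∏ g(p_i m) ∏ g(-q_j m) ω(ε M⁻¹ t)^m`,
where `Q` is the cardinality of `F` and `g(k)` is the Gauss sum of `ω ^ k` with respect to the
additive character `ψ`. -/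
noncomputable def H {F : Type u} [Field F] [Fintype F] (ψ : AddChar F ℂ) (ω : MulChar F ℂ)
    (t : F) : ℂ :=
  (-1) ^ (D.p.length + D.q.length) / (1 - (Fintype.card F : ℂ)) *
    ∑ m ∈ Finset.range (Fintype.card F - 1),
      (Fintype.card F : ℂ) ^
          ((D.mult (Fintype.card F) m : ℤ) - (D.mult (Fintype.card F) 0 : ℤ)) *
        ((D.p.map fun n => gaussSum (ω ^ ((n : ℤ) * m)) ψ).prod *
          (D.q.map fun n => gaussSum (ω ^ (-(n : ℤ) * m)) ψ).prod) *
        ω (D.sign F * (D.scale F)⁻¹ * t) ^ m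

end RationalData

/-- `α = (1/30, 7/30, 11/30, 13/30, 17/30, 19/30, 23/30, 29/30)`. -/
def alpha : Multiset ℚ := {1/30, 7/30, 11/30, 13/30, 17/30, 19/30, 23/30, 29/30}

/-- `β = (1/5, 1/3, 2/5, 1/2, 3/5, 2/3, 4/5, 1)`. -/
def beta : Multiset ℚ := {1/5, 1/3, 2/5, 1/2, 3/5, 2/3, 4/5, 1}

theorem rootOfUnity_div (n k : ℕ) :
    rootOfUnity ((k : ℚ) / n) = Complex.exp (2 * Real.pi * Complex.I / n) ^ k := by
  rw [rootOfUnity, ← Complex.exp_nat_mul]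
  congr 1
  push_cast
  ring

theorem X_pow_sub_one_eq (n : ℕ) (hn : 0 < n) :
    (X ^ n - 1 : ℂ[X]) =
      (((Multiset.range n).map fun k => ((k + 1 : ℕ) : ℚ) / n).map
        fun a => (X - C (rootOfUnity a) : ℂ[X])).prod := by
  have h := Complex.isPrimitiveRoot_exp n hn.ne'
  have h1 := X_pow_sub_one_eq_prod hn h
  have h2 : (nthRoots n (1 : ℂ)) = _ := h.nthRoots_eq (α := Complex.exp (2 * Real.pi * Complex.I / n))
    (a := 1) h.pow_eq_one
  rw [h1, nthRootsFinset_def, Finset.prod, Multiset.toFinset_val,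
    Multiset.dedup_eq_self.2 h.nthRoots_one_nodup, h2, Multiset.map_map, Multiset.map_map]
  congr 1
  refine Multiset.map_congr rfl fun k _ => ?_
  simp only [Function.comp]
  rw [rootOfUnity_div, pow_succ]

/-- The parameters `alpha`, `beta` are defined over `ℚ`:
`∏ (X - e^{2πi α_j}) / ∏ (X - e^{2πi β_j}) =
  (X^30 - 1) (X - 1) / ((X^15 - 1) (X^10 - 1) (X^6 - 1))`. -/
def surfaceData : RationalData alpha beta where
  p := [30, 1]
  q := [15, 10, 6]
  p_pos := by simp
  q_pos := by simp
  prod_eq := by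
    simp only [List.map_cons, List.map_nil, List.prod_cons, List.prod_nil, mul_one]
    rw [X_pow_sub_one_eq 30 (by norm_num), X_pow_sub_one_eq 15 (by norm_num),
      X_pow_sub_one_eq 10 (by norm_num), X_pow_sub_one_eq 6 (by norm_num),
      X_pow_sub_one_eq 1 (by norm_num)]
    simp only [← Multiset.prod_add, ← Multiset.map_add]
    congr 2
    decide +kernel

/-! ### The surface and its completion -/

section Surface

variable {F : Type u} [Field F]

/-- The polynomial `y² - xyz + x³ + z⁵ - λ⁻¹`, with `x, y, z` the variables `0, 1, 2`. -/
noncomputable def surfacePoly (lam : F) : MvPolynomial (Fin 3) F :=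
  MvPolynomial.X 1 ^ 2 - MvPolynomial.X 0 * MvPolynomial.X 1 * MvPolynomial.X 2 +
    MvPolynomial.X 0 ^ 3 + MvPolynomial.X 2 ^ 5 - MvPolynomial.C lam⁻¹

/-- The ideal of the affine surface `S_λ`. -/
noncomputable def surfaceIdeal (lam : F) : Ideal (MvPolynomial (Fin 3) F) :=
  Ideal.span {surfacePoly lam}

/-- The coordinate ring of the affine surface `S_λ`. -/
abbrev SurfaceRing (lam : F) : Type u := MvPolynomial (Fin 3) F ⧸ surfaceIdeal lam

/-- The affine surface `S_λ`. -/
noncomputable abbrev surface (lam : F) : Scheme.{u} := Spec (CommRingCat.of (SurfaceRing lam))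

/-- The inclusion of `F[x, y, z]` into the ring `F[x^±¹, y^±¹, z^±¹]` of Laurent polynomials. -/
noncomputable def toLaurent : MvPolynomial (Fin 3) F →ₐ[F] AddMonoidAlgebra F (Fin 3 → ℤ) :=
  MvPolynomial.aeval fun i => AddMonoidAlgebra.single (Pi.single i 1) 1

/-- The coordinate ring `F[x^±¹, y^±¹, z^±¹] / (y² - xyz + x³ + z⁵ - λ⁻¹)` of the part `V_λ` of
`S_λ` where `xyz ≠ 0`. -/
abbrev TorusRing (lam : F) : Type u :=
  AddMonoidAlgebra F (Fin 3 → ℤ) ⧸ (surfaceIdeal lam).map (toLaurent (F := F))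

/-- The restriction of functions from `S_λ` to `V_λ`. -/
noncomputable def restrict (lam : F) : SurfaceRing lam →+* TorusRing lam :=
  Ideal.quotientMap _ (toLaurent (F := F)).toRingHom Ideal.le_comap_map

/-- The function on `V_λ` given by the Laurent monomial with exponent vector `m`. -/
noncomputable def character (lam : F) (m : Fin 3 → ℤ) : TorusRing lam :=
  Ideal.Quotient.mk _ (AddMonoidAlgebra.single m 1)

/-- The primitive generators of the six rays of the fan, in the cocharacter lattice of the torus
with coordinates `x, y, z`.

`V_λ` is identified with `x₁ + x₂ = y₁ + y₂ + y₃`, `λ x₁^30 x₂ = y₁^15 y₂^10 y₃^6` through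
`(x₁ : x₂ : y₁ : y₂ : y₃) = (1 : λ⁻¹/(xyz) : y/(xz) : x²/(yz) : z⁴/(xy))`, and `ray (i, j)` is the
direction in which precisely `x_{i+1}` and `y_{j+1}` tend to zero: if the coordinate `x_{i+1}` has
order `q_{j+1}`, the coordinate `y_{j+1}` has order `p_{i+1}` and the others have order zero, where
`p = (30, 1)` and `q = (15, 10, 6)`, then `(x, y, z)` has order a positive multiple of
`ray (i, j)`. -/
def ray : Fin 2 × Fin 3 → Fin 3 → ℤ
  | (0, 0) => ![0, 1, 0]
  | (0, 1) => ![1, 0, 0]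
  | (0, 2) => ![0, 0, 1]
  | (1, 0) => ![-5, -7, -3]
  | (1, 1) => ![-3, -5, -2]
  | (1, 2) => ![-2, -3, -1]

/-- The cells of the staircase triangulation of `Δ¹ × Δ²` (sets of index pairs totally ordered by
the product order) whose support is not maximal. They index the cones of the fan: the cone of a
cell is spanned by the rays of its elements. -/
def IsCell (C : Finset (Fin 2 × Fin 3)) : Prop :=
  (∀ a ∈ C, ∀ b ∈ C, a ≤ b ∨ b ≤ a) ∧
    ¬ (C.image Prod.fst = Finset.univ ∧ C.image Prod.snd = Finset.univ)

/-- The type of cones of the fan. -/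
abbrev Cell : Type := {C : Finset (Fin 2 × Fin 3) // IsCell C}

/-- The coordinate ring of the Zariski closure of `V_λ` in the affine toric threefold of the cone of
`C`: the subring of the ring of functions on `V_λ` generated by the Laurent monomials whose
exponents lie in the dual cone. -/
noncomputable def chartRing (lam : F) (C : Finset (Fin 2 × Fin 3)) :
    Subalgebra F (TorusRing lam) :=
  Algebra.adjoin F {f | ∃ m : Fin 3 → ℤ, (∀ c ∈ C, 0 ≤ ray c ⬝ᵥ m) ∧ f = character lam m}

theorem chartRing_anti (lam : F) {C C' : Finset (Fin 2 × Fin 3)} (h : C' ⊆ C) :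
    chartRing lam C ≤ chartRing lam C' :=
  Algebra.adjoin_mono fun _ ⟨m, hm, hf⟩ => ⟨m, fun c hc => hm c (h hc), hf⟩

/-- The closure of `V_λ` in the affine toric threefold of the cone of `C`. -/
noncomputable abbrev chartScheme (lam : F) (C : Finset (Fin 2 × Fin 3)) : Scheme.{u} :=
  Spec (CommRingCat.of (chartRing lam C))

/-- The map of charts induced by the inclusion of a face. -/
noncomputable def faceMap (lam : F) {C C' : Finset (Fin 2 × Fin 3)} (h : C' ⊆ C) :
    chartScheme lam C' ⟶ chartScheme lam C :=
  Spec.map (CommRingCat.ofHom (Subalgebra.inclusion (chartRing_anti lam h)).toRingHom)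

/-- The inclusion of `V_λ` into a chart. -/
noncomputable def torusToChart (lam : F) (C : Finset (Fin 2 × Fin 3)) :
    Spec (CommRingCat.of (TorusRing lam)) ⟶ chartScheme lam C :=
  Spec.map (CommRingCat.ofHom (chartRing lam C).val.toRingHom)

/-- The inclusion of `V_λ` into `S_λ`. -/
noncomputable def torusToSurface (lam : F) :
    Spec (CommRingCat.of (TorusRing lam)) ⟶ surface lam :=
  Spec.map (CommRingCat.ofHom (restrict lam))

/-- The completion of `S_λ`: the closure of `V_λ` in the complete toric threefold of the fan. It is
a proper scheme over `F` covered by the open charts `chartScheme lam C`, which are glued along the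
faces of the cones, and it contains `S_λ` as a dense open subscheme. -/
structure Completion (lam : F) where
  /-- the underlying scheme -/
  X : Scheme.{u}
  /-- the structure morphism -/
  π : X ⟶ Spec (CommRingCat.of F)
  proper : IsProper π
  /-- the charts -/
  chart : ∀ C : Cell, chartScheme lam C.1 ⟶ X
  chart_open : ∀ C : Cell, IsOpenImmersion (chart C)
  chart_over : ∀ C : Cell,
    chart C ≫ π = Spec.map (CommRingCat.ofHom (algebraMap F (chartRing lam C.1)))
  chart_face : ∀ (C C' : Cell) (h : C'.1 ⊆ C.1), faceMap lam h ≫ chart C = chart C'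
  chart_cover : ∀ x : X, ∃ C, x ∈ Set.range (chart C)
  /-- the embedding of the affine surface -/
  ι : surface lam ⟶ X
  ι_open : IsOpenImmersion ι
  ι_dense : DenseRange ι
  ι_over : ι ≫ π = Spec.map (CommRingCat.ofHom (algebraMap F (SurfaceRing lam)))
  ι_torus : ∀ C : Cell, torusToSurface lam ≫ ι = torusToChart lam C.1 ≫ chart C

/-- The set of `F`-rational points of the completion. -/
def Completion.RationalPoints {lam : F} (S : Completion lam) : Type u :=
  {s : Spec (CommRingCat.of F) ⟶ S.X // s ≫ S.π = 𝟙 _}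

end Surface

end FiniteHypergeometric

namespace FiniteHypergeometric

/-! ### Divisibility of the number of solutions of an equation of small weighted degree -/

section CyclicShift

variable (p f : ℕ)

/-! Let N be the number of rational points of S_λ. Everything follows from N = q² + 1 + qH, from N ≡
1 modulo q, and from the fact that the boundary of the completion has 3q rational points.

The formula for N (`card_surfacePoints`) is harmonic analysis on F^×. In H the exponent s(m) - s(0)
depends only on the order of χ = ω^m, and by inclusion-exclusion (`charWeight_eq`) the weight is a
combination of the constant 1 and of indicators of the d-torsion characters for d = 6, 10, 15, 2, 3,
5, 1. The unweighted sum of products of Gauss sums counts V_λ. For d = 6, 10, 15 the product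
degenerates and the torsion sum counts the points with exactly one vanishing coordinate; for d = 2,
3, 5 it counts those on the coordinate axes. The origin is not on S_λ, so these counts add up to N.

Integrality then amounts to q ∣ N - 1. The weighted cone over S_λ is a hypersurface in four
variables of weights 2, 3, 1, 1 and of degree 6, less than 7, so a weighted form of Ax's theorem
(`pow_dvd_card_zeros`) makes its number of points divisible by q. Ax's theorem is proved with
Teichmüller lifts in Witt vectors: the indicator of a zero is 1 - Y^L modulo q with L = (q -
1)p^(f-1), and a term of the multinomial expansion of Y^L either sums to a multiple of q or has a
multinomial coefficient divisible by q, by Legendre's formula and an estimate of digit sums.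

The completion is realised as Proj of the ring of sections of a lattice polytope whose eight
vertices correspond to the maximal cones (`model`); this gives properness, and the charts are the
basic open sets of suitable monomials. Rational points of a chart are monoid homomorphisms to F
satisfying the equation, because the ideal of the closure is generated by the equation divided by a
coordinate monomial (`mem_dualCone_of_relation_mul`). Since the five toric coordinates satisfy a
linear relation, at least two of them are nonzero at each rational point, so each such point lies in
the chart of a row or of a column. The first row is S_λ, the second adds a triangle of lines with 3q
- 3 points, and each of the three columns adds one point (`card_rationalPoints`). -/

/-- The value of a digit expansion after a cyclic shift of the exponents modulo `f`. -/
def shiftedDigits : List ℕ → ℕ → ℕ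
  | [], _ => 0
  | d :: L, t => d * p ^ (t % f) + shiftedDigits L (t + 1)

variable {p}

theorem pow_mod_modEq (hp : 0 < p) (t : ℕ) : p ^ (t % f) ≡ p ^ t [MOD p ^ f - 1] := by
  have h1 : p ^ f ≡ 1 [MOD p ^ f - 1] :=
    ((Nat.modEq_iff_dvd' (Nat.one_le_pow _ _ hp)).2 dvd_rfl).symm
  conv_rhs => rw [← Nat.mod_add_div t f, pow_add, pow_mul]
  simpa using ((h1.pow (t / f)).mul_left (p ^ (t % f))).symm

/-- As p ^ f ≡ 1, reducing exponents modulo f is harmless modulo p ^ f - 1, and a shift by t acts on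
residues as multiplication by p ^ t. -/
theorem shiftedDigits_modEq (hp : 0 < p) (L : List ℕ) (t : ℕ) :
    shiftedDigits p f L t ≡ p ^ t * Nat.ofDigits p L [MOD p ^ f - 1] := by
  induction L generalizing t with
  | nil => simp [shiftedDigits, Nat.ModEq.refl]
  | cons d L ih =>
    rw [shiftedDigits, Nat.ofDigits_cons, mul_add, ← mul_assoc, ← pow_succ, mul_comm (p ^ t)]
    exact ((pow_mod_modEq f hp t).mul_left d).add (ih (t + 1))

theorem sum_range_pow_mod (s : ℕ) :
    ∑ t ∈ Finset.range f, p ^ ((t + s) % f) = ∑ t ∈ Finset.range f, p ^ t := by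
  induction s with
  | zero => exact Finset.sum_congr rfl fun t ht => by rw [add_zero, Nat.mod_eq_of_lt (by simpa using ht)]
  | succ s ih =>
    rw [← ih]
    have h1 := Finset.sum_range_succ (fun t => p ^ ((t + s) % f)) f
    have h2 := Finset.sum_range_succ' (fun t => p ^ ((t + s) % f)) f
    simp only [Nat.add_mod_left, Nat.zero_add] at h1 h2
    simp only [show ∀ t, t + (s + 1) = t + 1 + s by intro t; ring]
    omega

/-- Over a full cycle of shifts every digit meets each of the powers 1, p, …, p ^ (f - 1) exactly
once, so only the digit sum survives. -/
theorem sum_shiftedDigits (L : List ℕ) (s : ℕ) :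
    ∑ t ∈ Finset.range f, shiftedDigits p f L (t + s) =
      L.sum * ∑ t ∈ Finset.range f, p ^ t := by
  induction L generalizing s with
  | nil => simp [shiftedDigits]
  | cons d L ih =>
    simp only [shiftedDigits, Finset.sum_add_distrib, add_assoc, ih (s + 1), ← Finset.mul_sum,
      sum_range_pow_mod, List.sum_cons, add_mul]

/-- Positivity is what later turns divisibility by p ^ f - 1 into a lower bound. -/
theorem shiftedDigits_pos (hp : 0 < p) {n : ℕ} (hn : 0 < n) (t : ℕ) :
    0 < shiftedDigits p f (p.digits n) t := by
  have key : ∀ (L : List ℕ) (t : ℕ), shiftedDigits p f L t = 0 → Nat.ofDigits p L = 0 := by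
    intro L
    induction L with
    | nil => simp
    | cons d L ih =>
      intro t h
      have h' : d * p ^ (t % f) = 0 ∧ shiftedDigits p f L (t + 1) = 0 := by
        simpa [shiftedDigits] using h
      have hd : d = 0 := by
        rcases Nat.mul_eq_zero.1 h'.1 with h | h
        · exact h
        · exact absurd h (pow_pos hp _).ne'
      rw [Nat.ofDigits_cons, ih _ h'.2, hd]
      simp
  rw [Nat.pos_iff_ne_zero]
  intro h
  have := key _ _ h
  rw [Nat.ofDigits_digits] at this
  omega

end CyclicShift

theorem digits_sum_mul_pow {p : ℕ} (hp : 1 < p) (m k : ℕ) :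
    (p.digits (p ^ k * m)).sum = (p.digits m).sum := by
  rcases Nat.eq_zero_or_pos m with rfl | hm
  · simp
  · rw [Nat.digits_base_pow_mul hp hm]; simp

theorem digits_sum_pow_sub_one {p : ℕ} (hp : 1 < p) (f : ℕ) :
    (p.digits (p ^ f - 1)).sum = f * (p - 1) := by
  induction f with
  | zero => simp
  | succ f ih =>
    have h1 : p ^ (f + 1) - 1 = (p - 1) + p * (p ^ f - 1) := by
      have := Nat.one_le_pow f p (by omega)
      zify [this, Nat.one_le_pow (f + 1) p (by omega), hp.le]
      ring
    rw [h1, Nat.digits_add p hp _ _ (by omega) (by left; omega), List.sum_cons, ih]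
    ring

theorem padicValNat_prod {ι : Type*} {p : ℕ} [hp : Fact p.Prime] {s : Finset ι} {g : ι → ℕ}
    (hg : ∀ i, g i ≠ 0) : padicValNat p (∏ i ∈ s, g i) = ∑ i ∈ s, padicValNat p (g i) := by
  classical
  induction s using Finset.induction_on with
  | empty => simp
  | insert a s ha ih =>
    rw [Finset.prod_insert ha, Finset.sum_insert ha,
      padicValNat.mul (hg a) (Finset.prod_ne_zero_iff.2 fun i _ => hg i), ih]

section Multinomial

variable {ι : Type*} [Fintype ι]

/-- Legendre's formula, (p - 1) v(n!) = n minus the digit sum of n, is applied to every factorial;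
the terms n cancel. -/
theorem padicValNat_multinomial {p : ℕ} [hp : Fact p.Prime] (e : ι → ℕ) :
    (p - 1) * padicValNat p (Nat.multinomial Finset.univ e) + (p.digits (∑ i, e i)).sum =
      ∑ i, (p.digits (e i)).sum := by
  have h0 : Nat.multinomial Finset.univ e ≠ 0 := (Nat.multinomial_pos _ _).ne'
  have h1 := congrArg (padicValNat p) (Nat.multinomial_spec Finset.univ e)
  have hprod : ∏ i, (e i).factorial ≠ 0 := Finset.prod_ne_zero_iff.2 fun i _ => Nat.factorial_ne_zero _
  rw [padicValNat.mul hprod h0, padicValNat_prod fun i => Nat.factorial_ne_zero _] at h1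
  have h2 := congrArg ((p - 1) * ·) h1
  simp only [mul_add, Finset.mul_sum, sub_one_mul_padicValNat_factorial] at h2
  have h3 : ∑ i, (e i - (p.digits (e i)).sum) + ∑ i, (p.digits (e i)).sum = ∑ i, e i := by
    rw [← Finset.sum_add_distrib]
    exact Finset.sum_congr rfl fun i _ => Nat.sub_add_cancel (Nat.digit_sum_le p _)
  have h4 := Nat.digit_sum_le p (∑ i, e i)
  omega

/-- The combinatorial heart of Ax's theorem: if all variables occur in a monomial of
`F ^ ((q - 1) * p ^ k)` with positive exponents divisible by `q - 1`, its multinomial coefficient is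
divisible by `q`, provided the weighted degree of `F` is less than the sum of the weights. -/
theorem pow_dvd_multinomial {σ : Type*} [Fintype σ] {p : ℕ} [hp : Fact p.Prime] {f k d : ℕ}
    (hf : 0 < f) (M : ι → σ → ℕ) (w : σ → ℕ) (hM : ∀ i, ∑ j, M i j * w j ≤ d) (hd : d < ∑ j, w j)
    (e : ι → ℕ) (he : ∑ i, e i = (p ^ f - 1) * p ^ k)
    (hpos : ∀ j, 0 < ∑ i, e i * M i j) (hdvd : ∀ j, p ^ f - 1 ∣ ∑ i, e i * M i j) :
    p ^ f ∣ Nat.multinomial Finset.univ e := by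
  have hp1 := hp.out.one_lt
  have hp0 : 0 < p := by omega
  set Q := p ^ f - 1 with hQ
  have hQpos : 0 < Q := by
    have := Nat.one_lt_pow hf.ne' hp1
    omega
  let φ : ℕ → ι → ℕ := fun t i => shiftedDigits p f (p.digits (e i)) t
  have hφ : ∀ t i, φ t i ≡ p ^ t * e i [MOD Q] := fun t i => by
    simpa [Nat.ofDigits_digits] using shiftedDigits_modEq f hp0 (p.digits (e i)) t
  -- For each variable the shifted exponent is a positive multiple of Q, hence at least Q. Weighting
  -- and summing gives Q ∑ w ≤ d ∑ φ, so ∑ φ > Q because d < ∑ w; as a multiple of Q it is at least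
  -- 2 Q.
  have key : ∀ t, 2 * Q ≤ ∑ i, φ t i := by
    intro t
    have h1 : ∀ j, Q ≤ ∑ i, φ t i * M i j := by
      intro j
      refine Nat.le_of_dvd ?_ ?_
      · obtain ⟨i, _, hi⟩ := Finset.exists_ne_zero_of_sum_ne_zero (hpos j).ne'
        refine Finset.sum_pos' (fun _ _ => Nat.zero_le _) ⟨i, Finset.mem_univ _, ?_⟩
        have h := Nat.mul_ne_zero_iff.1 hi
        exact Nat.mul_pos (shiftedDigits_pos f hp0 (Nat.pos_of_ne_zero h.1) t)
          (Nat.pos_of_ne_zero h.2)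
      · have : ∑ i, φ t i * M i j ≡ p ^ t * ∑ i, e i * M i j [MOD Q] := by
          rw [Finset.mul_sum]
          refine Nat.ModEq.sum fun i _ => ?_
          rw [← mul_assoc]
          exact (hφ t i).mul_right _
        exact (this.dvd_iff dvd_rfl).2 ((hdvd j).mul_left _)
    have h2 : Q * ∑ j, w j ≤ (∑ i, φ t i) * d := by
      calc Q * ∑ j, w j ≤ ∑ j, (∑ i, φ t i * M i j) * w j := by
            rw [Finset.mul_sum]
            exact Finset.sum_le_sum fun j _ => Nat.mul_le_mul_right _ (h1 j)
        _ = ∑ i, φ t i * ∑ j, M i j * w j := by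
            simp only [Finset.sum_mul, Finset.mul_sum, mul_assoc]
            rw [Finset.sum_comm]
        _ ≤ _ := by
            rw [Finset.sum_mul]
            exact Finset.sum_le_sum fun i _ => Nat.mul_le_mul_left _ (hM i)
    have h3 : Q < ∑ i, φ t i := by
      by_contra! h
      have := Nat.mul_le_mul_right d h
      have := Nat.mul_lt_mul_of_pos_left hd hQpos
      omega
    have h4 : Q ∣ ∑ i, φ t i := by
      have : ∑ i, φ t i ≡ p ^ t * ∑ i, e i [MOD Q] := by
        rw [Finset.mul_sum]
        exact Nat.ModEq.sum fun i _ => hφ t i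
      refine (this.dvd_iff dvd_rfl).2 ?_
      rw [he]
      exact ((dvd_mul_right _ _).mul_left _)
    obtain ⟨c, hc⟩ := h4
    rw [hc] at h3 ⊢
    have : 1 < c := by
      by_contra! h
      have := Nat.mul_le_mul_left Q h
      omega
    nlinarith
  have hsum : ∑ t ∈ Finset.range f, ∑ i, φ t i =
      (∑ i, (p.digits (e i)).sum) * ∑ t ∈ Finset.range f, p ^ t := by
    rw [Finset.sum_comm, Finset.sum_mul]
    exact Finset.sum_congr rfl fun i _ => sum_shiftedDigits f (p.digits (e i)) 0
  -- The bounds for all f shifts are added up; dividing by G = 1 + p + ⋯ + p ^ (f - 1), where Q = G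
  -- (p - 1), bounds the total digit sum below by 2 f (p - 1).
  have hge : f * (2 * Q) ≤ (∑ i, (p.digits (e i)).sum) * ∑ t ∈ Finset.range f, p ^ t := by
    rw [← hsum]
    simpa using Finset.card_nsmul_le_sum (Finset.range f) _ (2 * Q) fun t _ => key t
  have hgeom : Q = (∑ t ∈ Finset.range f, p ^ t) * (p - 1) := by
    zify [hp1.le]
    rw [hQ, Nat.cast_sub (Nat.one_le_pow _ _ hp0)]
    push_cast
    exact (geom_sum_mul _ _).symm
  have hdig : 2 * f * (p - 1) ≤ ∑ i, (p.digits (e i)).sum := by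
    set G := ∑ t ∈ Finset.range f, p ^ t
    have hG : 0 < G := by
      rcases Nat.eq_zero_or_pos G with h | h
      · rw [h] at hgeom; omega
      · exact h
    refine Nat.le_of_mul_le_mul_right ?_ hG
    rw [hgeom] at hge
    calc 2 * f * (p - 1) * G = f * (2 * (G * (p - 1))) := by ring
      _ ≤ _ := hge
  -- The total exponent (p ^ f - 1) p ^ k has digit sum only f (p - 1), so the difference in
  -- Legendre's formula is at least f (p - 1).
  have hval := padicValNat_multinomial (p := p) e
  rw [he, mul_comm (Q) (p ^ k), digits_sum_mul_pow hp1, hQ, digits_sum_pow_sub_one hp1] at hval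
  have : f ≤ padicValNat p (Nat.multinomial Finset.univ e) := by
    have h5 : (p - 1) * f ≤ (p - 1) * padicValNat p (Nat.multinomial Finset.univ e) := by
      have : 2 * f * (p - 1) = f * (p - 1) + (p - 1) * f := by ring
      omega
    exact Nat.le_of_mul_le_mul_left h5 (by omega)
  exact (pow_dvd_pow p this).trans pow_padicValNat_dvd

end Multinomial

theorem teichmuller_pow_card_sub_one {F : Type*} [Field F] [Fintype F] {p : ℕ}
    [hp : Fact p.Prime] {f : ℕ} (hq : Fintype.card F = p ^ f) {x : F} (hx : x ≠ 0) :
    WittVector.teichmuller p x ^ (p ^ f - 1) = 1 := by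
  rw [← map_pow, ← hq, FiniteField.pow_card_sub_one_eq_one x hx, map_one]

section Witt

variable {F : Type*} [Field F] [Fintype F] {p : ℕ} [hp : Fact p.Prime] [CharP F p]

theorem natCast_dvd_witt_iff (x : WittVector p F) :
    (p : WittVector p F) ∣ x ↔ WittVector.constantCoeff x = 0 := by
  rw [← Ideal.mem_span_singleton, WittVector.mem_span_p_iff_coeff_zero_eq_zero]
  rfl

/-- The residue field F has characteristic p, so p divides N in ℤ once it does in the Witt vectors;
p is not a zero divisor there and can be cancelled repeatedly. -/
theorem pow_dvd_of_pow_dvd_witt {f : ℕ} {N : ℤ} (h : (p : WittVector p F) ^ f ∣ (N : WittVector p F)) :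
    (p : ℤ) ^ f ∣ N := by
  induction f generalizing N with
  | zero => simp
  | succ f ih =>
    have h1 : (p : WittVector p F) ∣ (N : WittVector p F) :=
      (dvd_pow_self _ (Nat.succ_ne_zero f)).trans h
    rw [natCast_dvd_witt_iff, map_intCast, CharP.intCast_eq_zero_iff F p] at h1
    obtain ⟨n, rfl⟩ := h1
    rw [pow_succ']
    refine mul_dvd_mul_left _ (ih ?_)
    push_cast at h
    rw [pow_succ'] at h
    exact (mul_dvd_mul_iff_left (WittVector.p_nonzero p F)).1 h

variable {f : ℕ} (hq : Fintype.card F = p ^ f)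

include hq

/-- For k = 0 the sum is q. Otherwise multiplication by a generator g of F^× permutes the terms and
multiplies the sum by a factor different from 1, so the sum vanishes. -/
theorem sum_teichmuller_pow (k : ℕ) (hk : ¬ (0 < k ∧ p ^ f - 1 ∣ k)) :
    (p : WittVector p F) ^ f ∣ ∑ x : F, WittVector.teichmuller p x ^ k := by
  rcases Nat.eq_zero_or_pos k with rfl | hk0
  · simp [hq]
  · have hndvd : ¬ p ^ f - 1 ∣ k := fun h => hk ⟨hk0, h⟩
    obtain ⟨g, hg⟩ := IsCyclic.exists_generator (α := Fˣ)
    have hgk : WittVector.teichmuller p (g : F) ^ k ≠ 1 := by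
      intro h
      have h1 : (g : F) ^ k = 1 := by
        have := congrArg WittVector.constantCoeff h
        simpa [WittVector.constantCoeff_apply, ← map_pow, WittVector.teichmuller_coeff_zero] using this
      have h2 : orderOf g ∣ k := orderOf_dvd_of_pow_eq_one (Units.ext (by simpa using h1))
      rw [orderOf_eq_card_of_forall_mem_zpowers hg, Nat.card_units, Nat.card_eq_fintype_card, hq] at h2
      exact hndvd h2
    have h3 : ∑ x : F, WittVector.teichmuller p x ^ k =
        WittVector.teichmuller p (g : F) ^ k * ∑ x : F, WittVector.teichmuller p x ^ k := by
      rw [Finset.mul_sum]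
      refine Fintype.sum_equiv (Equiv.mulLeft₀ (g : F)⁻¹ (by simp)) _ _ fun x => ?_
      rw [← mul_pow, ← map_mul]
      simp
    have h4 : (1 - WittVector.teichmuller p (g : F) ^ k) *
        ∑ x : F, WittVector.teichmuller p x ^ k = 0 := by
      rw [sub_mul, one_mul, ← h3, sub_self]
    rcases mul_eq_zero.1 h4 with h | h
    · exact absurd (sub_eq_zero.1 h).symm hgk
    · rw [h]; exact dvd_zero _

/-- If y = 0 then p divides Y, and the exponent is at least f. If y ≠ 0 then Y agrees with the
Teichmüller lift of y modulo p, hence their p ^ (f - 1)-th powers agree modulo p ^ f, and the lift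
is a (q - 1)-th root of unity. -/
theorem pow_dvd_indicator (hf : 0 < f) (y : F) (Y : WittVector p F)
    (hY : WittVector.constantCoeff Y = y) [Decidable (y = 0)] :
    (p : WittVector p F) ^ f ∣ (1 - Y ^ ((p ^ f - 1) * p ^ (f - 1))) - if y = 0 then 1 else 0 := by
  have hp1 := hp.out.one_lt
  split_ifs with hy
  · have h1 : f ≤ (p ^ f - 1) * p ^ (f - 1) := by
      have h2 := Nat.lt_pow_self (n := f - 1) hp1
      have h3 := Nat.one_lt_pow hf.ne' hp1
      have h4 : 1 ≤ p ^ f - 1 := by omega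
      calc f ≤ 1 * p ^ (f - 1) := by omega
        _ ≤ _ := Nat.mul_le_mul_right _ h4
    rw [sub_sub_cancel_left, dvd_neg]
    exact (pow_dvd_pow_of_dvd ((natCast_dvd_witt_iff Y).2 (hY.trans hy)) f).trans (pow_dvd_pow _ h1)
  · have h1 : (p : WittVector p F) ∣ WittVector.teichmuller p y - Y := by
      rw [natCast_dvd_witt_iff, map_sub, hY, WittVector.constantCoeff_apply,
        WittVector.teichmuller_coeff_zero, sub_self]
    have h2 := dvd_sub_pow_of_dvd_sub h1 (f - 1)
    rw [Nat.sub_add_cancel hf] at h2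
    have h3 := h2.trans (sub_dvd_pow_sub_pow _ _ (p ^ f - 1))
    rw [← pow_mul, ← pow_mul, mul_comm, pow_mul, teichmuller_pow_card_sub_one hq hy, one_pow] at h3
    rw [sub_zero]
    exact h3

/-- **Ax's theorem** modulo `q`, for weighted degrees. -/
theorem pow_dvd_card_zeros {ι σ : Type*} [Fintype ι] [Fintype σ] [DecidableEq σ] [DecidableEq F]
    (hf : 0 < f) (a : ι → F) (M : ι → σ → ℕ)
    (w : σ → ℕ) {d : ℕ} (hM : ∀ i, ∑ j, M i j * w j ≤ d) (hd : d < ∑ j, w j) :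
    p ^ f ∣ (Finset.univ.filter fun x : σ → F => ∑ i, a i * ∏ j, x j ^ M i j = 0).card := by
  classical
  set N := (Finset.univ.filter fun x : σ → F => ∑ i, a i * ∏ j, x j ^ M i j = 0).card with hN
  let τ : F →* WittVector p F := WittVector.teichmuller p
  have hτ : ∀ x, WittVector.constantCoeff (τ x) = x := fun x => by
    rw [WittVector.constantCoeff_apply, WittVector.teichmuller_coeff_zero]
  set L := (p ^ f - 1) * p ^ (f - 1) with hL
  let Y : (σ → F) → WittVector p F := fun x => ∑ i, τ (a i) * ∏ j, τ (x j) ^ M i j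
  have hY : ∀ x, WittVector.constantCoeff (Y x) = ∑ i, a i * ∏ j, x j ^ M i j := fun x => by
    simp only [Y, map_sum, map_mul, map_prod, map_pow, hτ]
  have hσ : Nonempty σ := by
    by_contra h
    rw [not_nonempty_iff] at h
    simp at hd
  have h1 : (p : WittVector p F) ^ f ∣ (∑ x : σ → F, (1 - Y x ^ L)) - (N : ℕ) := by
    rw [hN, Finset.natCast_card_filter, ← Finset.sum_sub_distrib]
    exact Finset.dvd_sum fun x _ => pow_dvd_indicator hq hf _ (Y x) (hY x)
  have h2 : (p : WittVector p F) ^ f ∣ ∑ x : σ → F, (1 : WittVector p F) := by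
    simp only [Finset.sum_const, Finset.card_univ, Fintype.card_fun, hq, nsmul_eq_mul, mul_one]
    push_cast
    exact dvd_pow_self _ Fintype.card_ne_zero
  have h3 : (p : WittVector p F) ^ f ∣ ∑ x : σ → F, Y x ^ L := by
    have expand : ∀ x, Y x ^ L = ∑ e ∈ Finset.univ.piAntidiag L, (Nat.multinomial Finset.univ e : WittVector p F) *
        (∏ i, τ (a i) ^ e i) * ∏ j, τ (x j) ^ (∑ i, e i * M i j) := by
      intro x
      rw [Finset.sum_pow_eq_sum_piAntidiag]
      refine Finset.sum_congr rfl fun e _ => ?_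
      rw [mul_assoc]
      congr 1
      simp only [mul_pow, Finset.prod_mul_distrib, ← Finset.prod_pow]
      congr 1
      rw [Finset.prod_comm]
      refine Finset.prod_congr rfl fun j _ => ?_
      rw [← Finset.prod_pow_eq_pow_sum]
      exact Finset.prod_congr rfl fun i _ => by rw [← pow_mul, mul_comm]
    simp only [expand]
    rw [Finset.sum_comm]
    refine Finset.dvd_sum fun e he => ?_
    rw [← Finset.mul_sum, ← Fintype.prod_sum fun (j : σ) (y : F) => τ y ^ (∑ i, e i * M i j)]
    -- Either each variable has a positive exponent divisible by q - 1, and the multinomial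
    -- coefficient is divisible by q, or one factor of the product of one-variable sums is.
    by_cases hall : ∀ j, 0 < ∑ i, e i * M i j ∧ p ^ f - 1 ∣ ∑ i, e i * M i j
    · have := pow_dvd_multinomial hf M w hM hd e (k := f - 1)
        (by simpa using (Finset.mem_piAntidiag.1 he).1) (fun j => (hall j).1) fun j => (hall j).2
      have h4 := Nat.cast_dvd_cast (α := WittVector p F) this
      push_cast at h4
      exact (h4.mul_right _).mul_right _
    · push Not at hall
      obtain ⟨j, hj⟩ := hall
      refine Dvd.dvd.mul_left ((sum_teichmuller_pow hq _ fun h => hj h.1 h.2).trans ?_) _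
      exact Finset.dvd_prod_of_mem (fun j => ∑ y, τ y ^ (∑ i, e i * M i j)) (Finset.mem_univ j)
  have h4 : (p : WittVector p F) ^ f ∣ ((N : ℤ) : WittVector p F) := by
    have h5 := (h2.sub h3).sub h1
    rw [Finset.sum_sub_distrib] at h5
    simpa using h5
  exact_mod_cast pow_dvd_of_pow_dvd_witt h4

end Witt

end FiniteHypergeometric

namespace FiniteHypergeometric

/-! ### The number of points of the affine surface modulo q -/

section SurfaceCount

variable {F : Type u} [Field F]

/-- The affine surface `y² - xyz + x³ + z⁵ = c` as a set of triples. -/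
def surfacePoints (c : F) : Set (F × F × F) :=
  {v | v.2.1 ^ 2 - v.1 * v.2.1 * v.2.2 + v.1 ^ 3 + v.2.2 ^ 5 - c = 0}

variable (F) in
/-- The curve at infinity `y² - xyz + x³ = 0` in the weighted projective closure, as a cone. -/
def coneAtInfinity : Set (F × F × F) :=
  {v | v.2.1 ^ 2 - v.1 * v.2.1 * v.2.2 + v.1 ^ 3 = 0}

/-- The weighted cone over the surface. -/
def weightedCone (c : F) : Set (Fin 4 → F) :=
  {v | v 1 ^ 2 - v 0 * v 1 * v 2 + v 0 ^ 3 + v 2 ^ 5 * v 3 - c * v 3 ^ 6 = 0}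

open Classical in
/-- The part of the weighted cone at infinity and the part over the affine surface. -/
noncomputable def weightedConeEquiv (c : F) :
    weightedCone c ≃ coneAtInfinity F ⊕ Fˣ × surfacePoints c where
  toFun v := if h : v.1 3 = 0 then
      .inl ⟨(v.1 0, v.1 1, v.1 2), by
        have := v.2
        simp only [weightedCone, Set.mem_ofPred_eq, h] at this
        simp only [coneAtInfinity, Set.mem_ofPred_eq]
        linear_combination this⟩
    else .inr (Units.mk0 _ h, ⟨(v.1 0 / v.1 3 ^ 2, v.1 1 / v.1 3 ^ 3, v.1 2 / v.1 3), by
        have := v.2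
        simp only [weightedCone, Set.mem_ofPred_eq] at this
        simp only [surfacePoints, Set.mem_ofPred_eq]
        field_simp
        linear_combination this⟩)
  invFun := Sum.elim
    (fun v => ⟨![v.1.1, v.1.2.1, v.1.2.2, 0], by
      have := v.2
      simp only [coneAtInfinity, Set.mem_ofPred_eq] at this
      simp only [weightedCone, Set.mem_ofPred_eq, Matrix.cons_val]
      linear_combination this⟩)
    (fun v => ⟨![v.1 ^ 2 * v.2.1.1, v.1 ^ 3 * v.2.1.2.1, v.1 * v.2.1.2.2, v.1], by
      have := v.2.2
      simp only [surfacePoints, Set.mem_ofPred_eq] at this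
      simp only [weightedCone, Set.mem_ofPred_eq, Matrix.cons_val]
      linear_combination (v.1 : F) ^ 6 * this⟩)
  left_inv v := by
    by_cases h : v.1 3 = 0
    · simp only [h, dif_pos, Sum.elim_inl]
      ext i
      fin_cases i <;> simp [h]
    · simp only [h, dif_neg, not_false_eq_true, Sum.elim_inr]
      ext i
      fin_cases i <;> simp <;> field_simp
  right_inv v := by
    rcases v with v | v
    · simp
    · simp [mul_div_cancel_left₀]

/-- Points of the cone at infinity: either `x = y = 0`, or `x, y ≠ 0` and these determine `z`. -/
noncomputable def coneAtInfinityEquiv [DecidableEq F] : coneAtInfinity F ≃ F ⊕ Fˣ × Fˣ where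
  toFun v := if h : v.1.1 = 0 then .inl v.1.2.2 else .inr (Units.mk0 _ h, Units.mk0 v.1.2.1 (by
      intro h'
      have := v.2
      simp only [coneAtInfinity, Set.mem_ofPred_eq, h'] at this
      exact h (pow_eq_zero_iff (n := 3) (by norm_num) |>.1 (by linear_combination this))))
  invFun := Sum.elim (fun z => ⟨(0, 0, z), by simp [coneAtInfinity]⟩)
    (fun v => ⟨(v.1, v.2, (v.2 ^ 2 + v.1 ^ 3) / (v.1 * v.2)), by
      simp only [coneAtInfinity, Set.mem_ofPred_eq]
      field_simp
      ring⟩)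
  left_inv v := by
    obtain ⟨⟨x, y, z⟩, hv⟩ := v
    simp only [coneAtInfinity, Set.mem_ofPred_eq] at hv
    by_cases h : x = 0
    · have hy : y = 0 := pow_eq_zero_iff (n := 2) (by norm_num) |>.1 (by
        rw [h] at hv; linear_combination hv)
      simp [h, hy]
    · have hy : y ≠ 0 := fun h' => h (pow_eq_zero_iff (n := 3) (by norm_num) |>.1 (by
        rw [h'] at hv; linear_combination hv))
      simp only [h, dif_neg, not_false_eq_true, Sum.elim_inr, Units.val_mk0]
      refine Subtype.ext (Prod.ext rfl (Prod.ext rfl ?_))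
      field_simp
      linear_combination hv
  right_inv v := by
    rcases v with v | v <;> simp

variable [Fintype F]

theorem card_weightedCone (c : F) : Nat.card (weightedCone c) =
    Fintype.card F + (Fintype.card F - 1) ^ 2 +
      (Fintype.card F - 1) * Nat.card (surfacePoints c) := by
  classical
  rw [Nat.card_congr (weightedConeEquiv c), Nat.card_sum, Nat.card_congr coneAtInfinityEquiv,
    Nat.card_sum, Nat.card_prod, Nat.card_prod, Nat.card_units, Nat.card_eq_fintype_card (α := F)]
  ring

/-- The homogenised equation has weighted degree 6 for the weights 2, 3, 1, 1, whose sum is 7; this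
is exactly the room that Ax's theorem needs. -/
theorem card_dvd_card_weightedCone (c : F) : Fintype.card F ∣ Nat.card (weightedCone c) := by
  classical
  obtain ⟨p, hp⟩ := CharP.exists F
  obtain ⟨f, hpp, hq⟩ := FiniteField.card F p
  have : Fact p.Prime := ⟨hpp⟩
  have h := pow_dvd_card_zeros hq f.pos (![1, -1, 1, 1, -c] : Fin 5 → F)
    (![![0, 2, 0, 0], ![1, 1, 1, 0], ![3, 0, 0, 0], ![0, 0, 5, 1], ![0, 0, 0, 6]])
    (![2, 3, 1, 1]) (d := 6) (by decide) (by decide)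
  rw [hq]
  convert! h
  rw [Nat.card_eq_fintype_card, ← Set.toFinset_card]
  congr 1
  ext v
  rw [Set.mem_toFinset]
  simp only [weightedCone, Set.mem_ofPred_eq, Finset.mem_filter, Finset.mem_univ,
    true_and, Fin.sum_univ_five, Fin.prod_univ_four, Matrix.cons_val]
  refine Eq.congr ?_ rfl
  ring

/-- The number of points of the affine surface is congruent to `1` modulo `q`. -/
theorem card_dvd_card_surfacePoints_sub_one (c : F) :
    (Fintype.card F : ℤ) ∣ (Nat.card (surfacePoints c) : ℤ) - 1 := by
  have h := Int.natCast_dvd_natCast.2 (card_dvd_card_weightedCone c)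
  rw [card_weightedCone] at h
  push_cast [Nat.cast_sub Fintype.card_pos] at h
  -- Modulo q the cone has 0 + 1 - N points, where N is the number of points of the surface.
  have h2 : (Nat.card (surfacePoints c) : ℤ) - 1 = (Fintype.card F : ℤ) *
      (1 + (Fintype.card F - 2) + Nat.card (surfacePoints c)) -
      (Fintype.card F + (Fintype.card F - 1) ^ 2 + (Fintype.card F - 1) *
        (Nat.card (surfacePoints c) : ℤ)) := by
    ring
  rw [h2]
  exact (dvd_mul_right _ _).sub h

end SurfaceCount

end FiniteHypergeometric

namespace FiniteHypergeometric

/-! ### Sums of products of Gauss sums as point counts -/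

theorem map_sum_eq_prod_addChar {F : Type*} [Field F] (ψ : AddChar F ℂ) {ι : Type*} (s : Finset ι) (b : ι → F) :
    ψ (∑ i ∈ s, b i) = ∏ i ∈ s, ψ (b i) := by
  classical
  induction s using Finset.induction_on with
  | empty => simp
  | insert a s ha ih => rw [Finset.sum_insert ha, Finset.prod_insert ha, AddChar.map_add_eq_mul, ih]

theorem prod_zpow_eq_zpow_sum {G ι : Type*} [CommGroup G] (g : G) (s : Finset ι) (k : ι → ℤ) :
    ∏ i ∈ s, g ^ k i = g ^ (∑ i ∈ s, k i) := by
  classical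
  induction s using Finset.induction_on with
  | empty => simp
  | insert a s ha ih => rw [Finset.sum_insert ha, Finset.prod_insert ha, ih, zpow_add]

theorem mulChar_zpow_apply {F : Type*} [Field F] (χ : MulChar F ℂ) (k : ℤ) (u : Fˣ) : (χ ^ k) u = χ (u ^ k : Fˣ) := by
  cases k with
  | ofNat n => simp [MulChar.pow_apply_coe]
  | negSucc n =>
    rw [zpow_negSucc, zpow_negSucc, MulChar.inv_apply, Ring.inverse_unit,
      MulChar.pow_apply_coe, ← map_pow, ← Units.val_pow_eq_pow_val, inv_pow]

section CharacterSums

variable {F : Type u} [Field F] [Fintype F]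

theorem sum_eq_zero_add_sum_units {A : Type*} [AddCommMonoid A] [Fintype Fˣ] (G : F → A) :
    ∑ x, G x = G 0 + ∑ u : Fˣ, G u := by
  classical
  rw [Fintype.sum_eq_add_sum_subtype_ne G 0]
  congr 1
  exact Fintype.sum_equiv unitsEquivNeZero.symm _ _ fun x => rfl

theorem gaussSum_eq_sum_units [Fintype Fˣ] (χ : MulChar F ℂ) (ψ : AddChar F ℂ) :
    gaussSum χ ψ = ∑ u : Fˣ, χ u * ψ u := by
  rw [gaussSum, sum_eq_zero_add_sum_units, MulChar.map_zero, zero_mul, zero_add]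

theorem gaussSum_one_eq [Fintype Fˣ] {ψ : AddChar F ℂ} (hψ : ψ ≠ 1) : gaussSum (1 : MulChar F ℂ) ψ = -1 := by
  have h := AddChar.sum_eq_zero_of_ne_one hψ
  rw [sum_eq_zero_add_sum_units, AddChar.map_zero_eq_one] at h
  rw [gaussSum_eq_sum_units]
  simp only [MulChar.one_apply_coe, one_mul]
  linear_combination h

variable [DecidableEq F]

theorem sum_units_addChar_mul {ψ : AddChar F ℂ} (hψ : ψ ≠ 1) (b : F) :
    ∑ s : Fˣ, ψ (s * b) = (if b = 0 then (Fintype.card F : ℂ) else 0) - 1 := by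
  have h := AddChar.sum_mulShift b (AddChar.IsPrimitive.of_ne_one hψ)
  rw [sum_eq_zero_add_sum_units, zero_mul, AddChar.map_zero_eq_one] at h
  push_cast at h
  linear_combination h

/-- If s is the variable of the first Gauss sum, scaling all the others by s collects the powers of
s into χ ^ (k₀ + ∑ k), which is trivial. The remaining sum of ψ (s (1 + ∑ a)) over s is evaluated by
orthogonality. -/
theorem gaussSum_mul_prod_gaussSum {ψ : AddChar F ℂ} (hψ : ψ ≠ 1) {ι : Type*} [Fintype ι]
    [DecidableEq ι] (χ : MulChar F ℂ) (k₀ : ℤ) (k : ι → ℤ) (h : χ ^ (k₀ + ∑ i, k i) = 1) :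
    gaussSum (χ ^ k₀) ψ * ∏ i, gaussSum (χ ^ k i) ψ =
      ∑ a : ι → Fˣ, χ (∏ i, a i ^ k i : Fˣ) *
        ((if 1 + ∑ i, (a i : F) = 0 then (Fintype.card F : ℂ) else 0) - 1) := by
  simp only [gaussSum_eq_sum_units]
  rw [Fintype.prod_sum, Finset.sum_mul_sum]
  have step : ∀ s : Fˣ, ∑ b : ι → Fˣ, (χ ^ k₀) s * ψ s * ∏ i, (χ ^ k i) (b i) * ψ (b i) =
      ∑ a : ι → Fˣ, χ (∏ i, a i ^ k i : Fˣ) * ψ (s * (1 + ∑ i, (a i : F))) := by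
    intro s
    refine Fintype.sum_equiv (Equiv.piCongrRight fun _ => Equiv.mulLeft s⁻¹) _ _ fun b => ?_
    simp only [Equiv.piCongrRight_apply, Pi.map_apply, Equiv.coe_mulLeft]
    have h1 : (s : F) * (1 + ∑ i, ((s⁻¹ * b i : Fˣ) : F)) = s + ∑ i, (b i : F) := by
      simp [mul_add, Finset.mul_sum]
    rw [h1, AddChar.map_add_eq_mul, map_sum_eq_prod_addChar, Finset.prod_mul_distrib]
    simp only [mulChar_zpow_apply]
    have h2 : ((s ^ k₀ : Fˣ) : F) * ∏ i, ((b i ^ k i : Fˣ) : F) =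
        ((s ^ (k₀ + ∑ i, k i) : Fˣ) : F) * ((∏ i, (s⁻¹ * b i) ^ k i : Fˣ) : F) := by
      rw [← Units.coe_prod, ← Units.val_mul, ← Units.val_mul]
      congr 1
      simp only [mul_zpow, inv_zpow, Finset.prod_mul_distrib,
        Finset.prod_inv_distrib, prod_zpow_eq_zpow_sum, zpow_add]
      group
    have h4 : χ ((s ^ (k₀ + ∑ i, k i) : Fˣ) : F) = 1 := by
      rw [← mulChar_zpow_apply, h, MulChar.one_apply_coe]
    have h5 := congrArg χ h2
    rw [map_mul, map_mul, h4, one_mul, map_prod] at h5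
    rw [← h5]
    ring
  rw [Finset.sum_congr rfl fun s _ => step s, Finset.sum_comm]
  refine Finset.sum_congr rfl fun a _ => ?_
  rw [← Finset.mul_sum, sum_units_addChar_mul hψ]

variable [Fintype (MulChar F ℂ)]

theorem sum_mulChar_apply (u : Fˣ) :
    ∑ χ : MulChar F ℂ, χ u = if u = 1 then (Fintype.card F : ℂ) - 1 else 0 := by
  split_ifs with h
  · subst h
    have h1 := MulChar.card_eq_card_units_of_hasEnoughRootsOfUnity F ℂ
    rw [Nat.card_units, Nat.card_eq_fintype_card, Nat.card_eq_fintype_card] at h1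
    simp [h1, Nat.cast_sub Fintype.card_pos]
  · obtain ⟨χ', hχ'⟩ := MulChar.exists_apply_ne_one_of_hasEnoughRootsOfUnity F ℂ (a := (u : F))
      (by simpa using h)
    have h3 : ∑ χ : MulChar F ℂ, χ u = χ' u * ∑ χ : MulChar F ℂ, χ u := by
      rw [Finset.mul_sum]
      refine Fintype.sum_equiv (Equiv.mulLeft χ'⁻¹) _ _ fun χ => ?_
      rw [← MulChar.mul_apply]
      simp
    have h4 : (1 - χ' u) * ∑ χ : MulChar F ℂ, χ u = 0 := by
      rw [sub_mul, one_mul, ← h3, sub_self]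
    rcases mul_eq_zero.1 h4 with h5 | h5
    · exact absurd (sub_eq_zero.1 h5).symm hχ'
    · exact h5

/-- The double sum of χ (r ^ d u⁻¹) over χ and r is evaluated in two ways: summing over r isolates
the characters with χ ^ d = 1, summing over χ isolates the r with r ^ d = u. -/
theorem sum_torsion_mulChar_apply [DecidableEq (MulChar F ℂ)] (d : ℕ) (u : Fˣ) :
    ∑ χ : MulChar F ℂ with χ ^ d = 1, χ u = ∑ r : Fˣ, if r ^ d = u then (1 : ℂ) else 0 := by
  have hq : (Fintype.card F : ℂ) - 1 ≠ 0 := by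
    rw [sub_ne_zero]
    exact_mod_cast Fintype.one_lt_card.ne'
  have h1 : ∀ χ : MulChar F ℂ, ∑ r : Fˣ, χ (r ^ d * u⁻¹ : Fˣ) =
      if χ ^ d = 1 then ((Fintype.card F : ℂ) - 1) * χ (u⁻¹ : Fˣ) else 0 := by
    intro χ
    have h2 : ∀ r : Fˣ, χ (r ^ d * u⁻¹ : Fˣ) = (χ ^ d) r * χ (u⁻¹ : Fˣ) := fun r => by
      rw [MulChar.pow_apply_coe, Units.val_mul, map_mul, Units.val_pow_eq_pow_val, map_pow]
    rw [Finset.sum_congr rfl fun r _ => h2 r, ← Finset.sum_mul]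
    split_ifs with hχ
    · simp [hχ, Fintype.card_units, Nat.cast_sub Fintype.card_pos]
    · have h3 := MulChar.sum_eq_zero_of_ne_one hχ
      rw [sum_eq_zero_add_sum_units, MulChar.map_zero, zero_add] at h3
      rw [h3, zero_mul]
  have h4 : ∑ χ : MulChar F ℂ, ∑ r : Fˣ, χ (r ^ d * u⁻¹ : Fˣ) =
      ((Fintype.card F : ℂ) - 1) * ∑ r : Fˣ, if r ^ d = u then (1 : ℂ) else 0 := by
    rw [Finset.sum_comm, Finset.mul_sum]
    refine Finset.sum_congr rfl fun r _ => ?_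
    rw [sum_mulChar_apply]
    simp [mul_inv_eq_one]
  rw [Finset.sum_congr rfl fun χ _ => h1 χ, ← Finset.sum_filter, ← Finset.mul_sum] at h4
  rw [← mul_left_cancel₀ hq h4]
  -- Inversion preserves the torsion characters and turns χ (u⁻¹) into χ u.
  refine Finset.sum_nbij' (·⁻¹) (·⁻¹) ?_ ?_ ?_ ?_ ?_
  · intro χ hχ
    simpa using hχ
  · intro χ hχ
    simpa using hχ
  · simp
  · simp
  · intro χ _
    rw [← zpow_neg_one χ, mulChar_zpow_apply]
    simp

/-- Sums of products of Gauss sums over the `d`-torsion characters count points. -/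
theorem sum_torsion_gaussSum [DecidableEq (MulChar F ℂ)] {ψ : AddChar F ℂ} (hψ : ψ ≠ 1)
    {ι : Type*} [Fintype ι] [DecidableEq ι] (d : ℕ) (k₀ : ℤ) (k : ι → ℤ)
    (h : (d : ℤ) ∣ k₀ + ∑ i, k i) (v : Fˣ) :
    ∑ χ : MulChar F ℂ with χ ^ d = 1,
        gaussSum (χ ^ k₀) ψ * (∏ i, gaussSum (χ ^ k i) ψ) * χ v =
      ∑ a : (ι → Fˣ) × Fˣ with a.2 ^ d = v * ∏ i, a.1 i ^ k i,
        ((if 1 + ∑ i, (a.1 i : F) = 0 then (Fintype.card F : ℂ) else 0) - 1) := by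
  have h1 : ∀ χ : MulChar F ℂ, χ ^ d = 1 → gaussSum (χ ^ k₀) ψ * (∏ i, gaussSum (χ ^ k i) ψ) * χ v =
      ∑ a : ι → Fˣ, χ (v * ∏ i, a i ^ k i : Fˣ) *
        ((if 1 + ∑ i, (a i : F) = 0 then (Fintype.card F : ℂ) else 0) - 1) := by
    intro χ hχ
    obtain ⟨c, hc⟩ := h
    rw [gaussSum_mul_prod_gaussSum hψ χ k₀ k (by rw [hc, zpow_mul, zpow_natCast, hχ, one_zpow]),
      Finset.sum_mul]
    refine Finset.sum_congr rfl fun a _ => ?_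
    rw [Units.val_mul, map_mul]
    ring
  rw [Finset.sum_congr rfl fun χ hχ => h1 χ (Finset.mem_filter.1 hχ).2, Finset.sum_comm]
  simp only [← Finset.sum_mul, sum_torsion_mulChar_apply]
  rw [Finset.sum_filter, Fintype.sum_prod_type]
  refine Finset.sum_congr rfl fun a _ => ?_
  rw [Finset.sum_mul]
  simp only [ite_mul, one_mul, zero_mul]

/-- As the exponents add up to zero, every character is admissible in `gaussSum_mul_prod_gaussSum`;
orthogonality over all of them leaves one multiplicative condition. -/
theorem sum_gaussSum {ψ : AddChar F ℂ} (hψ : ψ ≠ 1)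
    {ι : Type*} [Fintype ι] [DecidableEq ι] (k₀ : ℤ) (k : ι → ℤ)
    (h : k₀ + ∑ i, k i = 0) (v : Fˣ) :
    ∑ χ : MulChar F ℂ, gaussSum (χ ^ k₀) ψ * (∏ i, gaussSum (χ ^ k i) ψ) * χ v =
      ((Fintype.card F : ℂ) - 1) * ∑ a : ι → Fˣ with v * ∏ i, a i ^ k i = 1,
        ((if 1 + ∑ i, (a i : F) = 0 then (Fintype.card F : ℂ) else 0) - 1) := by
  have h1 : ∀ χ : MulChar F ℂ, gaussSum (χ ^ k₀) ψ * (∏ i, gaussSum (χ ^ k i) ψ) * χ v =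
      ∑ a : ι → Fˣ, χ (v * ∏ i, a i ^ k i : Fˣ) *
        ((if 1 + ∑ i, (a i : F) = 0 then (Fintype.card F : ℂ) else 0) - 1) := by
    intro χ
    rw [gaussSum_mul_prod_gaussSum hψ χ k₀ k (by rw [h, zpow_zero]), Finset.sum_mul]
    refine Finset.sum_congr rfl fun a _ => ?_
    rw [Units.val_mul, map_mul]
    ring
  rw [Finset.sum_congr rfl fun χ _ => h1 χ, Finset.sum_comm]
  simp only [← Finset.sum_mul, sum_mulChar_apply]
  rw [Finset.sum_filter, Finset.mul_sum]
  refine Finset.sum_congr rfl fun a _ => ?_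
  split_ifs <;> simp

end CharacterSums

end FiniteHypergeometric

namespace FiniteHypergeometric

/-! ### Gauss sums for the equation of the surface and for its coordinate sections -/

theorem sum_ite_sub_one {T : Type*} [Fintype T] (P : T → Prop) [DecidablePred P] (q : ℂ) :
    ∑ x : T, ((if P x then q else 0) - 1) = q * ∑ x, (if P x then (1 : ℂ) else 0) - Fintype.card T := by
  rw [Finset.sum_sub_distrib, Finset.mul_sum]
  simp only [mul_ite, mul_one, mul_zero, Finset.sum_const, Finset.card_univ, nsmul_eq_mul]

/-- Transport of the sums obtained from Gauss sums along a parametrization of their index set. -/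
theorem sum_filter_ite_eq {S T : Type*} [Fintype S] [Fintype T] {A : S → Prop} [DecidablePred A]
    {B : S → Prop} [DecidablePred B] {P : T → Prop} [DecidablePred P] (q : ℂ)
    (i : S → T) (j : T → S) (hj : ∀ t, A (j t)) (hij : ∀ s, A s → j (i s) = s)
    (hji : ∀ t, i (j t) = t) (hB : ∀ t, B (j t) ↔ P t) :
    ∑ s : S with A s, ((if B s then q else 0) - 1) =
      q * ∑ t, (if P t then (1 : ℂ) else 0) - Fintype.card T := by
  rw [← sum_ite_sub_one]
  refine Finset.sum_nbij' i j (by simp) (by simpa using hj) (by simpa using hij)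
    (by simpa using hji) fun s hs => ?_
  have := hB (i s)
  rw [hij s (by simpa using hs)] at this
  simp only [this]

section PointCounts

variable {F : Type u} [Field F] [Fintype F] 

variable [DecidableEq F]

theorem card_units_complex : (Fintype.card Fˣ : ℂ) = (Fintype.card F : ℂ) - 1 := by
  rw [Fintype.card_units, Nat.cast_sub Fintype.card_pos, Nat.cast_one]

variable [Fintype (MulChar F ℂ)] {ψ : AddChar F ℂ} (lam : Fˣ)

/-- The index set is parametrised by V_λ: a 0, -a 1, -a 2, -a 3 are the monomials λ⁻¹/(xyz), y/(xz),
x²/(yz), z⁴/(xy), and 1 + ∑ a = 0 is the equation of the surface divided by -xyz. -/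
theorem sum_gaussSum_surface (hψ : ψ ≠ 1) :
    ∑ χ : MulChar F ℂ, gaussSum (χ ^ (30 : ℤ)) ψ *
      (gaussSum χ ψ * gaussSum (χ ^ (-15 : ℤ)) ψ * gaussSum (χ ^ (-10 : ℤ)) ψ *
        gaussSum (χ ^ (-6 : ℤ)) ψ) * χ (-lam : Fˣ) =
    ((Fintype.card F : ℂ) - 1) * (Fintype.card F * ∑ v : Fˣ × Fˣ × Fˣ,
      (if (v.2.1 ^ 2 - v.1 * v.2.1 * v.2.2 + v.1 ^ 3 + v.2.2 ^ 5 - (lam⁻¹ : Fˣ) : F) = 0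
        then (1 : ℂ) else 0) - ((Fintype.card F : ℂ) - 1) ^ 3) := by
  have h := sum_gaussSum hψ (30 : ℤ) (![1, -15, -10, -6] : Fin 4 → ℤ)
    (by simp [Fin.sum_univ_four]) (-lam)
  simp only [Fin.prod_univ_four, Fin.sum_univ_four, Matrix.cons_val, zpow_one] at h
  rw [h]
  congr 1
  have h2 := sum_filter_ite_eq (S := Fin 4 → Fˣ) (T := Fˣ × Fˣ × Fˣ)
    (A := fun a => -lam * (a 0 * a 1 ^ (-15 : ℤ) * a 2 ^ (-10 : ℤ) * a 3 ^ (-6 : ℤ)) = 1)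
    (B := fun a => 1 + ((a 0 : F) + a 1 + a 2 + a 3) = 0)
    (P := fun v => (v.2.1 ^ 2 - v.1 * v.2.1 * v.2.2 + v.1 ^ 3 + v.2.2 ^ 5 - (lam⁻¹ : Fˣ) : F) = 0)
    (Fintype.card F : ℂ)
    -- The exponents are the entries of the rays `ray (1, j)`, whose matrix is inverse to the
    -- exponent matrix of y/(xz), x²/(yz), z⁴/(xy).
    (fun a => (((-a 1) ^ 5 * (-a 2) ^ 3 * (-a 3) ^ 2)⁻¹, ((-a 1) ^ 7 * (-a 2) ^ 5 * (-a 3) ^ 3)⁻¹,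
      ((-a 1) ^ 3 * (-a 2) ^ 2 * (-a 3))⁻¹))
    (fun v => ![lam⁻¹ * (v.1 * v.2.1 * v.2.2)⁻¹, -(v.2.1 * (v.1 * v.2.2)⁻¹),
      -(v.1 ^ 2 * (v.2.1 * v.2.2)⁻¹), -(v.2.2 ^ 4 * (v.1 * v.2.1)⁻¹)])
    ?_ ?_ ?_ ?_
  · rw [h2]
    congr 1
    simp only [Fintype.card_prod, Nat.cast_mul, card_units_complex]
    ring
  · rintro ⟨x, y, z⟩
    simp only [Matrix.cons_val]
    ext
    push_cast
    simp only [zpow_neg]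
    norm_cast
    push_cast
    field_simp
  · intro a ha
    have ha0 : a 0 = -(lam⁻¹ * (a 1 ^ 15 * a 2 ^ 10 * a 3 ^ 6)) := by
      ext
      have := congrArg Units.val ha
      push_cast at this ⊢
      simp only [zpow_neg] at this
      norm_cast at this
      push_cast at this
      field_simp at this ⊢
      linear_combination -this
    funext i
    fin_cases i
    · simp only [Fin.zero_eta, Matrix.cons_val]
      rw [ha0]
      ext
      push_cast
      field_simp
    all_goals
      simp only [Fin.mk_one, Fin.reduceFinMk, Matrix.cons_val]
      ext
      push_cast
      field_simp
  · rintro ⟨x, y, z⟩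
    simp only [Matrix.cons_val]
    refine Prod.ext ?_ (Prod.ext ?_ ?_) <;>
    · ext
      push_cast
      field_simp
  · rintro ⟨x, y, z⟩
    simp only [Matrix.cons_val]
    push_cast
    rw [← mul_right_inj' (a := -(x * y * z : F)) (b := 1 + _) (by simp), mul_zero]
    refine Eq.congr ?_ rfl
    field_simp
    ring

/-- For d = 2, 3, 5 these are the points on the coordinate axes. The torsion variable is x⁻¹, and a
= -λ x ^ d. -/
theorem sum_torsion_gaussSum_single [DecidableEq (MulChar F ℂ)] (hψ : ψ ≠ 1) (d : ℕ) :
    ∑ χ : MulChar F ℂ with χ ^ d = 1,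
      gaussSum χ ψ * gaussSum (χ ^ (-1 : ℤ)) ψ * χ (-lam : Fˣ) =
    Fintype.card F * ∑ x : Fˣ, (if (x ^ d - (lam⁻¹ : Fˣ) : F) = 0 then (1 : ℂ) else 0) -
      ((Fintype.card F : ℂ) - 1) := by
  have h := sum_torsion_gaussSum hψ d (1 : ℤ) (![-1] : Fin 1 → ℤ) (by simp) (-lam)
  simp only [Fin.prod_univ_one, Fin.sum_univ_one, Matrix.cons_val, zpow_one] at h
  rw [h]
  have h2 := sum_filter_ite_eq (S := (Fin 1 → Fˣ) × Fˣ) (T := Fˣ)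
    (A := fun a => a.2 ^ d = -lam * a.1 0 ^ (-1 : ℤ))
    (B := fun a => 1 + (a.1 0 : F) = 0)
    (P := fun x => (x ^ d - (lam⁻¹ : Fˣ) : F) = 0)
    (Fintype.card F : ℂ)
    (fun a => a.2⁻¹) (fun x => (![-lam * x ^ d], x⁻¹)) ?_ ?_ ?_ ?_
  · rw [h2, card_units_complex]
  · intro x
    simp
  · intro a ha
    refine Prod.ext ?_ (by simp)
    funext i
    fin_cases i
    simp only [inv_pow, ha]
    simp
  · simp
  · intro x
    simp only [Matrix.cons_val]
    push_cast
    rw [← mul_right_inj' (a := -(lam : F)) (b := (x : F) ^ d - _) (by simp), mul_zero]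
    refine Eq.congr ?_ rfl
    field_simp
    ring

/-- These are the points with z = 0. The two terms -λ y² and -λ x³ do not determine (x, y); the
torsion variable r = λ x y supplies what is missing. -/
theorem sum_torsion_gaussSum_six [DecidableEq (MulChar F ℂ)] (hψ : ψ ≠ 1) :
    ∑ χ : MulChar F ℂ with χ ^ 6 = 1,
      gaussSum χ ψ * (gaussSum (χ ^ (3 : ℤ)) ψ * gaussSum (χ ^ (2 : ℤ)) ψ) * χ (-lam : Fˣ) =
    Fintype.card F * ∑ v : Fˣ × Fˣ, (if (v.2 ^ 2 + v.1 ^ 3 - (lam⁻¹ : Fˣ) : F) = 0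
      then (1 : ℂ) else 0) - ((Fintype.card F : ℂ) - 1) ^ 2 := by
  have h := sum_torsion_gaussSum hψ 6 (1 : ℤ) (![3, 2] : Fin 2 → ℤ) (by simp) (-lam)
  simp only [Fin.prod_univ_two, Fin.sum_univ_two, Matrix.cons_val, zpow_one] at h
  rw [h]
  have h2 := sum_filter_ite_eq (S := (Fin 2 → Fˣ) × Fˣ) (T := Fˣ × Fˣ)
    (A := fun a => a.2 ^ 6 = -lam * (a.1 0 ^ (3 : ℤ) * a.1 1 ^ (2 : ℤ)))
    (B := fun a => 1 + ((a.1 0 : F) + a.1 1) = 0)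
    (P := fun v => (v.2 ^ 2 + v.1 ^ 3 - (lam⁻¹ : Fˣ) : F) = 0)
    (Fintype.card F : ℂ)
    (fun a => (a.1 0 * a.1 1 * (a.2 ^ 2)⁻¹, a.2 ^ 3 * (lam * a.1 0 * a.1 1)⁻¹))
    (fun v => (![-lam * v.2 ^ 2, -lam * v.1 ^ 3], lam * v.1 * v.2)) ?_ ?_ ?_ ?_
  · rw [h2]
    congr 1
    simp only [Fintype.card_prod, Nat.cast_mul, card_units_complex]
    ring
  · rintro ⟨x, y⟩
    simp only [Matrix.cons_val]
    norm_cast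
    ext
    push_cast
    ring
  · rintro ⟨a, r⟩ ha
    simp only at ha ⊢
    norm_cast at ha
    have ha' := congrArg Units.val ha
    push_cast at ha'
    refine Prod.ext ?_ ?_
    · funext i
      fin_cases i
      · simp only [Fin.zero_eta, Matrix.cons_val]
        ext
        push_cast
        field_simp
        linear_combination -ha'
      · simp only [Fin.mk_one, Matrix.cons_val]
        ext
        push_cast
        field_simp
        linear_combination -ha'
    · ext
      push_cast
      field_simp
  · rintro ⟨x, y⟩
    simp only [Matrix.cons_val]
    refine Prod.ext ?_ ?_ <;>
    · ext
      push_cast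
      field_simp
  · rintro ⟨x, y⟩
    simp only [Matrix.cons_val]
    push_cast
    rw [← mul_right_inj' (a := -(lam : F)) (b := (y : F) ^ 2 + _ - _) (by simp), mul_zero]
    refine Eq.congr ?_ rfl
    field_simp
    ring

/-- The points with x = 0, recovered from -λ y², -λ z⁵ and the torsion variable r = λ y z². -/
theorem sum_torsion_gaussSum_ten [DecidableEq (MulChar F ℂ)] (hψ : ψ ≠ 1) :
    ∑ χ : MulChar F ℂ with χ ^ 10 = 1,
      gaussSum χ ψ * (gaussSum (χ ^ (5 : ℤ)) ψ * gaussSum (χ ^ (4 : ℤ)) ψ) * χ (-lam : Fˣ) =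
    Fintype.card F * ∑ v : Fˣ × Fˣ, (if (v.1 ^ 2 + v.2 ^ 5 - (lam⁻¹ : Fˣ) : F) = 0
      then (1 : ℂ) else 0) - ((Fintype.card F : ℂ) - 1) ^ 2 := by
  have h := sum_torsion_gaussSum hψ 10 (1 : ℤ) (![5, 4] : Fin 2 → ℤ) (by simp) (-lam)
  simp only [Fin.prod_univ_two, Fin.sum_univ_two, Matrix.cons_val, zpow_one] at h
  rw [h]
  have h2 := sum_filter_ite_eq (S := (Fin 2 → Fˣ) × Fˣ) (T := Fˣ × Fˣ)
    (A := fun a => a.2 ^ 10 = -lam * (a.1 0 ^ (5 : ℤ) * a.1 1 ^ (4 : ℤ)))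
    (B := fun a => 1 + ((a.1 0 : F) + a.1 1) = 0)
    (P := fun v => (v.1 ^ 2 + v.2 ^ 5 - (lam⁻¹ : Fˣ) : F) = 0)
    (Fintype.card F : ℂ)
    (fun a => (a.2 * (a.2 ^ 2 * (a.1 0 * a.1 1)⁻¹) ^ 2 * lam⁻¹, a.1 0 * a.1 1 * (a.2 ^ 2)⁻¹))
    (fun v => (![-lam * v.1 ^ 2, -lam * v.2 ^ 5], lam * v.1 * v.2 ^ 2)) ?_ ?_ ?_ ?_
  · rw [h2]
    congr 1
    simp only [Fintype.card_prod, Nat.cast_mul, card_units_complex]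
    ring
  · rintro ⟨x, y⟩
    simp only [Matrix.cons_val]
    norm_cast
    ext
    push_cast
    ring
  · rintro ⟨a, r⟩ ha
    simp only at ha ⊢
    norm_cast at ha
    have ha' := congrArg Units.val ha
    push_cast at ha'
    refine Prod.ext ?_ ?_
    · funext i
      fin_cases i
      · simp only [Fin.zero_eta, Matrix.cons_val]
        ext
        push_cast
        field_simp
        linear_combination -ha'
      · simp only [Fin.mk_one, Matrix.cons_val]
        ext
        push_cast
        field_simp
        linear_combination -ha'
    · ext
      push_cast
      field_simp
  · rintro ⟨x, y⟩
    simp only [Matrix.cons_val]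
    refine Prod.ext ?_ ?_ <;>
    · ext
      push_cast
      field_simp
  · rintro ⟨x, y⟩
    simp only [Matrix.cons_val]
    push_cast
    rw [← mul_right_inj' (a := -(lam : F)) (b := (x : F) ^ 2 + _ - _) (by simp), mul_zero]
    refine Eq.congr ?_ rfl
    field_simp
    ring

/-- The points with y = 0, recovered from -λ x³, -λ z⁵ and the torsion variable r = x / z². -/
theorem sum_torsion_gaussSum_fifteen [DecidableEq (MulChar F ℂ)] (hψ : ψ ≠ 1) :
    ∑ χ : MulChar F ℂ with χ ^ 15 = 1,
      gaussSum χ ψ * (gaussSum (χ ^ (5 : ℤ)) ψ * gaussSum (χ ^ (-6 : ℤ)) ψ) * χ (-lam : Fˣ) =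
    Fintype.card F * ∑ v : Fˣ × Fˣ, (if (v.1 ^ 3 + v.2 ^ 5 - (lam⁻¹ : Fˣ) : F) = 0
      then (1 : ℂ) else 0) - ((Fintype.card F : ℂ) - 1) ^ 2 := by
  have h := sum_torsion_gaussSum hψ 15 (1 : ℤ) (![5, -6] : Fin 2 → ℤ) (by simp) (-lam)
  simp only [Fin.prod_univ_two, Fin.sum_univ_two, Matrix.cons_val, zpow_one] at h
  rw [h]
  have h2 := sum_filter_ite_eq (S := (Fin 2 → Fˣ) × Fˣ) (T := Fˣ × Fˣ)
    (A := fun a => a.2 ^ 15 = -lam * (a.1 0 ^ (5 : ℤ) * a.1 1 ^ (-6 : ℤ)))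
    (B := fun a => 1 + ((a.1 0 : F) + a.1 1) = 0)
    (P := fun v => (v.1 ^ 3 + v.2 ^ 5 - (lam⁻¹ : Fˣ) : F) = 0)
    (Fintype.card F : ℂ)
    (fun a => (a.2 * (a.1 0 * (a.1 1 * a.2 ^ 3)⁻¹) ^ 2, a.1 0 * (a.1 1 * a.2 ^ 3)⁻¹))
    (fun v => (![-lam * v.1 ^ 3, -lam * v.2 ^ 5], v.1 * (v.2 ^ 2)⁻¹)) ?_ ?_ ?_ ?_
  · rw [h2]
    congr 1
    simp only [Fintype.card_prod, Nat.cast_mul, card_units_complex]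
    ring
  · rintro ⟨x, y⟩
    simp only [Matrix.cons_val, zpow_neg]
    norm_cast
    ext
    push_cast
    field_simp
  · rintro ⟨a, r⟩ ha
    simp only [zpow_neg] at ha ⊢
    norm_cast at ha
    have ha' := congrArg Units.val ha
    push_cast at ha'
    field_simp at ha'
    refine Prod.ext ?_ ?_
    · funext i
      fin_cases i
      · simp only [Fin.zero_eta, Matrix.cons_val]
        ext
        push_cast
        field_simp
        linear_combination -ha'
      · simp only [Fin.mk_one, Matrix.cons_val]
        ext
        push_cast
        field_simp
        linear_combination -ha'
    · ext
      push_cast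
      field_simp
  · rintro ⟨x, y⟩
    simp only [Matrix.cons_val]
    refine Prod.ext ?_ ?_ <;>
    · ext
      push_cast
      field_simp
  · rintro ⟨x, y⟩
    simp only [Matrix.cons_val]
    push_cast
    rw [← mul_right_inj' (a := -(lam : F)) (b := (x : F) ^ 3 + _ - _) (by simp), mul_zero]
    refine Eq.congr ?_ rfl
    field_simp
    ring

end PointCounts

end FiniteHypergeometric

namespace FiniteHypergeometric

/-! ### The hypergeometric sum and the affine surface -/

theorem rootMultiplicity_X_pow_sub_one {n : ℕ} (hn : 0 < n) (z : ℂ) :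
    (X ^ n - 1 : ℂ[X]).rootMultiplicity z = if z ^ n = 1 then 1 else 0 := by
  have h0 : (X ^ n - 1 : ℂ[X]) ≠ 0 := X_pow_sub_C_ne_zero hn 1
  have hroot : (X ^ n - 1 : ℂ[X]).IsRoot z ↔ z ^ n = 1 := by
    simp [IsRoot, sub_eq_zero]
  split_ifs with h
  · refine le_antisymm ?_ ((rootMultiplicity_pos h0).2 (hroot.2 h))
    by_contra! h2
    have h3 := ((one_lt_rootMultiplicity_iff_isRoot h0).1 h2).2
    have hz : z ≠ 0 := by
      rintro rfl
      rw [zero_pow hn.ne'] at h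
      exact zero_ne_one h
    rw [derivative_sub, derivative_one, sub_zero, derivative_X_pow] at h3
    simp [IsRoot, hn.ne', hz] at h3
  · rw [rootMultiplicity_eq_zero]
    exact fun h' => h (hroot.1 h')

theorem rootMultiplicity_gcd [DecidableEq ℂ[X]] {A B : ℂ[X]} (hA : A ≠ 0) (hB : B ≠ 0) (z : ℂ) :
    (EuclideanDomain.gcd A B).rootMultiplicity z =
      min (A.rootMultiplicity z) (B.rootMultiplicity z) := by
  have h0 : EuclideanDomain.gcd A B ≠ 0 := fun h => hA (EuclideanDomain.gcd_eq_zero_iff.1 h).1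
  refine le_antisymm (le_min ?_ ?_) ?_
  · rw [le_rootMultiplicity_iff hA]
    exact (pow_rootMultiplicity_dvd _ _).trans (EuclideanDomain.gcd_dvd_left _ _)
  · rw [le_rootMultiplicity_iff hB]
    exact (pow_rootMultiplicity_dvd _ _).trans (EuclideanDomain.gcd_dvd_right _ _)
  · rw [le_rootMultiplicity_iff h0]
    exact EuclideanDomain.dvd_gcd
      ((pow_dvd_pow _ (min_le_left _ _)).trans (pow_rootMultiplicity_dvd _ _))
      ((pow_dvd_pow _ (min_le_right _ _)).trans (pow_rootMultiplicity_dvd _ _))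

theorem mult_surfaceData (Q m : ℕ) :
    surfaceData.mult Q m =
      let z := rootOfUnity ((m : ℚ) / ((Q : ℚ) - 1))
      min ((if z ^ 30 = 1 then 1 else 0) + if z ^ 1 = 1 then 1 else 0)
        ((if z ^ 15 = 1 then 1 else 0) + ((if z ^ 10 = 1 then 1 else 0) +
          if z ^ 6 = 1 then 1 else 0)) := by
  have h1 : ∀ n : ℕ, 0 < n → (X ^ n - 1 : ℂ[X]) ≠ 0 := fun n hn => X_pow_sub_C_ne_zero hn 1
  have hA := mul_ne_zero (h1 30 (by norm_num)) (h1 1 (by norm_num))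
  have hB' := mul_ne_zero (h1 10 (by norm_num)) (h1 6 (by norm_num))
  have hB := mul_ne_zero (h1 15 (by norm_num)) hB'
  simp only [RationalData.mult, RationalData.commonDivisor, surfaceData, List.map_cons, List.map_nil,
    List.prod_cons, List.prod_nil, mul_one]
  rw [rootMultiplicity_gcd hA hB, rootMultiplicity_mul hA, rootMultiplicity_mul hB,
    rootMultiplicity_mul hB']
  simp only [rootMultiplicity_X_pow_sub_one, Nat.zero_lt_succ]

theorem rootOfUnity_pow_eq_one_iff {Q : ℕ} (hQ : 1 < Q) (m k : ℕ) :
    rootOfUnity ((m : ℚ) / ((Q : ℚ) - 1)) ^ k = 1 ↔ Q - 1 ∣ m * k := by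
  have h1 : ((Q : ℚ) - 1) = ((Q - 1 : ℕ) : ℚ) := by
    rw [Nat.cast_sub hQ.le, Nat.cast_one]
  rw [h1, rootOfUnity_div, ← pow_mul]
  exact (Complex.isPrimitiveRoot_exp (Q - 1) (by omega)).pow_eq_one_iff_dvd _

section

variable {F : Type u} [Field F] [Fintype F]

theorem orderOf_mulChar_of_forall_mem_zpowers {ω : MulChar F ℂ}
    (hω : ∀ χ : MulChar F ℂ, χ ∈ Subgroup.zpowers ω) : orderOf ω = Fintype.card F - 1 := by
  rw [orderOf_eq_card_of_forall_mem_zpowers hω,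
    MulChar.card_eq_card_units_of_hasEnoughRootsOfUnity F ℂ, Nat.card_units,
    Nat.card_eq_fintype_card]

open Classical in
/-- The multiplicity `s(m)` in terms of the character `ω ^ m`. -/
theorem mult_surfaceData_eq {ω : MulChar F ℂ} (hω : ∀ χ : MulChar F ℂ, χ ∈ Subgroup.zpowers ω)
    (m : ℕ) :
    surfaceData.mult (Fintype.card F) m =
      if orderOf (ω ^ m) = 1 then 2 else if orderOf (ω ^ m) ∣ 6 ∨ orderOf (ω ^ m) ∣ 10 ∨
        orderOf (ω ^ m) ∣ 15 then 1 else 0 := by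
  have key : ∀ k : ℕ, rootOfUnity ((m : ℚ) / ((Fintype.card F : ℚ) - 1)) ^ k = 1 ↔
      orderOf (ω ^ m) ∣ k := fun k => by
    rw [rootOfUnity_pow_eq_one_iff Fintype.one_lt_card, orderOf_dvd_iff_pow_eq_one, ← pow_mul,
      ← orderOf_dvd_iff_pow_eq_one, orderOf_mulChar_of_forall_mem_zpowers hω]
  rw [mult_surfaceData]
  simp only [key, Nat.dvd_one]
  set n := orderOf (ω ^ m)
  by_cases h1 : n = 1
  · simp [h1]
  · have h6 : n ∣ 6 → n ∣ 30 := fun h => h.trans (by norm_num)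
    have h10 : n ∣ 10 → n ∣ 30 := fun h => h.trans (by norm_num)
    have h15 : n ∣ 15 → n ∣ 30 := fun h => h.trans (by norm_num)
    by_cases a : n ∣ 6 <;> by_cases b : n ∣ 10 <;> by_cases c : n ∣ 15 <;> by_cases d : n ∣ 30 <;>
      simp_all

/-- The product of Gauss sums occurring in the hypergeometric sum. -/
noncomputable def gaussProduct (ψ : AddChar F ℂ) (χ : MulChar F ℂ) : ℂ :=
  gaussSum (χ ^ (30 : ℤ)) ψ * (gaussSum χ ψ * gaussSum (χ ^ (-15 : ℤ)) ψ *
    gaussSum (χ ^ (-10 : ℤ)) ψ * gaussSum (χ ^ (-6 : ℤ)) ψ)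

open Classical in
/-- The power of `q` attached to a character in the hypergeometric sum. -/
noncomputable def charWeight (χ : MulChar F ℂ) : ℂ :=
  if orderOf χ = 1 then (Fintype.card F : ℂ) ^ 2 else
    if orderOf χ ∣ 6 ∨ orderOf χ ∣ 10 ∨ orderOf χ ∣ 15 then (Fintype.card F : ℂ) else 1

open Classical in
-- An order dividing two of 6, 10, 15 divides their gcd 2, 3 or 5, and one dividing all three is 1.
-- Inclusion-exclusion therefore gives 1 on the union of the three torsion groups away from the
-- trivial character, where the bracket must be q + 1 because q² = 1 + (q - 1)(q + 1).
theorem charWeight_eq (χ : MulChar F ℂ) :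
    charWeight χ = 1 + ((Fintype.card F : ℂ) - 1) * ((if χ ^ 6 = 1 then 1 else 0) +
      (if χ ^ 10 = 1 then 1 else 0) + (if χ ^ 15 = 1 then 1 else 0) -
      (if χ ^ 2 = 1 then 1 else 0) - (if χ ^ 3 = 1 then 1 else 0) -
      (if χ ^ 5 = 1 then 1 else 0) + (Fintype.card F + 1) * (if χ = 1 then 1 else 0)) := by
  rw [charWeight]
  simp only [← orderOf_dvd_iff_pow_eq_one, ← orderOf_eq_one_iff (x := χ)]
  set n := orderOf χ
  have h2 : n ∣ 2 ↔ n ∣ 6 ∧ n ∣ 10 := (Nat.dvd_gcd_iff (m := 6) (n := 10))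
  have h3 : n ∣ 3 ↔ n ∣ 6 ∧ n ∣ 15 := (Nat.dvd_gcd_iff (m := 6) (n := 15))
  have h5 : n ∣ 5 ↔ n ∣ 10 ∧ n ∣ 15 := (Nat.dvd_gcd_iff (m := 10) (n := 15))
  have h1 : n = 1 ↔ n ∣ 6 ∧ n ∣ 10 ∧ n ∣ 15 := by
    rw [← h5, ← Nat.dvd_gcd_iff, ← Nat.dvd_one]
    rfl
  by_cases a : n ∣ 6 <;> by_cases b : n ∣ 10 <;> by_cases c : n ∣ 15 <;>
    simp only [h1, h2, h3, h5, a, b, c, and_true, and_false, or_true, or_false, if_true, if_false] <;>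
    ring

theorem scale_surfaceData (hq : (Fintype.card F).Coprime 30) :
    (surfaceData.scale F = 2 ^ 14 * 3 ^ 9 * 5 ^ 5) ∧ (surfaceData.scale F ≠ 0) := by
  have hne : ∀ n : ℕ, n ∣ 30 → 1 < n → (n : F) ≠ 0 := by
    intro n hn h1 h0
    obtain ⟨p, hp⟩ := CharP.exists F
    obtain ⟨f, hpp, hf⟩ := FiniteField.card F p
    have h2 : p ∣ 30 := ((CharP.cast_eq_zero_iff F p n).1 h0).trans hn
    have h3 : p ∣ Fintype.card F := by
      rw [hf]
      exact dvd_pow_self _ f.pos.ne'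
    have := Nat.dvd_gcd h3 h2
    rw [hq, Nat.dvd_one] at this
    exact hpp.ne_one this
  have h2 : (2 : F) ≠ 0 := by exact_mod_cast hne 2 (by norm_num) (by norm_num)
  have h3 : (3 : F) ≠ 0 := by exact_mod_cast hne 3 (by norm_num) (by norm_num)
  have h5 : (5 : F) ≠ 0 := by exact_mod_cast hne 5 (by norm_num) (by norm_num)
  have h : surfaceData.scale F = 2 ^ 14 * 3 ^ 9 * 5 ^ 5 := by
    simp only [RationalData.scale, surfaceData, List.map_cons, List.map_nil,
      List.prod_cons, List.prod_nil, mul_one]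
    push_cast
    rw [show (30 : F) = 2 * 3 * 5 by norm_num, show (15 : F) = 3 * 5 by norm_num,
      show (10 : F) = 2 * 5 by norm_num, show (6 : F) = 2 * 3 by norm_num]
    field_simp
  refine ⟨h, ?_⟩
  rw [h]
  positivity

/-- The powers ω ^ m with 0 ≤ m < q - 1 run through all characters once. The factor q² clears s(0) =
2, the sign (-1)^5 turns 1 - q into q - 1, and ε = (-1)^31 puts -λ into the character. -/
theorem hypergeometric_eq [Fintype (MulChar F ℂ)] (hq : (Fintype.card F).Coprime 30)
    (ψ : AddChar F ℂ) {ω : MulChar F ℂ} (hω : ∀ χ : MulChar F ℂ, χ ∈ Subgroup.zpowers ω)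
    (lam : Fˣ) :
    ((Fintype.card F : ℂ) - 1) * (Fintype.card F : ℂ) ^ 2 *
        surfaceData.H ψ ω (2 ^ 14 * 3 ^ 9 * 5 ^ 5 * lam) =
      ∑ χ : MulChar F ℂ, charWeight χ * gaussProduct ψ χ * χ (-lam : Fˣ) := by
  classical
  obtain ⟨hs, hs0⟩ := scale_surfaceData (F := F) hq
  have hq0 : (Fintype.card F : ℂ) ≠ 0 := by exact_mod_cast Fintype.card_ne_zero
  have hq1 : (1 - Fintype.card F : ℂ) ≠ 0 := by
    rw [sub_ne_zero]
    exact_mod_cast Fintype.one_lt_card.ne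
  have harg : surfaceData.sign F * (surfaceData.scale F)⁻¹ * (2 ^ 14 * 3 ^ 9 * 5 ^ 5 * lam) =
      ((-lam : Fˣ) : F) := by
    rw [← hs, mul_assoc, inv_mul_cancel_left₀ hs0]
    simp only [RationalData.sign, surfaceData, List.sum_cons, List.sum_nil, Units.val_neg]
    norm_num
  rw [← IsCyclic.image_range_orderOf hω, Finset.sum_image (fun m hm n hn h =>
    pow_injOn_Iio_orderOf (by simpa using hm) (by simpa using hn) h),
    orderOf_mulChar_of_forall_mem_zpowers hω]
  have hmult0 : surfaceData.mult (Fintype.card F) 0 = 2 := by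
    rw [mult_surfaceData_eq hω]
    simp
  have hterm : ∀ m : ℕ, (Fintype.card F : ℂ) ^ ((surfaceData.mult (Fintype.card F) m : ℤ) -
      (surfaceData.mult (Fintype.card F) 0 : ℤ)) =
      charWeight (ω ^ m) * ((Fintype.card F : ℂ) ^ 2)⁻¹ := by
    intro m
    rw [hmult0, zpow_sub₀ hq0, mult_surfaceData_eq hω, charWeight, div_eq_mul_inv]
    congr 1
    split_ifs <;> simp
  rw [RationalData.H, harg]
  simp only [hterm]
  rw [mul_comm (_ / _), ← mul_assoc, Finset.mul_sum, Finset.sum_mul]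
  refine Finset.sum_congr rfl fun m _ => ?_
  have hpow : ∀ k : ℤ, (ω ^ m) ^ k = ω ^ (k * m) := fun k => by
    rw [← zpow_natCast, ← zpow_mul, mul_comm]
  have hpow' : ω ^ ((1 : ℕ) * (m : ℤ)) = ω ^ m := by
    rw [← zpow_natCast]
    simp
  rw [gaussProduct, MulChar.pow_apply_coe]
  simp only [hpow, surfaceData, bind_pure_comp, List.map_eq_map, List.map_cons, List.map_nil,
    List.prod_cons, List.prod_nil, hpow', List.length_cons, List.length_nil]
  push_cast
  field_simp
  ring

/-- The points are sorted by which coordinates vanish; c ≠ 0 excludes the origin. -/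
theorem card_surfacePoints_eq_sum [DecidableEq F] (c : F) (hc : c ≠ 0) :
    (Nat.card (surfacePoints c) : ℂ) =
      ∑ v : Fˣ × Fˣ × Fˣ, (if (v.2.1 ^ 2 - v.1 * v.2.1 * v.2.2 + v.1 ^ 3 + v.2.2 ^ 5 - c : F) = 0
        then (1 : ℂ) else 0) +
      ∑ v : Fˣ × Fˣ, (if (v.2 ^ 2 + v.1 ^ 3 - c : F) = 0 then (1 : ℂ) else 0) +
      ∑ v : Fˣ × Fˣ, (if (v.1 ^ 2 + v.2 ^ 5 - c : F) = 0 then (1 : ℂ) else 0) +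
      ∑ v : Fˣ × Fˣ, (if (v.1 ^ 3 + v.2 ^ 5 - c : F) = 0 then (1 : ℂ) else 0) +
      ∑ x : Fˣ, (if (x ^ 2 - c : F) = 0 then (1 : ℂ) else 0) +
      ∑ x : Fˣ, (if (x ^ 3 - c : F) = 0 then (1 : ℂ) else 0) +
      ∑ x : Fˣ, (if (x ^ 5 - c : F) = 0 then (1 : ℂ) else 0) := by
  have h : (Nat.card (surfacePoints c) : ℂ) = ∑ v : F × F × F,
      if v.2.1 ^ 2 - v.1 * v.2.1 * v.2.2 + v.1 ^ 3 + v.2.2 ^ 5 - c = 0 then (1 : ℂ) else 0 := by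
    rw [← Finset.natCast_card_filter, ← Nat.subtype_card _ fun v => ?_]
    simp [surfacePoints]
  rw [h]
  simp only [Fintype.sum_prod_type]
  simp only [sum_eq_zero_add_sum_units (F := F), Finset.sum_add_distrib]
  have hc' : -c ≠ 0 := neg_ne_zero.2 hc
  simp [hc]
  ring

/-- Exponents matter only modulo 6. Two of the five characters become trivial and contribute -1
each, so no sign remains; the same happens for 10 and 15. -/
theorem gaussProduct_of_pow_six {ψ : AddChar F ℂ} (hψ : ψ ≠ 1) {χ : MulChar F ℂ} (h : χ ^ 6 = 1) :
    gaussProduct ψ χ =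
      gaussSum χ ψ * (gaussSum (χ ^ (3 : ℤ)) ψ * gaussSum (χ ^ (2 : ℤ)) ψ) := by
  classical
  have h' : χ ^ (6 : ℤ) = 1 := by exact_mod_cast h
  rw [gaussProduct, show (30 : ℤ) = 6 * 5 by norm_num, show (-15 : ℤ) = 6 * (-3) + 3 by norm_num,
    show (-10 : ℤ) = 6 * (-2) + 2 by norm_num, show (-6 : ℤ) = 6 * (-1) by norm_num]
  simp only [zpow_add, zpow_mul, h', one_zpow, one_mul, gaussSum_one_eq hψ]
  ring

theorem gaussProduct_of_pow_ten {ψ : AddChar F ℂ} (hψ : ψ ≠ 1) {χ : MulChar F ℂ} (h : χ ^ 10 = 1) :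
    gaussProduct ψ χ =
      gaussSum χ ψ * (gaussSum (χ ^ (5 : ℤ)) ψ * gaussSum (χ ^ (4 : ℤ)) ψ) := by
  classical
  have h' : χ ^ (10 : ℤ) = 1 := by exact_mod_cast h
  rw [gaussProduct, show (30 : ℤ) = 10 * 3 by norm_num, show (-15 : ℤ) = 10 * (-2) + 5 by norm_num,
    show (-10 : ℤ) = 10 * (-1) by norm_num, show (-6 : ℤ) = 10 * (-1) + 4 by norm_num]
  simp only [zpow_add, zpow_mul, h', one_zpow, one_mul, gaussSum_one_eq hψ]
  ring

theorem gaussProduct_of_pow_fifteen {ψ : AddChar F ℂ} (hψ : ψ ≠ 1) {χ : MulChar F ℂ}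
    (h : χ ^ 15 = 1) :
    gaussProduct ψ χ =
      gaussSum χ ψ * (gaussSum (χ ^ (5 : ℤ)) ψ * gaussSum (χ ^ (-6 : ℤ)) ψ) := by
  classical
  have h' : χ ^ (15 : ℤ) = 1 := by exact_mod_cast h
  rw [gaussProduct, show (30 : ℤ) = 15 * 2 by norm_num, show (-15 : ℤ) = 15 * (-1) by norm_num,
    show (-10 : ℤ) = 15 * (-1) + 5 by norm_num]
  simp only [zpow_add, zpow_mul, h', one_zpow, one_mul, gaussSum_one_eq hψ]
  ring

/-- For d = 2, 3, 5 three of the five characters become trivial, which leaves a sign. -/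
theorem gaussProduct_of_pow_prime {ψ : AddChar F ℂ} (hψ : ψ ≠ 1) {d : ℕ} (hd : d = 2 ∨ d = 3 ∨ d = 5)
    {χ : MulChar F ℂ} (h : χ ^ d = 1) :
    gaussProduct ψ χ = -(gaussSum χ ψ * gaussSum (χ ^ (-1 : ℤ)) ψ) := by
  classical
  rw [gaussProduct]
  rcases hd with rfl | rfl | rfl
  · have h' : χ ^ (2 : ℤ) = 1 := by exact_mod_cast h
    rw [show (30 : ℤ) = 2 * 15 by norm_num, show (-15 : ℤ) = 2 * (-7) + (-1) by norm_num,
      show (-10 : ℤ) = 2 * (-5) by norm_num, show (-6 : ℤ) = 2 * (-3) by norm_num]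
    simp only [zpow_add, zpow_mul, h', one_zpow, one_mul, gaussSum_one_eq hψ]
    ring
  · have h' : χ ^ (3 : ℤ) = 1 := by exact_mod_cast h
    rw [show (30 : ℤ) = 3 * 10 by norm_num, show (-15 : ℤ) = 3 * (-5) by norm_num,
      show (-10 : ℤ) = 3 * (-3) + (-1) by norm_num, show (-6 : ℤ) = 3 * (-2) by norm_num]
    simp only [zpow_add, zpow_mul, h', one_zpow, one_mul, gaussSum_one_eq hψ]
    ring
  · have h' : χ ^ (5 : ℤ) = 1 := by exact_mod_cast h
    rw [show (30 : ℤ) = 5 * 6 by norm_num, show (-15 : ℤ) = 5 * (-3) by norm_num,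
      show (-10 : ℤ) = 5 * (-2) by norm_num, show (-6 : ℤ) = 5 * (-1) + (-1) by norm_num]
    simp only [zpow_add, zpow_mul, h', one_zpow, one_mul, gaussSum_one_eq hψ]
    ring

/-- The number of points of the affine surface in terms of the hypergeometric sum. -/
theorem card_surfacePoints (hq : (Fintype.card F).Coprime 30)
    {ψ : AddChar F ℂ} (hψ : ψ ≠ 1) {ω : MulChar F ℂ}
    (hω : ∀ χ : MulChar F ℂ, χ ∈ Subgroup.zpowers ω) (lam : Fˣ) :
    (Nat.card (surfacePoints (lam⁻¹ : F)) : ℂ) = (Fintype.card F : ℂ) ^ 2 + 1 +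
      Fintype.card F * surfaceData.H ψ ω (2 ^ 14 * 3 ^ 9 * 5 ^ 5 * lam) := by
  classical
  have : Fintype (MulChar F ℂ) := Fintype.ofFinite _
  set q := (Fintype.card F : ℂ) with hqdef
  have hq0 : q ≠ 0 := by
    rw [hqdef]
    exact_mod_cast Fintype.card_ne_zero
  have hq1 : q - 1 ≠ 0 := by
    rw [hqdef, sub_ne_zero]
    exact_mod_cast Fintype.one_lt_card.ne'
  have hH := hypergeometric_eq hq ψ hω lam
  have hT : ∀ d : ℕ, ∀ G : MulChar F ℂ → ℂ, (∀ χ, χ ^ d = 1 → gaussProduct ψ χ = G χ) →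
      ∑ χ : MulChar F ℂ, (if χ ^ d = 1 then (1 : ℂ) else 0) * gaussProduct ψ χ * χ (-lam : Fˣ) =
        ∑ χ : MulChar F ℂ with χ ^ d = 1, G χ * χ (-lam : Fˣ) := by
    intro d G hG
    rw [Finset.sum_filter]
    refine Finset.sum_congr rfl fun χ _ => ?_
    split_ifs with h
    · rw [one_mul, hG χ h]
    · ring
  have h6 := hT 6 _ fun χ h => gaussProduct_of_pow_six hψ h
  have h10 := hT 10 _ fun χ h => gaussProduct_of_pow_ten hψ h
  have h15 := hT 15 _ fun χ h => gaussProduct_of_pow_fifteen hψ h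
  have hp : ∀ d : ℕ, (d = 2 ∨ d = 3 ∨ d = 5) →
      ∑ χ : MulChar F ℂ, (if χ ^ d = 1 then (1 : ℂ) else 0) * gaussProduct ψ χ * χ (-lam : Fˣ) =
        -(q * ∑ x : Fˣ, (if (x ^ d - (lam⁻¹ : Fˣ) : F) = 0 then (1 : ℂ) else 0) - (q - 1)) := by
    intro d hd
    rw [hT d _ fun χ h => gaussProduct_of_pow_prime hψ hd h, ← sum_torsion_gaussSum_single lam hψ d]
    simp only [neg_mul, Finset.sum_neg_distrib]
  have h2 := hp 2 (by norm_num)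
  have h3 := hp 3 (by norm_num)
  have h5 := hp 5 (by norm_num)
  have h1 : ∑ χ : MulChar F ℂ, (if χ = 1 then (1 : ℂ) else 0) * gaussProduct ψ χ * χ (-lam : Fˣ) =
      -1 := by
    rw [Finset.sum_eq_single 1]
    · simp only [if_true, gaussProduct, one_zpow, gaussSum_one_eq hψ, MulChar.one_apply_coe]
      norm_num
    · intro χ _ h
      simp [h]
    · simp
  rw [sum_torsion_gaussSum_six lam hψ] at h6
  rw [sum_torsion_gaussSum_ten lam hψ] at h10
  rw [sum_torsion_gaussSum_fifteen lam hψ] at h15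
  have hV := sum_gaussSum_surface lam hψ
  -- Inclusion-exclusion for the weights matches the decomposition of S_λ by vanishing coordinates:
  -- the sums for 2, 3, 5 enter with a minus and carry another one by `hp`, so all seven counts
  -- occur with a plus.
  have expand : ∑ χ : MulChar F ℂ, charWeight χ * gaussProduct ψ χ * χ (-lam : Fˣ) =
      ∑ χ : MulChar F ℂ, gaussProduct ψ χ * χ (-lam : Fˣ) + (q - 1) * (
      ∑ χ : MulChar F ℂ, (if χ ^ 6 = 1 then (1 : ℂ) else 0) * gaussProduct ψ χ * χ (-lam : Fˣ) +
      ∑ χ : MulChar F ℂ, (if χ ^ 10 = 1 then (1 : ℂ) else 0) * gaussProduct ψ χ * χ (-lam : Fˣ) +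
      ∑ χ : MulChar F ℂ, (if χ ^ 15 = 1 then (1 : ℂ) else 0) * gaussProduct ψ χ * χ (-lam : Fˣ) -
      ∑ χ : MulChar F ℂ, (if χ ^ 2 = 1 then (1 : ℂ) else 0) * gaussProduct ψ χ * χ (-lam : Fˣ) -
      ∑ χ : MulChar F ℂ, (if χ ^ 3 = 1 then (1 : ℂ) else 0) * gaussProduct ψ χ * χ (-lam : Fˣ) -
      ∑ χ : MulChar F ℂ, (if χ ^ 5 = 1 then (1 : ℂ) else 0) * gaussProduct ψ χ * χ (-lam : Fˣ) +
      (q + 1) *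
      ∑ χ : MulChar F ℂ, (if χ = 1 then (1 : ℂ) else 0) * gaussProduct ψ χ * χ (-lam : Fˣ)) := by
    simp only [Finset.mul_sum, ← Finset.sum_add_distrib, ← Finset.sum_sub_distrib]
    refine Finset.sum_congr rfl fun χ _ => ?_
    rw [charWeight_eq]
    ring
  rw [expand, h6, h10, h15, h2, h3, h5, h1] at hH
  rw [show ∑ χ : MulChar F ℂ, gaussProduct ψ χ * χ (-lam : Fˣ) = _ from hV] at hH
  rw [card_surfacePoints_eq_sum _ (by simp)]
  rw [← Units.val_inv_eq_inv_val]
  apply mul_left_cancel₀ (mul_ne_zero hq1 hq0)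
  linear_combination -hH

/-- From q H = N - q² - 1 and N = 1 + q k one gets H = k - q. Every t ≠ 0 is of the form 2^14 3^9
5^5 λ because q is prime to 30. -/
theorem exists_int_hypergeometric (hq : (Fintype.card F).Coprime 30)
    {ψ : AddChar F ℂ} (hψ : ψ ≠ 1) {ω : MulChar F ℂ}
    (hω : ∀ χ : MulChar F ℂ, χ ∈ Subgroup.zpowers ω) (t : F) (ht : t ≠ 0) :
    ∃ n : ℤ, surfaceData.H ψ ω t = n := by
  obtain ⟨hs, hs0⟩ := scale_surfaceData (F := F) hq
  rw [hs] at hs0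
  let lam : Fˣ := Units.mk0 ((2 ^ 14 * 3 ^ 9 * 5 ^ 5)⁻¹ * t) (mul_ne_zero (inv_ne_zero hs0) ht)
  have hlam : (2 ^ 14 * 3 ^ 9 * 5 ^ 5 * (lam : F)) = t := by
    simp only [lam, Units.val_mk0]
    exact mul_inv_cancel_left₀ hs0 t
  have h := card_surfacePoints hq hψ hω lam
  rw [hlam] at h
  obtain ⟨k, hk⟩ := card_dvd_card_surfacePoints_sub_one (lam⁻¹ : F)
  have hk' := congrArg (Int.cast : ℤ → ℂ) hk
  push_cast at hk'
  have hq0 : (Fintype.card F : ℂ) ≠ 0 := by exact_mod_cast Fintype.card_ne_zero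
  refine ⟨k - Fintype.card F, ?_⟩
  apply mul_left_cancel₀ hq0
  push_cast
  linear_combination hk' - h

end

end FiniteHypergeometric

namespace FiniteHypergeometric

/-! ### Laurent polynomials and the charts -/

section Saturation

variable {R M : Type*} [CommRing R] [AddCommMonoid M]

/-- The homogeneous part of degree `k` of an element of a monoid algebra graded by `deg`. -/
noncomputable def homogeneousPart (deg : M →+ ℤ) (k : ℤ) (x : AddMonoidAlgebra R M) :
    AddMonoidAlgebra R M :=
  .ofCoeff (x.coeff.filter fun m => deg m = k)

theorem coeff_homogeneousPart (deg : M →+ ℤ) (k : ℤ) (x : AddMonoidAlgebra R M) (m : M) :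
    (homogeneousPart deg k x).coeff m = if deg m = k then x.coeff m else 0 := by
  simp [homogeneousPart, Finsupp.filter_apply]

/-- Lowest parts multiply: every other contribution to the product has degree at least a + b + 1. -/
theorem coeff_mul_eq_homogeneousPart_mul (deg : M →+ ℤ) {a b : ℤ} {x y : AddMonoidAlgebra R M}
    (hx : ∀ m, x.coeff m ≠ 0 → a ≤ deg m) (hy : ∀ m, y.coeff m ≠ 0 → b ≤ deg m)
    {m : M} (hm : deg m = a + b) :
    (x * y).coeff m = (homogeneousPart deg a x * homogeneousPart deg b y).coeff m := by
  classical
  have key : ∀ {u v : AddMonoidAlgebra R M} (s t : ℤ), (∀ m, u.coeff m ≠ 0 → s ≤ deg m) →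
      (∀ m, v.coeff m ≠ 0 → t ≤ deg m) → a + b < s + t → (u * v).coeff m = 0 := by
    intro u v s t hu hv hst
    by_contra h
    have := AddMonoidAlgebra.support_coeff_mul_subset u v (Finsupp.mem_support_iff.2 h)
    obtain ⟨m₁, h₁, m₂, h₂, rfl⟩ := Finset.mem_add.1 this
    have := hu m₁ (Finsupp.mem_support_iff.1 h₁)
    have := hv m₂ (Finsupp.mem_support_iff.1 h₂)
    rw [map_add] at hm
    omega
  have hpart : ∀ {z : AddMonoidAlgebra R M} (k : ℤ) (m), (homogeneousPart deg k z).coeff m ≠ 0 →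
      k ≤ deg m := by
    intro z k m h
    rw [coeff_homogeneousPart] at h
    split_ifs at h with h'
    · exact h'.ge
    · exact absurd rfl h
  have hrest : ∀ {z : AddMonoidAlgebra R M} (k : ℤ), (∀ m, z.coeff m ≠ 0 → k ≤ deg m) →
      ∀ m, (z - homogeneousPart deg k z).coeff m ≠ 0 → k + 1 ≤ deg m := by
    intro z k hz m h
    rw [AddMonoidAlgebra.coeff_sub, Finsupp.sub_apply, coeff_homogeneousPart] at h
    split_ifs at h with h'
    · exact absurd (sub_self _) h
    · have := hz m (by simpa using h)
      omega
  have hdecomp : x * y = homogeneousPart deg a x * homogeneousPart deg b y +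
      (homogeneousPart deg a x * (y - homogeneousPart deg b y) +
        (x - homogeneousPart deg a x) * y) := by ring
  rw [hdecomp, AddMonoidAlgebra.coeff_add, Finsupp.add_apply, AddMonoidAlgebra.coeff_add,
    Finsupp.add_apply, key a (b + 1) (hpart a) (hrest b hy) (by omega),
    key (a + 1) b (hrest a hx) hy (by omega), add_zero, add_zero]

/-- If `P` has order exactly zero for a grading, then `g` has nonnegative order as soon as `P * g`
does. -/
theorem nonneg_of_mul_nonneg [NoZeroDivisors (AddMonoidAlgebra R M)] (deg : M →+ ℤ)
    {P g : AddMonoidAlgebra R M} (hP : ∀ m, P.coeff m ≠ 0 → 0 ≤ deg m)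
    (hP0 : ∃ m, P.coeff m ≠ 0 ∧ deg m = 0) (hPg : ∀ m, (P * g).coeff m ≠ 0 → 0 ≤ deg m) :
    ∀ m, g.coeff m ≠ 0 → 0 ≤ deg m := by
  intro m₀ hm₀
  by_contra! hneg
  obtain ⟨m₁, hm₁, hmin⟩ := Finset.exists_min_image g.coeff.support deg
    ⟨m₀, Finsupp.mem_support_iff.2 hm₀⟩
  have hg : ∀ m, g.coeff m ≠ 0 → deg m₁ ≤ deg m := fun m hm =>
    hmin m (Finsupp.mem_support_iff.2 hm)
  have h1 : homogeneousPart deg 0 P ≠ 0 := by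
    obtain ⟨m, hm, hdeg⟩ := hP0
    intro h
    have := coeff_homogeneousPart deg 0 P m
    rw [if_pos hdeg, h] at this
    exact hm (by simpa using this.symm)
  have h2 : homogeneousPart deg (deg m₁) g ≠ 0 := by
    intro h
    have := coeff_homogeneousPart deg (deg m₁) g m₁
    rw [if_pos rfl, h] at this
    exact Finsupp.mem_support_iff.1 hm₁ (by simpa using this.symm)
  -- In a domain the product of the lowest parts survives, so `P * g` would have a term of the
  -- negative degree `deg m₁`.
  have h3 := mul_ne_zero h1 h2
  obtain ⟨m, hm⟩ : ∃ m, (homogeneousPart deg 0 P * homogeneousPart deg (deg m₁) g).coeff m ≠ 0 := by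
    by_contra! h
    exact h3 (AddMonoidAlgebra.ext (Finsupp.ext h))
  classical
  have hdeg : deg m = 0 + deg m₁ := by
    have := AddMonoidAlgebra.support_coeff_mul_subset _ _ (Finsupp.mem_support_iff.2 hm)
    obtain ⟨a, ha, b, hb, rfl⟩ := Finset.mem_add.1 this
    rw [Finsupp.mem_support_iff, coeff_homogeneousPart] at ha hb
    rw [map_add, (ite_ne_right_iff.1 ha).1, (ite_ne_right_iff.1 hb).1]
  rw [← coeff_mul_eq_homogeneousPart_mul deg hP hg hdeg] at hm
  have := hPg m hm
  have := hg m₀ hm₀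
  omega

end Saturation

/-- The dual cone of a set of rays, as a monoid of exponents. -/
def dualCone (C : Finset (Fin 2 × Fin 3)) : AddSubmonoid (Fin 3 → ℤ) where
  carrier := {m | ∀ c ∈ C, 0 ≤ ray c ⬝ᵥ m}
  zero_mem' := by simp
  add_mem' := fun ha hb c hc => by
    rw [dotProduct_add]
    exact add_nonneg (ha c hc) (hb c hc)

theorem mem_dualCone {C : Finset (Fin 2 × Fin 3)} {m : Fin 3 → ℤ} :
    m ∈ dualCone C ↔ ∀ c ∈ C, 0 ≤ ray c ⬝ᵥ m := Iff.rfl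

/-- The order of a monomial along a ray. -/
def rayDegree (c : Fin 2 × Fin 3) : (Fin 3 → ℤ) →+ ℤ where
  toFun m := ray c ⬝ᵥ m
  map_zero' := dotProduct_zero _
  map_add' := dotProduct_add _

/-- The exponents of the monomials `1, λ⁻¹/(xyz), y/(xz), x²/(yz), z⁴/(xy)`. -/
def coordExponent : Fin 2 ⊕ Fin 3 → Fin 3 → ℤ
  | .inl 0 => ![0, 0, 0]
  | .inl 1 => ![-1, -1, -1]
  | .inr 0 => ![-1, 1, -1]
  | .inr 1 => ![2, -1, -1]
  | .inr 2 => ![-1, -1, 4]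

/-- The index `(i, j)` involves the coordinates `x_i` and `y_j`. -/
def Involves (c : Fin 2 × Fin 3) (o : Fin 2 ⊕ Fin 3) : Prop := o = .inl c.1 ∨ o = .inr c.2

instance (c : Fin 2 × Fin 3) (o : Fin 2 ⊕ Fin 3) : Decidable (Involves c o) :=
  inferInstanceAs (Decidable (_ ∨ _))

/-- This finite check is the geometric meaning of the rays: along `ray c` just the two coordinates
involved in c vanish, measured against any coordinate that does not. -/
theorem ray_coordExponent (c : Fin 2 × Fin 3) (e o : Fin 2 ⊕ Fin 3) (he : ¬ Involves c e) :
    0 ≤ ray c ⬝ᵥ (coordExponent o - coordExponent e) ∧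
      (ray c ⬝ᵥ (coordExponent o - coordExponent e) = 0 ↔ ¬ Involves c o) := by
  revert c e o
  decide

theorem coordExponent_sub_mem {C : Finset (Fin 2 × Fin 3)} {e : Fin 2 ⊕ Fin 3}
    (he : ∀ c ∈ C, ¬ Involves c e) (o : Fin 2 ⊕ Fin 3) :
    coordExponent o - coordExponent e ∈ dualCone C :=
  fun c hc => (ray_coordExponent c e o (he c hc)).1

theorem coordExponent_injective : Function.Injective coordExponent := by
  unfold Function.Injective
  decide

section Laurent

variable {F : Type u} [Field F] (lam : F)

/-- The coefficients of the linear relation between the monomials `coordExponent`. -/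
def coordCoeff : Fin 2 ⊕ Fin 3 → F
  | .inl 0 => 1
  | .inl 1 => lam⁻¹
  | .inr _ => -1

/-- The equation of `V_λ`, divided by the monomial `coordExponent e`. -/
noncomputable def relation (e : Fin 2 ⊕ Fin 3) : AddMonoidAlgebra F (Fin 3 → ℤ) :=
  ∑ o, .single (coordExponent o - coordExponent e) (coordCoeff lam o)

theorem sum_coord {A : Type*} [AddCommMonoid A] (G : Fin 2 ⊕ Fin 3 → A) :
    ∑ o, G o = G (.inl 0) + G (.inl 1) + (G (.inr 0) + G (.inr 1) + G (.inr 2)) := by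
  rw [Fintype.sum_sum_type, Fin.sum_univ_two, Fin.sum_univ_three]

theorem toLaurent_X (i : Fin 3) :
    toLaurent (F := F) (MvPolynomial.X i) = .single (Pi.single i 1) 1 :=
  MvPolynomial.aeval_X _ _

theorem toLaurent_surfacePoly (e : Fin 2 ⊕ Fin 3) :
    toLaurent (surfacePoly lam) = .single (coordExponent e + ![1, 1, 1]) (-1) * relation lam e := by
  have h1 : toLaurent (surfacePoly lam) = .single ![0, 2, 0] 1 - .single ![1, 1, 1] 1 +
      .single ![3, 0, 0] 1 + .single ![0, 0, 5] 1 - .single 0 lam⁻¹ := by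
    have h0 : toLaurent (MvPolynomial.C lam⁻¹ : MvPolynomial (Fin 3) F) = .single 0 lam⁻¹ :=
      MvPolynomial.aeval_C _ _
    simp only [surfacePoly, map_sub, map_add, map_mul, map_pow, toLaurent_X, h0,
      AddMonoidAlgebra.single_pow, AddMonoidAlgebra.single_mul_single, one_pow, one_mul]
    congr <;> · ext i; fin_cases i <;> simp
  rw [h1, relation, Finset.mul_sum, sum_coord]
  have h2 : ∀ m : Fin 3 → ℤ, coordExponent e + ![1, 1, 1] + (m - coordExponent e) =
      ![1, 1, 1] + m := fun m => by abel
  simp only [AddMonoidAlgebra.single_mul_single, h2]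
  simp only [coordCoeff, coordExponent]
  simp only [Matrix.cons_add_cons, Matrix.empty_add_empty]
  norm_num
  rw [show (![0, 0, 0] : Fin 3 → ℤ) = 0 by ext i; fin_cases i <;> rfl, sub_eq_add_neg,
    sub_eq_add_neg]
  simp only [← AddMonoidAlgebra.single_neg]
  abel

/-- Laurent monomials are units, so the equation may be normalised at any coordinate; on each chart
one chooses a coordinate that does not vanish along its rays. -/
theorem map_surfaceIdeal (e : Fin 2 ⊕ Fin 3) :
    (surfaceIdeal lam).map (toLaurent (F := F)) = Ideal.span {relation lam e} := by
  have hu : IsUnit (AddMonoidAlgebra.single (coordExponent e + ![1, 1, 1]) (-1 : F)) := by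
    refine IsUnit.of_mul_eq_one (.single (-(coordExponent e + ![1, 1, 1])) (-1)) ?_
    rw [AddMonoidAlgebra.single_mul_single, add_neg_cancel, AddMonoidAlgebra.one_def]
    norm_num
  rw [surfaceIdeal, Ideal.map_span, Set.image_singleton]
  rw [show (toLaurent (F := F)) (surfacePoly lam) = _ from toLaurent_surfacePoly lam e]
  exact Ideal.span_singleton_mul_left_unit hu _

theorem coeff_relation (e : Fin 2 ⊕ Fin 3) (m : Fin 3 → ℤ) : (relation lam e).coeff m =
    ∑ o, if coordExponent o - coordExponent e = m then coordCoeff lam o else 0 := by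
  classical
  simp only [relation, AddMonoidAlgebra.coeff_sum, Finsupp.finsetSum_apply,
    AddMonoidAlgebra.coeff_single, Finsupp.single_apply]

variable {lam}

theorem coordCoeff_ne_zero (hlam : lam ≠ 0) (o : Fin 2 ⊕ Fin 3) : coordCoeff lam o ≠ 0 := by
  rcases o with i | j
  · fin_cases i <;> simp [coordCoeff, hlam]
  · simp [coordCoeff]

/-- Multiples of the equation with exponents in the dual cone have their cofactor there, too. -/
theorem mem_dualCone_of_relation_mul (hlam : lam ≠ 0) {C : Finset (Fin 2 × Fin 3)}
    {e : Fin 2 ⊕ Fin 3} (he : ∀ c ∈ C, ¬ Involves c e) {g : AddMonoidAlgebra F (Fin 3 → ℤ)}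
    (hg : ∀ m, (relation lam e * g).coeff m ≠ 0 → m ∈ dualCone C) :
    ∀ m, g.coeff m ≠ 0 → m ∈ dualCone C := by
  intro m hm c hc
  refine nonneg_of_mul_nonneg (rayDegree c) (P := relation lam e) ?_ ⟨0, ?_, map_zero _⟩
    (fun m hm => hg m hm c hc) m hm
  · intro m hm
    rw [coeff_relation] at hm
    obtain ⟨o, -, ho⟩ := Finset.exists_ne_zero_of_sum_ne_zero hm
    obtain ⟨rfl, -⟩ := ite_ne_right_iff.1 ho
    exact coordExponent_sub_mem he o c hc
  · rw [coeff_relation, Finset.sum_eq_single e]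
    · simpa using coordCoeff_ne_zero hlam e
    · intro o _ ho
      rw [if_neg]
      rw [sub_eq_zero]
      exact fun h => ho (coordExponent_injective h)
    · simp

end Laurent

end FiniteHypergeometric

namespace FiniteHypergeometric

/-! ### Charts by generators and relations, and the affine surface as a chart -/

section Charts

variable {F : Type u} [Field F] {lam : F}

theorem character_zero : character lam 0 = 1 := map_one (Ideal.Quotient.mk _)

theorem character_add (m m' : Fin 3 → ℤ) :
    character lam (m + m') = character lam m * character lam m' := by
  rw [character, character, character, ← map_mul, AddMonoidAlgebra.single_mul_single, one_mul]

theorem character_nsmul (n : ℕ) (m : Fin 3 → ℤ) : character lam (n • m) = character lam m ^ n := by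
  induction n with
  | zero => rw [zero_smul, pow_zero, character_zero]
  | succ n ih => rw [succ_nsmul, character_add, ih, pow_succ]

theorem character_mul_neg (m : Fin 3 → ℤ) : character lam m * character lam (-m) = 1 := by
  rw [← character_add, add_neg_cancel, character_zero]

theorem isUnit_character (m : Fin 3 → ℤ) : IsUnit (character lam m) :=
  IsUnit.of_mul_eq_one _ (character_mul_neg m)

theorem character_mem {C : Finset (Fin 2 × Fin 3)} {m : Fin 3 → ℤ} (hm : m ∈ dualCone C) :
    character lam m ∈ chartRing lam C :=
  Algebra.subset_adjoin ⟨m, hm, rfl⟩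

theorem sum_coordCoeff_smul_character (e : Fin 2 ⊕ Fin 3) :
    ∑ o, coordCoeff lam o • character lam (coordExponent o - coordExponent e) = 0 := by
  have h : Ideal.Quotient.mk ((surfaceIdeal lam).map (toLaurent (F := F))) (relation lam e) = 0 := by
    rw [Ideal.Quotient.eq_zero_iff_mem, map_surfaceIdeal lam e]
    exact Ideal.mem_span_singleton_self _
  rw [relation, map_sum] at h
  rw [← h]
  refine Finset.sum_congr rfl fun o _ => Eq.symm ?_
  rw [character]
  change Ideal.Quotient.mkₐ F ((surfaceIdeal lam).map (toLaurent (F := F))) _ = _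
  rw [show AddMonoidAlgebra.single (coordExponent o - coordExponent e) (coordCoeff lam o) =
    coordCoeff lam o • AddMonoidAlgebra.single (coordExponent o - coordExponent e) (1 : F) by simp]
  exact map_smul (Ideal.Quotient.mkₐ F ((surfaceIdeal lam).map (toLaurent (F := F)))) _ _

variable (lam) in
/-- The monomials of a chart, as a monoid homomorphism. -/
noncomputable def chartMonomial (C : Finset (Fin 2 × Fin 3)) :
    Multiplicative (dualCone C) →* chartRing lam C where
  toFun m := ⟨character lam m.toAdd, character_mem m.toAdd.2⟩
  map_one' := Subtype.ext character_zero
  map_mul' _ _ := Subtype.ext (character_add _ _)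

variable (lam) in
/-- The presentation of a chart as a quotient of a monoid algebra. -/
noncomputable def toChart (C : Finset (Fin 2 × Fin 3)) :
    AddMonoidAlgebra F (dualCone C) →ₐ[F] chartRing lam C :=
  AddMonoidAlgebra.lift F _ _ (chartMonomial lam C)

theorem toChart_single (C : Finset (Fin 2 × Fin 3)) (m : dualCone C) :
    toChart lam C (.single m 1) = chartMonomial lam C (.ofAdd m) := by
  simp [toChart, AddMonoidAlgebra.lift_single]

theorem toChart_surjective (C : Finset (Fin 2 × Fin 3)) : Function.Surjective (toChart lam C) := by
  have h : chartRing lam C ≤ ((chartRing lam C).val.comp (toChart lam C)).range := by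
    refine Algebra.adjoin_le ?_
    rintro _ ⟨m, hm, rfl⟩
    exact ⟨.single ⟨m, hm⟩ 1, by
      rw [AlgHom.toRingHom_eq_coe, RingHom.coe_coe, AlgHom.comp_apply, toChart_single]; rfl⟩
  intro x
  obtain ⟨p, hp⟩ := h x.2
  exact ⟨p, Subtype.ext hp⟩

variable (F) in
/-- The inclusion of the monoid algebra of a dual cone into the Laurent polynomials. -/
noncomputable def coneInclusion (C : Finset (Fin 2 × Fin 3)) :
    AddMonoidAlgebra F (dualCone C) →ₐ[F] AddMonoidAlgebra F (Fin 3 → ℤ) :=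
  AddMonoidAlgebra.mapDomainAlgHom F F (dualCone C).subtype

theorem coneInclusion_single (C : Finset (Fin 2 × Fin 3)) (m : dualCone C) (r : F) :
    coneInclusion F C (.single m r) = .single m r := by
  simp [coneInclusion]

theorem coneInclusion_injective (C : Finset (Fin 2 × Fin 3)) :
    Function.Injective (coneInclusion F C) :=
  AddMonoidAlgebra.mapDomain_injective Subtype.val_injective

theorem exists_coneInclusion_eq {C : Finset (Fin 2 × Fin 3)} {g : AddMonoidAlgebra F (Fin 3 → ℤ)}
    (hg : ∀ m, g.coeff m ≠ 0 → m ∈ dualCone C) : ∃ g', coneInclusion F C g' = g := by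
  refine ⟨∑ m : g.coeff.support, .single ⟨m, hg m (Finsupp.mem_support_iff.1 m.2)⟩ (g.coeff m), ?_⟩
  simp only [map_sum, coneInclusion_single]
  rw [Finset.sum_coe_sort g.coeff.support fun m => AddMonoidAlgebra.single m (g.coeff m)]
  exact AddMonoidAlgebra.sum_coeff_single g

theorem val_toChart (C : Finset (Fin 2 × Fin 3)) (p : AddMonoidAlgebra F (dualCone C)) :
    (toChart lam C p : TorusRing lam) = Ideal.Quotient.mk _ (coneInclusion F C p) := by
  have h : (chartRing lam C).val.comp (toChart lam C) =
      (Ideal.Quotient.mkₐ F _).comp (coneInclusion F C) := by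
    refine AddMonoidAlgebra.algHom_ext (fun m => ?_) (Subsingleton.elim _ _)
    rw [AlgHom.comp_apply, AlgHom.comp_apply, toChart_single, coneInclusion_single]
    rfl
  exact DFunLike.congr_fun h p

/-- Rational points of a chart can be constructed from monoid homomorphisms annihilating the
equation. -/
theorem exists_chartHom (hlam : lam ≠ 0) {C : Finset (Fin 2 × Fin 3)} {e : Fin 2 ⊕ Fin 3}
    (he : ∀ c ∈ C, ¬ Involves c e) (h : Multiplicative (dualCone C) →* F)
    (hrel : ∑ o, coordCoeff lam o *
      h (.ofAdd ⟨coordExponent o - coordExponent e, coordExponent_sub_mem he o⟩) = 0) :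
    ∃ φ : chartRing lam C →ₐ[F] F, ∀ m, φ (chartMonomial lam C m) = h m := by
  let L : AddMonoidAlgebra F (dualCone C) →ₐ[F] F := AddMonoidAlgebra.lift F _ _ h
  have hL : ∀ (m : dualCone C) (r : F), L (.single m r) = r * h (.ofAdd m) := fun m r => by
    simp [L, AddMonoidAlgebra.lift_single]
  have hker : ∀ p, toChart lam C p = 0 → L p = 0 := by
    intro p hp
    have h1 := val_toChart (lam := lam) C p
    rw [hp, ZeroMemClass.coe_zero, eq_comm, Ideal.Quotient.eq_zero_iff_mem, map_surfaceIdeal lam e,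
      Ideal.mem_span_singleton] at h1
    obtain ⟨g, hg⟩ := h1
    have hsupp : ∀ m, (relation lam e * g).coeff m ≠ 0 → m ∈ dualCone C := by
      intro m hm
      rw [← hg] at hm
      by_contra hmem
      apply hm
      exact Finsupp.mapDomain_of_notMem_range _ _ fun ⟨x, hx⟩ => hmem (hx ▸ x.2)
    -- Here saturation enters: the cofactor has its exponents in the dual cone as well, so the
    -- kernel of the presentation is generated by the normalised equation.
    obtain ⟨g', rfl⟩ := exists_coneInclusion_eq (mem_dualCone_of_relation_mul hlam he hsupp)
    have hrel' : relation lam e = coneInclusion F C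
        (∑ o, .single ⟨_, coordExponent_sub_mem he o⟩ (coordCoeff lam o)) := by
      simp only [map_sum, coneInclusion_single]
      rfl
    rw [hrel', ← map_mul] at hg
    rw [coneInclusion_injective C hg, map_mul, map_sum]
    simp only [hL]
    rw [hrel, zero_mul]
  have hker' : ∀ p ∈ RingHom.ker (toChart lam C), L p = 0 := fun p hp => hker p hp
  refine ⟨(Ideal.Quotient.liftₐ _ L hker').comp
    (Ideal.quotientKerAlgEquivOfSurjective (toChart_surjective (lam := lam) C)).symm.toAlgHom,
    fun m => ?_⟩
  have h2 : (Ideal.quotientKerAlgEquivOfSurjective (toChart_surjective (lam := lam) C)).symm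
      (chartMonomial lam C m) = Ideal.Quotient.mk _ (.single m.toAdd 1) := by
    rw [AlgEquiv.symm_apply_eq]
    exact (toChart_single C m.toAdd).symm
  refine (congrArg (Ideal.Quotient.liftₐ _ L hker') h2).trans ?_
  change L _ = _
  rw [hL, one_mul]
  rfl

theorem chartHom_ext {C : Finset (Fin 2 × Fin 3)} {φ φ' : chartRing lam C →ₐ[F] F}
    (h : ∀ m, φ (chartMonomial lam C m) = φ' (chartMonomial lam C m)) : φ = φ' := by
  have h1 : φ.comp (toChart lam C) = φ'.comp (toChart lam C) := by
    refine AddMonoidAlgebra.algHom_ext (fun m => ?_) (Subsingleton.elim _ _)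
    rw [AlgHom.comp_apply, AlgHom.comp_apply, toChart_single]
    exact h _
  ext x
  obtain ⟨p, rfl⟩ := toChart_surjective C x
  exact DFunLike.congr_fun h1 p

/-- The equation satisfied by a rational point of a chart. -/
theorem sum_coordCoeff_mul_chartHom {C : Finset (Fin 2 × Fin 3)} {e : Fin 2 ⊕ Fin 3}
    (he : ∀ c ∈ C, ¬ Involves c e) (φ : chartRing lam C →ₐ[F] F) :
    ∑ o, coordCoeff lam o * φ (chartMonomial lam C
      (.ofAdd ⟨coordExponent o - coordExponent e, coordExponent_sub_mem he o⟩)) = 0 := by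
  have h : ∑ o, coordCoeff lam o • chartMonomial lam C
      (.ofAdd ⟨coordExponent o - coordExponent e, coordExponent_sub_mem he o⟩) = 0 := by
    refine Subtype.ext ?_
    rw [AddSubmonoidClass.coe_finsetSum]
    exact sum_coordCoeff_smul_character e
  have h2 := congrArg φ h
  simpa only [map_sum, map_smul, smul_eq_mul, map_zero] using h2

/-- The cone of the affine space containing the affine surface. -/
def affineCell : Finset (Fin 2 × Fin 3) := {(0, 0), (0, 1), (0, 2)}

theorem mem_dualCone_affineCell {m : Fin 3 → ℤ} :
    m ∈ dualCone affineCell ↔ ∀ i, 0 ≤ m i := by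
  rw [mem_dualCone, Fin.forall_fin_succ, Fin.forall_fin_two]
  simp [affineCell, ray, dotProduct, Fin.sum_univ_three]
  tauto

theorem toLaurent_monomial (n : Fin 3 →₀ ℕ) (r : F) :
    toLaurent (MvPolynomial.monomial n r) = .single (fun i => (n i : ℤ)) r := by
  rw [toLaurent, MvPolynomial.aeval_monomial, Finsupp.prod_fintype _ _ (by simp)]
  simp only [AddMonoidAlgebra.single_pow, one_pow, Fin.prod_univ_three,
    AddMonoidAlgebra.single_mul_single, AddMonoidAlgebra.coe_algebraMap, Function.comp,
    Algebra.algebraMap_self_apply, mul_one, zero_add]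
  congr 1
  funext i
  fin_cases i <;> simp

theorem toLaurent_injective : Function.Injective (toLaurent (F := F)) := by
  have h : ∀ (p : MvPolynomial (Fin 3) F) (n : Fin 3 →₀ ℕ),
      (toLaurent p).coeff (fun i => (n i : ℤ)) = p.coeff n := by
    intro p n
    classical
    induction p using MvPolynomial.induction_on' with
    | monomial k r =>
      rw [toLaurent_monomial, AddMonoidAlgebra.coeff_single, Finsupp.single_apply,
        MvPolynomial.coeff_monomial]
      congr 1
      rw [eq_iff_iff]
      refine ⟨fun h => Finsupp.ext fun i => ?_, fun h => by rw [h]⟩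
      exact_mod_cast congrFun h i
    | add p p' hp hp' =>
      rw [map_add, AddMonoidAlgebra.coeff_add, Finsupp.add_apply, hp, hp', MvPolynomial.coeff_add]
  intro p p' hpp
  ext n
  rw [← h, hpp, h]

theorem exists_toLaurent_eq {g : AddMonoidAlgebra F (Fin 3 → ℤ)}
    (hg : ∀ m, g.coeff m ≠ 0 → m ∈ dualCone affineCell) : ∃ p, toLaurent p = g := by
  refine ⟨∑ m ∈ g.coeff.support, MvPolynomial.monomial
    (Finsupp.equivFunOnFinite.symm fun i => (m i).toNat) (g.coeff m), ?_⟩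
  rw [map_sum]
  conv_rhs => rw [← AddMonoidAlgebra.sum_coeff_single g]
  refine Finset.sum_congr rfl fun m hm => ?_
  rw [toLaurent_monomial]
  congr 1
  ext i
  exact Int.toNat_of_nonneg (mem_dualCone_affineCell.1 (hg m (Finsupp.mem_support_iff.1 hm)) i)

theorem affineCell_not_involves : ∀ c ∈ affineCell, ¬ Involves c (.inl 1) := by decide

theorem toLaurent_coeff_nonneg (p : MvPolynomial (Fin 3) F) (m : Fin 3 → ℤ)
    (hm : (toLaurent p).coeff m ≠ 0) : m ∈ dualCone affineCell := by
  classical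
  rw [mem_dualCone_affineCell]
  induction p using MvPolynomial.induction_on' with
  | monomial k r =>
    rw [toLaurent_monomial, AddMonoidAlgebra.coeff_single, Finsupp.single_apply] at hm
    obtain ⟨rfl, -⟩ := ite_ne_right_iff.1 hm
    exact fun i => Int.natCast_nonneg _
  | add p p' hp hp' =>
    rw [map_add, AddMonoidAlgebra.coeff_add, Finsupp.add_apply] at hm
    by_cases h : (toLaurent p).coeff m = 0
    · exact hp' (by simpa [h] using hm)
    · exact hp h

/-- The equation has the nonzero constant term -λ⁻¹, so a polynomial that is a multiple of it in the
Laurent ring has a polynomial cofactor. -/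
theorem restrict_injective (hlam : lam ≠ 0) : Function.Injective (restrict lam) := by
  rw [injective_iff_map_eq_zero]
  intro x hx
  obtain ⟨p, rfl⟩ := Ideal.Quotient.mk_surjective x
  have h1 : Ideal.Quotient.mk ((surfaceIdeal lam).map (toLaurent (F := F))) (toLaurent p) = 0 := hx
  have hexp : coordExponent (.inl 1) + ![1, 1, 1] = 0 := by decide
  rw [Ideal.Quotient.eq_zero_iff_mem, map_surfaceIdeal lam (.inl 1),
    Ideal.mem_span_singleton] at h1
  obtain ⟨g, hg⟩ := h1
  obtain ⟨g', rfl⟩ := exists_toLaurent_eq (mem_dualCone_of_relation_mul hlam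
    affineCell_not_involves fun m hm => toLaurent_coeff_nonneg p m (hg ▸ hm))
  have h2 := toLaurent_surfacePoly lam (.inl 1)
  rw [hexp] at h2
  have h3 : toLaurent p = toLaurent (surfacePoly lam * -g') := by
    rw [map_mul, h2, hg, map_neg, mul_comm (AddMonoidAlgebra.single _ _), mul_assoc]
    congr 1
    rw [show AddMonoidAlgebra.single (0 : Fin 3 → ℤ) (-1 : F) = -1 by
      rw [AddMonoidAlgebra.single_neg, AddMonoidAlgebra.one_def]]
    ring
  rw [toLaurent_injective h3, Ideal.Quotient.eq_zero_iff_mem, surfaceIdeal]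
  exact Ideal.mul_mem_right _ _ (Ideal.mem_span_singleton_self _)

theorem restrict_mem (x : SurfaceRing lam) : restrict lam x ∈ chartRing lam affineCell := by
  obtain ⟨p, rfl⟩ := Ideal.Quotient.mk_surjective x
  have h1 : restrict lam (Ideal.Quotient.mk _ p) = Ideal.Quotient.mk _ (toLaurent p) := rfl
  obtain ⟨g, hg⟩ := exists_coneInclusion_eq (C := affineCell) (toLaurent_coeff_nonneg p)
  rw [h1, ← hg, ← val_toChart]
  exact (toChart lam affineCell g).2

variable (lam) in
/-- The restriction of functions from the affine surface to `V_λ`, with values in the chart. -/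
noncomputable def restrictToChart : SurfaceRing lam →+* chartRing lam affineCell :=
  (restrict lam).codRestrict (chartRing lam affineCell) restrict_mem

theorem restrictToChart_bijective (hlam : lam ≠ 0) : Function.Bijective (restrictToChart lam) := by
  refine ⟨fun x y h => restrict_injective hlam (congrArg Subtype.val h), fun x => ?_⟩
  obtain ⟨p, rfl⟩ := toChart_surjective affineCell x
  obtain ⟨p', hp'⟩ := exists_toLaurent_eq (F := F) (g := coneInclusion F affineCell p) fun m hm => by
    by_contra hmem
    exact hm (Finsupp.mapDomain_of_notMem_range _ _ fun ⟨x, hx⟩ => hmem (hx ▸ x.2))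
  refine ⟨Ideal.Quotient.mk _ p', Subtype.ext ?_⟩
  rw [val_toChart, ← hp']
  rfl

/-- The affine surface is the chart of the cone `affineCell`. -/
noncomputable def surfaceRingEquiv (hlam : lam ≠ 0) : SurfaceRing lam ≃+* chartRing lam affineCell :=
  RingEquiv.ofBijective _ (restrictToChart_bijective hlam)

end Charts

end FiniteHypergeometric

namespace FiniteHypergeometric

/-! ### Section rings -/

section SectionRing

variable {k B : Type*} [CommRing k] [CommRing B] [Algebra k B] (W : ℕ → Submodule k B)
  [hW : SetLike.GradedMonoid W]

/-- The ring of polynomials whose `n`-th coefficient lies in `W n`. -/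
def sectionRing : Subalgebra k B[X] where
  carrier := {p | ∀ n, p.coeff n ∈ W n}
  add_mem' ha hb n := by
    rw [coeff_add]
    exact add_mem (ha n) (hb n)
  mul_mem' ha hb n := by
    rw [coeff_mul]
    refine sum_mem fun x hx => ?_
    rw [← Finset.HasAntidiagonal.mem_antidiagonal.1 hx]
    exact hW.mul_mem (ha _) (hb _)
  algebraMap_mem' r n := by
    rw [Polynomial.algebraMap_apply, coeff_C]
    split_ifs with h
    · rw [h, Algebra.algebraMap_eq_smul_one]
      exact Submodule.smul_mem _ _ hW.one_mem
    · exact zero_mem _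

/-- The grading of the section ring by degree. -/
def sectionGrading (n : ℕ) : Submodule k (sectionRing W) where
  carrier := {a | ∀ i, i ≠ n → (a : B[X]).coeff i = 0}
  add_mem' ha hb i hi := by
    rw [Subalgebra.coe_add, coeff_add, ha i hi, hb i hi, add_zero]
  zero_mem' i _ := by simp
  smul_mem' r a ha i hi := by
    rw [Subalgebra.coe_smul, coeff_smul, ha i hi, smul_zero]

variable {W}

/-- An element of `W n`, as a homogeneous element of degree `n`. -/
noncomputable def homogeneousSection (n : ℕ) (b : W n) : sectionRing W :=
  ⟨monomial n (b : B), fun i => by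
    rw [coeff_monomial]
    split_ifs with h
    · subst h
      exact b.2
    · exact zero_mem _⟩

theorem homogeneousSection_mem (n : ℕ) (b : W n) :
    homogeneousSection n b ∈ sectionGrading W n := fun i hi => by
  change (monomial n (b : B)).coeff i = 0
  rw [coeff_monomial, if_neg hi.symm]

theorem homogeneousSection_mul {n n' : ℕ} (b : W n) (b' : W n') :
    homogeneousSection n b * homogeneousSection n' b' =
      homogeneousSection (n + n') ⟨(b : B) * (b' : B), hW.mul_mem b.2 b'.2⟩ :=
  Subtype.ext (monomial_mul_monomial _ _ _ _)

theorem eq_homogeneousSection {n : ℕ} {a : sectionRing W} (ha : a ∈ sectionGrading W n) :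
    a = homogeneousSection n ⟨(a : B[X]).coeff n, a.2 n⟩ := by
  refine Subtype.ext (Polynomial.ext fun i => ?_)
  change _ = (monomial n ((a : B[X]).coeff n)).coeff i
  rw [coeff_monomial]
  split_ifs with h
  · rw [h]
  · exact ha i (Ne.symm h)

theorem sum_homogeneousSection (a : sectionRing W) :
    ∑ n ∈ (a : B[X]).support, homogeneousSection n ⟨(a : B[X]).coeff n, a.2 n⟩ = a := by
  refine Subtype.ext ?_
  rw [AddSubmonoidClass.coe_finsetSum]
  exact (as_sum_support (a : B[X])).symm

instance : SetLike.GradedMonoid (sectionGrading W) where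
  one_mem i hi := by
    rw [Subalgebra.coe_one, coeff_one, if_neg hi]
  mul_mem n n' a b ha hb i hi := by
    rw [Subalgebra.coe_mul, coeff_mul]
    refine Finset.sum_eq_zero fun x hx => ?_
    rw [Finset.HasAntidiagonal.mem_antidiagonal] at hx
    by_cases h : x.1 = n
    · rw [hb x.2 (by omega), mul_zero]
    · rw [ha x.1 h, zero_mul]

theorem coeff_coeAddMonoidHom (x : DirectSum ℕ fun n => sectionGrading W n) (i : ℕ) :
    ((DirectSum.coeAddMonoidHom (sectionGrading W) x : sectionRing W) : B[X]).coeff i =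
      ((x i : sectionRing W) : B[X]).coeff i := by
  classical
  induction x using DirectSum.induction_on with
  | zero => simp
  | of n y =>
    rw [DirectSum.coeAddMonoidHom_of]
    by_cases h : n = i
    · subst h
      rw [DirectSum.of_eq_same]
    · rw [DirectSum.of_eq_of_ne _ _ _ (Ne.symm h), y.2 i (Ne.symm h)]
      simp
  | add x y hx hy =>
    rw [map_add, DirectSum.add_apply, Submodule.coe_add, Subalgebra.coe_add, Subalgebra.coe_add,
      coeff_add, coeff_add, hx, hy]

theorem sectionGrading_isInternal : DirectSum.IsInternal (sectionGrading W) := by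
  classical
  constructor
  · intro x y hxy
    refine DFinsupp.ext fun n => Subtype.ext (Subtype.ext (Polynomial.ext fun i => ?_))
    by_cases hi : i = n
    · subst hi
      have h := congrArg (fun a : sectionRing W => (a : B[X]).coeff i) hxy
      simp only [coeff_coeAddMonoidHom] at h
      exact h
    · exact ((x n).2 i hi).trans ((y n).2 i hi).symm
  · intro a
    refine ⟨∑ n ∈ (a : B[X]).support,
      DirectSum.of (fun n => sectionGrading W n) n ⟨_, homogeneousSection_mem n ⟨_, a.2 n⟩⟩, ?_⟩
    rw [map_sum]
    simp only [DirectSum.coeAddMonoidHom_of]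
    exact sum_homogeneousSection a

noncomputable instance : GradedAlgebra (sectionGrading W) where
  toDecomposition := sectionGrading_isInternal.chooseDecomposition

variable (W) in
/-- Setting the grading variable equal to `1`. -/
noncomputable def sectionEval : sectionRing W →ₐ[k] B :=
  ((aeval (1 : B)).restrictScalars k).comp (sectionRing W).val

theorem sectionEval_homogeneousSection (n : ℕ) (b : W n) :
    sectionEval W (homogeneousSection n b) = b := by
  change aeval (1 : B) (monomial n (b : B)) = b
  rw [aeval_monomial, one_pow, mul_one]
  rfl

end SectionRing

end FiniteHypergeometric

namespace FiniteHypergeometric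

/-! ### Evaluating degree zero fractions -/

section AwayEval

open HomogeneousLocalization

variable {k A B : Type*} [CommRing k] [CommRing A] [Algebra k A] [CommRing B]
  (𝒜 : ℕ → Submodule k A) [GradedAlgebra 𝒜] (ev : A →+* B)

/-- The extension of a ring homomorphism to the degree zero fractions with denominators powers
of `f`. -/
noncomputable def awayEval {f : A} (hf : IsUnit (ev f)) : Away 𝒜 f →+* B :=
  (Localization.awayLift ev f hf).comp (algebraMap (Away 𝒜 f) (Localization.Away f))

variable {𝒜 ev}

theorem awayEval_mk {f : A} (hf : IsUnit (ev f)) {d : ℕ} (hd : f ∈ 𝒜 d) (n : ℕ) (x : A)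
    (hx : x ∈ 𝒜 (n • d)) : awayEval 𝒜 ev hf (Away.mk 𝒜 hd n x hx) * ev f ^ n = ev x := by
  change Localization.awayLift ev f hf (Localization.mk x ⟨f ^ n, n, rfl⟩) * _ = _
  obtain ⟨v, hv⟩ := hf.exists_right_inv
  rw [Localization.awayLift_mk (hv := hv), mul_assoc, ← mul_pow, mul_comm v, hv, one_pow, mul_one]

theorem awayEval_awayMap {f g : A} (hf : IsUnit (ev f)) {d e : ℕ} (hd : f ∈ 𝒜 d) (hg : g ∈ 𝒜 e)
    {x : A} (hx : x = f * g) (hx' : IsUnit (ev x)) (a : Away 𝒜 f) :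
    awayEval 𝒜 ev hx' (awayMap 𝒜 hg hx a) = awayEval 𝒜 ev hf a := by
  obtain ⟨n, a, ha, rfl⟩ := Away.mk_surjective 𝒜 hd a
  rw [awayMap_mk]
  have hg' : IsUnit (ev g) := by
    rw [hx, map_mul] at hx'
    exact isUnit_of_mul_isUnit_right hx'
  have h1 := awayEval_mk hx' (hx ▸ SetLike.mul_mem_graded hd hg : x ∈ 𝒜 (d + e)) n (a * g ^ n)
    (by rw [smul_add]; exact SetLike.mul_mem_graded ha (SetLike.pow_mem_graded n hg))
  refine (hx'.pow n).mul_right_cancel (h1.trans ?_)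
  rw [map_mul, map_pow, hx, map_mul, mul_pow, ← mul_assoc, awayEval_mk]

theorem awayEval_fromZero {f : A} (hf : IsUnit (ev f)) (a : 𝒜 0) :
    awayEval 𝒜 ev hf (fromZeroRingHom 𝒜 _ a) = ev a :=
  IsLocalization.lift_eq _ _

/-- The evaluation forgets the grading and need only be injective in each degree. That suffices,
since cross-multiplying two degree zero fractions gives homogeneous elements of the same degree. -/
theorem awayEval_injective {f : A} (hf : IsUnit (ev f)) {d : ℕ} (hd : f ∈ 𝒜 d)
    (hev : ∀ n, ∀ a ∈ 𝒜 n, ∀ b ∈ 𝒜 n, ev a = ev b → a = b) :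
    Function.Injective (awayEval 𝒜 ev hf) := by
  intro a b hab
  obtain ⟨n, a, ha, rfl⟩ := Away.mk_surjective 𝒜 hd a
  obtain ⟨m, b, hb, rfl⟩ := Away.mk_surjective 𝒜 hd b
  have h1 := awayEval_mk hf hd n a ha
  have h2 := awayEval_mk hf hd m b hb
  have h3 : a * f ^ m = b * f ^ n := by
    refine hev (n • d + m • d) _ (SetLike.mul_mem_graded ha (SetLike.pow_mem_graded m hd)) _ ?_ ?_
    · rw [add_comm]
      exact SetLike.mul_mem_graded hb (SetLike.pow_mem_graded n hd)
    · rw [map_mul, map_mul, map_pow, map_pow, ← h1, ← h2, hab]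
      ring
  refine HomogeneousLocalization.val_injective _ ?_
  rw [Away.val_mk, Away.val_mk, Localization.mk_eq_mk_iff, Localization.r_iff_exists]
  refine ⟨1, ?_⟩
  simp only [OneMemClass.coe_one, one_mul]
  rw [mul_comm, h3, mul_comm]

end AwayEval

/-! ### The polytope -/

/-- The support numbers of a polytope with normal fan the fan of cells. -/
def supportNumber : Fin 2 × Fin 3 → ℤ
  | (0, _) => 0
  | (1, 0) => 49
  | (1, 1) => 32
  | (1, 2) => 18

/-- The distance of `m` to a facet of the `n`-th multiple of the polytope. -/
def slack (c : Fin 2 × Fin 3) : (Fin 3 → ℤ) × ℕ →+ ℤ where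
  toFun x := ray c ⬝ᵥ x.1 + x.2 * supportNumber c
  map_zero' := by simp
  map_add' x y := by
    simp only [Prod.fst_add, Prod.snd_add, dotProduct_add]
    push_cast
    ring

theorem slack_apply (c : Fin 2 × Fin 3) (m : Fin 3 → ℤ) (n : ℕ) :
    slack c (m, n) = ray c ⬝ᵥ m + n * supportNumber c := rfl

/-- The lattice points of the multiples of the polytope. -/
def polytopeMonoid : AddSubmonoid ((Fin 3 → ℤ) × ℕ) where
  carrier := {x | ∀ c, 0 ≤ slack c x}
  zero_mem' c := (map_zero (slack c)).ge
  add_mem' hx hy c := by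
    rw [map_add]
    exact add_nonneg (hx c) (hy c)

theorem mem_polytopeMonoid {x : (Fin 3 → ℤ) × ℕ} : x ∈ polytopeMonoid ↔ ∀ c, 0 ≤ slack c x :=
  Iff.rfl

theorem forall_index {P : Fin 2 × Fin 3 → Prop} : (∀ c, P c) ↔
    P (0, 0) ∧ P (0, 1) ∧ P (0, 2) ∧ P (1, 0) ∧ P (1, 1) ∧ P (1, 2) := by
  simp [Prod.forall, Fin.forall_fin_succ]
  tauto

theorem slack_formulas (m : Fin 3 → ℤ) (n : ℕ) :
    slack (0, 0) (m, n) = m 1 ∧ slack (0, 1) (m, n) = m 0 ∧ slack (0, 2) (m, n) = m 2 ∧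
    slack (1, 0) (m, n) = -5 * m 0 - 7 * m 1 - 3 * m 2 + 49 * n ∧
    slack (1, 1) (m, n) = -3 * m 0 - 5 * m 1 - 2 * m 2 + 32 * n ∧
    slack (1, 2) (m, n) = -2 * m 0 - 3 * m 1 - m 2 + 18 * n := by
  simp only [slack_apply, ray, supportNumber, dotProduct, Fin.sum_univ_three]
  simp
  refine ⟨?_, ?_, ?_⟩ <;> ring

/-- A form of Gordan's lemma. Recording all slacks identifies the monoid with a submonoid of a free
ℕ-module that is cut out by linear equations, hence closed under differences and finitely generated.
The point m is recovered from the slacks of the first row, whose rays are the standard basis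
vectors. -/
theorem polytopeMonoid_fg : polytopeMonoid.FG := by
  let S : AddSubmonoid ((Fin 2 × Fin 3 → ℕ) × ℕ) :=
    { carrier := {s | ∃ m, ∀ c, (s.1 c : ℤ) = slack c (m, s.2)}
      zero_mem' := ⟨0, fun c => (map_zero (slack c)).symm⟩
      add_mem' := by
        rintro s t ⟨m, hm⟩ ⟨m', hm'⟩
        refine ⟨m + m', fun c => ?_⟩
        have := map_add (slack c) (m, s.2) (m', t.2)
        rw [Prod.mk_add_mk] at this
        rw [Prod.snd_add, this, ← hm c, ← hm' c]
        simp }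
  have hS : S.FG := by
    refine AddSubmonoid.fg_of_subtractive ?_
    rintro x ⟨m, hm⟩ y ⟨m', hm'⟩
    refine ⟨m' - m, fun c => ?_⟩
    have h1 := hm c
    have h2 := hm' c
    simp only [slack_apply, Prod.fst_add, Prod.snd_add, Pi.add_apply, dotProduct_sub] at h1 h2 ⊢
    push_cast at h2
    linarith
  let L : (Fin 2 × Fin 3 → ℕ) × ℕ →+ (Fin 3 → ℤ) × ℕ :=
    { toFun := fun s => (![s.1 (0, 1), s.1 (0, 0), s.1 (0, 2)], s.2)
      map_zero' := by
        refine Prod.ext (funext fun i => ?_) rfl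
        fin_cases i <;> rfl
      map_add' := fun s t => by
        refine Prod.ext (funext fun i => ?_) rfl
        fin_cases i <;> simp }
  have hL : polytopeMonoid = S.map L := by
    ext ⟨m, n⟩
    rw [AddSubmonoid.mem_map]
    constructor
    · intro h
      refine ⟨(fun c => (slack c (m, n)).toNat, n), ⟨m, fun c => Int.toNat_of_nonneg (h c)⟩, ?_⟩
      obtain ⟨h0, h1, h2, -⟩ := slack_formulas m n
      have e0 := Int.toNat_of_nonneg (h (0, 0))
      have e1 := Int.toNat_of_nonneg (h (0, 1))
      have e2 := Int.toNat_of_nonneg (h (0, 2))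
      refine Prod.ext (funext fun i => ?_) rfl
      fin_cases i
      · exact e1.trans h1
      · exact e0.trans h0
      · exact e2.trans h2
    · rintro ⟨⟨s, n'⟩, ⟨m', hm'⟩, h⟩
      obtain ⟨h0, h1, h2, -⟩ := slack_formulas m' n'
      obtain ⟨rfl, rfl⟩ := Prod.mk.inj h
      have : ![(s (0, 1) : ℤ), s (0, 0), s (0, 2)] = m' := by
        funext i
        fin_cases i
        · exact (hm' _).trans h1
        · exact (hm' _).trans h0
        · exact (hm' _).trans h2
      intro c
      change 0 ≤ slack c (![(s (0, 1) : ℤ), s (0, 0), s (0, 2)], n')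
      rw [this]
      exact (hm' c) ▸ Int.natCast_nonneg _
  rw [hL]
  exact hS.map L

/-- The maximal cells. -/
def maxCell : Fin 8 → Finset (Fin 2 × Fin 3)
  | 0 => {(0, 0), (0, 1), (0, 2)}
  | 1 => {(1, 0), (1, 1), (1, 2)}
  | 2 => {(0, 0), (0, 1), (1, 1)}
  | 3 => {(0, 0), (1, 0), (1, 1)}
  | 4 => {(0, 0), (0, 2), (1, 2)}
  | 5 => {(0, 0), (1, 0), (1, 2)}
  | 6 => {(0, 1), (0, 2), (1, 2)}
  | 7 => {(0, 1), (1, 1), (1, 2)}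

/-- The vertices of the polytope. -/
def vertex : Fin 8 → Fin 3 → ℤ
  | 0 => ![0, 0, 0]
  | 1 => ![3, 1, 9]
  | 2 => ![0, 0, 16]
  | 3 => ![2, 0, 13]
  | 4 => ![9, 0, 0]
  | 5 => ![5, 0, 8]
  | 6 => ![0, 6, 0]
  | 7 => ![0, 4, 6]

/-- This check ties the support numbers 49, 32, 18 to the fan: the vertices are lattice points of
the polytope, each on exactly the three facets of its maximal cone. -/
theorem slack_vertex (i : Fin 8) (c : Fin 2 × Fin 3) :
    0 ≤ slack c (vertex i, 1) ∧ slack c (vertex i, 1) ≤ 49 ∧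
      (slack c (vertex i, 1) = 0 ↔ c ∈ maxCell i) := by
  rw [slack_apply]
  revert i c
  decide

instance : DecidablePred IsCell := fun _ => inferInstanceAs (Decidable (_ ∧ _))

theorem isCell_maxCell (i : Fin 8) : IsCell (maxCell i) := by
  revert i
  decide

theorem exists_subset_maxCell {C : Finset (Fin 2 × Fin 3)} (hC : IsCell C) :
    ∃ i, C ⊆ maxCell i := by
  revert C
  decide +kernel

/-- A cell is the intersection of the maximal cells containing it, so the sum of the corresponding
vertices lies on no facets but those of the cell. -/
theorem mem_of_forall_maxCell {C : Finset (Fin 2 × Fin 3)} (hC : IsCell C) {c : Fin 2 × Fin 3}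
    (h : ∀ i, C ⊆ maxCell i → c ∈ maxCell i) : c ∈ C := by
  revert C c
  decide +kernel

/-- A lattice point in the relative interior of the face corresponding to a cone. -/
def cellWeight (C : Finset (Fin 2 × Fin 3)) : (Fin 3 → ℤ) × ℕ :=
  ∑ i with C ⊆ maxCell i, (vertex i, 1)

theorem slack_cellWeight_nonneg (C : Finset (Fin 2 × Fin 3)) (c : Fin 2 × Fin 3) :
    0 ≤ slack c (cellWeight C) := by
  rw [cellWeight, map_sum]
  exact Finset.sum_nonneg fun i _ => (slack_vertex i c).1

theorem cellWeight_mem (C : Finset (Fin 2 × Fin 3)) : cellWeight C ∈ polytopeMonoid :=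
  slack_cellWeight_nonneg C

theorem slack_cellWeight_eq_zero {C : Finset (Fin 2 × Fin 3)} (hC : IsCell C) {c : Fin 2 × Fin 3} :
    slack c (cellWeight C) = 0 ↔ c ∈ C := by
  rw [cellWeight, map_sum, Finset.sum_eq_zero_iff_of_nonneg fun i _ => (slack_vertex i c).1]
  constructor
  · intro h
    exact mem_of_forall_maxCell hC fun i hi =>
      (slack_vertex i c).2.2.1 (h i (Finset.mem_filter.2 ⟨Finset.mem_univ _, hi⟩))
  · intro hc i hi
    exact (slack_vertex i c).2.2.2 ((Finset.mem_filter.1 hi).2 hc)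

theorem cellWeight_snd (C : Finset (Fin 2 × Fin 3)) :
    (cellWeight C).2 = (Finset.univ.filter fun i => C ⊆ maxCell i).card := by
  rw [cellWeight, Prod.snd_sum, Finset.card_eq_sum_ones]

theorem cellWeight_snd_pos {C : Finset (Fin 2 × Fin 3)} (hC : IsCell C) : 0 < (cellWeight C).2 := by
  rw [cellWeight_snd, Finset.card_pos]
  obtain ⟨i, hi⟩ := exists_subset_maxCell hC
  exact ⟨i, Finset.mem_filter.2 ⟨Finset.mem_univ _, hi⟩⟩

theorem exists_cellWeight_add {C C' : Finset (Fin 2 × Fin 3)} (h : C' ⊆ C) :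
    ∃ x ∈ polytopeMonoid, cellWeight C' = cellWeight C + x := by
  refine ⟨∑ i ∈ (Finset.univ.filter fun i => C' ⊆ maxCell i) \
    Finset.univ.filter fun i => C ⊆ maxCell i, (vertex i, 1), fun c => ?_, ?_⟩
  · rw [map_sum]
    exact Finset.sum_nonneg fun i _ => (slack_vertex i c).1
  · rw [cellWeight, cellWeight, add_comm]
    exact (Finset.sum_sdiff (Finset.monotone_filter_right _ fun i _ hi => h.trans hi)).symm

/-- The excluded sets are the minimal non-cells: the three incomparable pairs and the two chains of
length three that project onto both factors. -/
theorem exists_subset_maxCell_of_nonfaces (T : Finset (Fin 2 × Fin 3))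
    (h : ¬ ((0, 1) ∈ T ∧ (1, 0) ∈ T) ∧ ¬ ((0, 2) ∈ T ∧ (1, 0) ∈ T) ∧
      ¬ ((0, 2) ∈ T ∧ (1, 1) ∈ T) ∧ ¬ ((0, 0) ∈ T ∧ (0, 1) ∈ T ∧ (1, 2) ∈ T) ∧
      ¬ ((0, 0) ∈ T ∧ (1, 1) ∈ T ∧ (1, 2) ∈ T)) : ∃ i, T ⊆ maxCell i := by
  revert T
  decide +kernel

/-- Every lattice point of a multiple of the polytope lies only on facets through a common
vertex. -/
theorem exists_maxCell_of_mem {x : (Fin 3 → ℤ) × ℕ} (hx : x ∈ polytopeMonoid) (hn : 0 < x.2) :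
    ∃ i, ∀ c ∉ maxCell i, 0 < slack c x := by
  obtain ⟨i, hi⟩ := exists_subset_maxCell_of_nonfaces (Finset.univ.filter fun c => slack c x = 0)
    (by
      obtain ⟨m, n⟩ := x
      rw [mem_polytopeMonoid, forall_index] at hx
      simp only [Finset.mem_filter, Finset.mem_univ, true_and]
      obtain ⟨f0, f1, f2, f3, f4, f5⟩ := slack_formulas m n
      rw [f0, f1, f2, f3, f4, f5] at hx ⊢
      simp only at hn
      -- On a non-cell, vanishing of its slacks is incompatible with nonnegativity of the others as
      -- soon as n > 0.
      refine ⟨?_, ?_, ?_, ?_, ?_⟩ <;> omega)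
  refine ⟨i, fun c hc => lt_of_le_of_ne (hx c) fun h => hc (hi ?_)⟩
  exact Finset.mem_filter.2 ⟨Finset.mem_univ _, h.symm⟩

end FiniteHypergeometric

namespace FiniteHypergeometric

/-! ### The completed surface as a projective spectrum -/

section Model

open HomogeneousLocalization

variable {F : Type u} [Field F] (lam : F)

/-- The restrictions to `V_λ` of the sections of the `n`-th multiple of the polytope. -/
noncomputable def sectionSpace (n : ℕ) : Submodule F (TorusRing lam) :=
  Submodule.span F {f | ∃ m : Fin 3 → ℤ, (m, n) ∈ polytopeMonoid ∧ f = character lam m}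

instance : SetLike.GradedMonoid (sectionSpace lam) where
  one_mem := Submodule.subset_span ⟨0, zero_mem polytopeMonoid, character_zero.symm⟩
  mul_mem n n' a b ha hb := by
    have h := Submodule.mul_mem_mul ha hb
    rw [sectionSpace, sectionSpace, Submodule.span_mul_span] at h
    refine Submodule.span_mono ?_ h
    rintro _ ⟨_, ⟨m, hm, rfl⟩, _, ⟨m', hm', rfl⟩, rfl⟩
    exact ⟨m + m', add_mem hm hm', (character_add _ _).symm⟩

/-- The homogeneous coordinate ring of the completed surface. -/
abbrev CoordRing : Type u := sectionRing (sectionSpace lam)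

/-- The grading of the homogeneous coordinate ring. -/
noncomputable abbrev coordGrading : ℕ → Submodule F (CoordRing lam) := sectionGrading (sectionSpace lam)

/-- The monomials in the homogeneous coordinate ring. -/
noncomputable def polytopeSection : Multiplicative polytopeMonoid →* CoordRing lam where
  toFun x := homogeneousSection x.toAdd.1.2
    ⟨character lam x.toAdd.1.1, Submodule.subset_span ⟨_, x.toAdd.2, rfl⟩⟩
  map_one' := Subtype.ext (by
    change monomial 0 (character lam 0) = 1
    rw [character_zero]
    rfl)
  map_mul' x y := by
    rw [homogeneousSection_mul]
    refine Subtype.ext ?_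
    change monomial _ (character lam (_ + _)) = monomial _ (character lam _ * character lam _)
    rw [character_add]
    rfl

theorem polytopeSection_mem (x : polytopeMonoid) :
    polytopeSection lam (.ofAdd x) ∈ coordGrading lam x.1.2 :=
  homogeneousSection_mem _ _

/-- The evaluation of sections on `V_λ`. -/
noncomputable abbrev coordEval : CoordRing lam →+* TorusRing lam :=
  (sectionEval (sectionSpace lam)).toRingHom

theorem coordEval_polytopeSection (x : polytopeMonoid) :
    coordEval lam (polytopeSection lam (.ofAdd x)) = character lam x.1.1 :=
  sectionEval_homogeneousSection _ _

variable {lam} in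
theorem exists_sum_polytopeSection {n : ℕ} {a : CoordRing lam} (ha : a ∈ coordGrading lam n) :
    a ∈ Submodule.span F {f | ∃ x : polytopeMonoid, x.1.2 = n ∧
      f = polytopeSection lam (.ofAdd x)} := by
  have key : ∀ b (hb : b ∈ sectionSpace lam n), homogeneousSection n ⟨b, hb⟩ ∈
      Submodule.span F {f | ∃ x : polytopeMonoid, x.1.2 = n ∧
        f = polytopeSection lam (.ofAdd x)} := by
    intro b hb
    induction hb using Submodule.span_induction with
    | mem b hb =>
      obtain ⟨m, hm, rfl⟩ := hb
      exact Submodule.subset_span ⟨⟨(m, n), hm⟩, rfl, rfl⟩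
    | zero =>
      rw [show homogeneousSection n ⟨0, zero_mem _⟩ = (0 : CoordRing lam) from
        Subtype.ext (map_zero (monomial n))]
      exact zero_mem _
    | add b c hb hc h1 h2 =>
      rw [show homogeneousSection n ⟨b + c, add_mem hb hc⟩ =
        homogeneousSection n ⟨b, hb⟩ + homogeneousSection n ⟨c, hc⟩ from
        Subtype.ext (map_add (monomial n) b c)]
      exact add_mem h1 h2
    | smul r b hb h1 =>
      rw [show homogeneousSection n ⟨r • b, Submodule.smul_mem _ r hb⟩ =
        r • homogeneousSection n ⟨b, hb⟩ from Subtype.ext (smul_monomial r n b).symm]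
      exact Submodule.smul_mem _ r h1
  rw [eq_homogeneousSection ha]
  exact key _ _

instance : Algebra.FiniteType F (CoordRing lam) := by
  have hfg : AddMonoid.FG polytopeMonoid :=
    (AddMonoid.fg_iff_addSubmonoid_fg _).2 polytopeMonoid_fg
  let L : AddMonoidAlgebra F polytopeMonoid →ₐ[F] CoordRing lam :=
    AddMonoidAlgebra.lift F _ _ (polytopeSection lam)
  refine Algebra.FiniteType.of_surjective L ?_
  have hle : ∀ n, coordGrading lam n ≤ L.toLinearMap.range := by
    intro n a ha
    refine Submodule.span_le.2 ?_ (exists_sum_polytopeSection ha)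
    rintro _ ⟨x, -, rfl⟩
    refine ⟨.single x 1, ?_⟩
    simp [L, AddMonoidAlgebra.lift_single]
  intro a
  have : a ∈ L.toLinearMap.range := by
    rw [← sum_homogeneousSection a]
    exact sum_mem fun n _ => hle n (homogeneousSection_mem _ _)
  exact this

instance : Algebra.FiniteType (coordGrading lam 0) (CoordRing lam) :=
  have : IsScalarTower F (coordGrading lam 0) (CoordRing lam) :=
    ⟨fun r a b => smul_mul_assoc r (a : CoordRing lam) b⟩
  Algebra.FiniteType.of_restrictScalars_finiteType F _ _

/-- The constants, as sections of degree zero. -/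
noncomputable def constHom : F →+* coordGrading lam 0 := algebraMap F (coordGrading lam 0)

/-- The zeroth multiple of the polytope is the origin alone, by completeness of the fan, so degree
zero consists of constants. -/
theorem constHom_surjective : Function.Surjective (constHom lam) := by
  rintro ⟨a, ha⟩
  have h := exists_sum_polytopeSection ha
  have h1 : {f | ∃ x : polytopeMonoid, x.1.2 = 0 ∧ f = polytopeSection lam (.ofAdd x)} ⊆
      {1} := by
    rintro _ ⟨⟨⟨m, n⟩, hx⟩, rfl, rfl⟩
    have hm : m = 0 := by
      rw [mem_polytopeMonoid, forall_index] at hx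
      obtain ⟨f0, f1, f2, f3, f4, f5⟩ := slack_formulas m 0
      rw [f0, f1, f2, f3, f4, f5] at hx
      push_cast at hx
      funext i
      fin_cases i
      · change m 0 = 0
        omega
      · change m 1 = 0
        omega
      · change m 2 = 0
        omega
    subst hm
    exact map_one (polytopeSection lam)
  obtain ⟨r, hr⟩ := Submodule.mem_span_singleton.1 (Submodule.span_mono h1 h)
  exact ⟨r, Subtype.ext ((Algebra.algebraMap_eq_smul_one r).trans hr)⟩

/-- The structure morphism of the completed surface. -/
noncomputable def modelToSpec : Proj (coordGrading lam) ⟶ Spec (CommRingCat.of F) :=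
  Proj.toSpecZero (coordGrading lam) ≫
    Spec.map (CommRingCat.ofHom (constHom lam))

theorem isClosedImmersion_constHom : IsClosedImmersion
    (Spec.map (CommRingCat.ofHom (R := F) (S := coordGrading lam 0) (constHom lam))) :=
  IsClosedImmersion.spec_of_surjective
    (CommRingCat.ofHom (R := F) (S := coordGrading lam 0) (constHom lam)) (constHom_surjective lam)

/-- Proj of a graded algebra of finite type over its degree zero part is proper over the spectrum of
that part, which is closed in Spec F. -/
theorem isProper_modelToSpec : IsProper (modelToSpec lam) := by
  have := isClosedImmersion_constHom lam
  unfold modelToSpec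
  infer_instance

/-! ### Charts of the model -/

/-- The section defining the chart of a cone. -/
noncomputable def cellSection (C : Finset (Fin 2 × Fin 3)) : CoordRing lam :=
  polytopeSection lam (.ofAdd ⟨cellWeight C, cellWeight_mem C⟩)

theorem cellSection_mem (C : Finset (Fin 2 × Fin 3)) :
    cellSection lam C ∈ coordGrading lam (cellWeight C).2 :=
  polytopeSection_mem lam ⟨cellWeight C, cellWeight_mem C⟩

theorem coordEval_cellSection (C : Finset (Fin 2 × Fin 3)) :
    coordEval lam (cellSection lam C) = character lam (cellWeight C).1 :=
  coordEval_polytopeSection lam ⟨cellWeight C, cellWeight_mem C⟩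

theorem isUnit_coordEval_cellSection (C : Finset (Fin 2 × Fin 3)) :
    IsUnit (coordEval lam (cellSection lam C)) := by
  rw [coordEval_cellSection]
  exact isUnit_character _

variable {lam} in
theorem coordEval_injective (n : ℕ) (a : CoordRing lam) (ha : a ∈ coordGrading lam n)
    (b : CoordRing lam) (hb : b ∈ coordGrading lam n) (h : coordEval lam a = coordEval lam b) :
    a = b := by
  rw [eq_homogeneousSection ha, eq_homogeneousSection hb] at h ⊢
  have h' := (sectionEval_homogeneousSection (k := F) n _).symm.trans
    (h.trans (sectionEval_homogeneousSection n _))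
  exact congrArg _ (Subtype.ext h')

/-- The functions on a chart of the model, as functions on `V_λ`. -/
noncomputable abbrev cellEval (C : Finset (Fin 2 × Fin 3)) :
    Away (coordGrading lam) (cellSection lam C) →+* TorusRing lam :=
  awayEval (coordGrading lam) (coordEval lam) (isUnit_coordEval_cellSection lam C)

theorem cellEval_injective (C : Finset (Fin 2 × Fin 3)) : Function.Injective (cellEval lam C) :=
  awayEval_injective _ (cellSection_mem lam C) coordEval_injective

theorem ray_sub_nsmul (c : Fin 2 × Fin 3) (x y : (Fin 3 → ℤ) × ℕ) (n : ℕ) (h : x.2 = n * y.2) :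
    ray c ⬝ᵥ (x.1 - n • y.1) = slack c x - n * slack c y := by
  obtain ⟨m, k⟩ := x
  obtain ⟨m', k'⟩ := y
  simp only at h
  subst h
  simp only [slack_apply, dotProduct_sub, dotProduct_smul]
  push_cast
  rw [nsmul_eq_mul]
  ring

theorem eq_character_sub {a : TorusRing lam} {m m' : Fin 3 → ℤ} {n : ℕ}
    (h : a * character lam m' ^ n = character lam m) : a = character lam (m - n • m') := by
  refine ((isUnit_character m').pow n).mul_right_cancel (h.trans ?_)
  rw [← character_nsmul, ← character_add, sub_add_cancel]

variable {lam}

/-- A fraction with monomial numerator x and denominator the n-th power of the cell section has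
order `slack c x - n * slack c (cellWeight C)` along ray c, and the second term vanishes for c in C.
-/
theorem cellEval_mem {C : Finset (Fin 2 × Fin 3)} (hC : IsCell C)
    (z : Away (coordGrading lam) (cellSection lam C)) : cellEval lam C z ∈ chartRing lam C := by
  obtain ⟨n, a, ha, rfl⟩ := Away.mk_surjective _ (cellSection_mem lam C) z
  have h1 := awayEval_mk (isUnit_coordEval_cellSection lam C) (cellSection_mem lam C) n a ha
  rw [coordEval_cellSection] at h1
  obtain ⟨b, hb⟩ : ∃ b, b = cellEval lam C (Away.mk _ (cellSection_mem lam C) n a ha) := ⟨_, rfl⟩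
  rw [← hb]
  change cellEval lam C _ * _ = _ at h1
  rw [← hb] at h1
  have h2 : ∀ a' ∈ Submodule.span F {f | ∃ x : polytopeMonoid, x.1.2 = n • (cellWeight C).2 ∧
      f = polytopeSection lam (.ofAdd x)}, ∀ b : TorusRing lam,
        b * character lam (cellWeight C).1 ^ n = coordEval lam a' → b ∈ chartRing lam C := by
    intro a' ha'
    induction ha' using Submodule.span_induction with
    | mem a' ha' =>
      rintro b hb
      obtain ⟨x, hx, rfl⟩ := ha'
      rw [coordEval_polytopeSection] at hb
      rw [eq_character_sub lam hb]
      refine character_mem fun c hc => ?_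
      rw [ray_sub_nsmul c x.1 _ n (by rw [hx, smul_eq_mul]), (slack_cellWeight_eq_zero hC).2 hc,
        mul_zero, sub_zero]
      exact x.2 c
    | zero =>
      intro b hb
      rw [map_zero] at hb
      rw [((isUnit_character (cellWeight C).1).pow n).mul_left_eq_zero.1 hb]
      exact zero_mem _
    | add a₁ a₂ _ _ h₁ h₂ =>
      intro b hb
      obtain ⟨v, hv⟩ := ((isUnit_character (lam := lam) (cellWeight C).1).pow n).exists_left_inv
      have hb' : b = coordEval lam a₁ * v + coordEval lam a₂ * v := by
        rw [← add_mul, ← map_add, ← hb, mul_assoc, mul_comm _ v, hv, mul_one]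
      rw [hb']
      exact add_mem (h₁ _ (by rw [mul_assoc, hv, mul_one])) (h₂ _ (by rw [mul_assoc, hv, mul_one]))
    | smul r a₁ _ h₁ =>
      intro b hb
      obtain ⟨v, hv⟩ := ((isUnit_character (lam := lam) (cellWeight C).1).pow n).exists_left_inv
      have hb' : b = r • (coordEval lam a₁ * v) := by
        rw [← smul_mul_assoc,
          ← show coordEval lam (r • a₁) = r • coordEval lam a₁ from map_smul (sectionEval _) r a₁,
          ← hb, mul_assoc, mul_comm _ v, hv, mul_one]
      rw [hb']
      exact Subalgebra.smul_mem _ (h₁ _ (by rw [mul_assoc, hv, mul_one])) r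
  exact h2 a (exists_sum_polytopeSection ha) b h1

/-- Off C the slack of `cellWeight C` is positive. A large multiple of it therefore moves any
exponent of the dual cone into a multiple of the polytope, which exhibits the monomial as a
fraction. -/
theorem exists_cellEval_eq {C : Finset (Fin 2 × Fin 3)} (hC : IsCell C) {b : TorusRing lam}
    (hb : b ∈ chartRing lam C) : ∃ z, cellEval lam C z = b := by
  induction hb using Algebra.adjoin_induction with
  | mem b hb =>
    obtain ⟨m, hm, rfl⟩ := hb
    obtain ⟨k, hk⟩ : ∃ k : ℕ, ∀ c, -(ray c ⬝ᵥ m) ≤ k := by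
      refine ⟨∑ c, (ray c ⬝ᵥ m).natAbs, fun c => ?_⟩
      have := Finset.single_le_sum (f := fun c => (ray c ⬝ᵥ m).natAbs)
        (fun _ _ => Nat.zero_le _) (Finset.mem_univ c)
      omega
    have hx : (m + k • (cellWeight C).1, k • (cellWeight C).2) ∈ polytopeMonoid := by
      intro c
      have h1 := ray_sub_nsmul c (m + k • (cellWeight C).1, k • (cellWeight C).2) (cellWeight C) k rfl
      rw [add_sub_cancel_right] at h1
      by_cases hc : c ∈ C
      · have := hm c hc
        have := (slack_cellWeight_eq_zero hC).2 hc
        rw [this] at h1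
        linarith
      · have h2 : 1 ≤ slack c (cellWeight C) :=
          lt_of_le_of_ne (slack_cellWeight_nonneg C c)
            fun h => hc ((slack_cellWeight_eq_zero hC).1 h.symm)
        have := hk c
        nlinarith
    refine ⟨Away.mk _ (cellSection_mem lam C) k (polytopeSection lam (.ofAdd ⟨_, hx⟩))
      (polytopeSection_mem lam ⟨_, hx⟩), ?_⟩
    have h1 := awayEval_mk (isUnit_coordEval_cellSection lam C) (cellSection_mem lam C) k
      (polytopeSection lam (.ofAdd ⟨_, hx⟩)) (polytopeSection_mem lam ⟨_, hx⟩)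
    rw [coordEval_cellSection, coordEval_polytopeSection] at h1
    rw [eq_character_sub lam h1, add_sub_cancel_right]
  | algebraMap r =>
    refine ⟨fromZeroRingHom _ _ (constHom lam r), ?_⟩
    rw [awayEval_fromZero]
    exact (sectionEval (sectionSpace lam)).commutes r
  | add b c _ _ hb hc =>
    obtain ⟨z, rfl⟩ := hb
    obtain ⟨z', rfl⟩ := hc
    exact ⟨z + z', map_add _ _ _⟩
  | mul b c _ _ hb hc =>
    obtain ⟨z, rfl⟩ := hb
    obtain ⟨z', rfl⟩ := hc
    exact ⟨z * z', map_mul _ _ _⟩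

/-- The identification of the functions on a chart of the model. -/
noncomputable def awayHom {C : Finset (Fin 2 × Fin 3)} (hC : IsCell C) :
    Away (coordGrading lam) (cellSection lam C) →+* chartRing lam C :=
  (cellEval lam C).codRestrict (chartRing lam C) (cellEval_mem hC)

theorem val_awayHom {C : Finset (Fin 2 × Fin 3)} (hC : IsCell C)
    (z : Away (coordGrading lam) (cellSection lam C)) :
    (awayHom hC z : TorusRing lam) = cellEval lam C z := rfl

theorem awayHom_bijective {C : Finset (Fin 2 × Fin 3)} (hC : IsCell C) :
    Function.Bijective (awayHom (lam := lam) hC) :=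
  ⟨fun _ _ h => cellEval_injective lam C (congrArg Subtype.val h), fun b => by
    obtain ⟨z, hz⟩ := exists_cellEval_eq hC b.2
    exact ⟨z, Subtype.ext hz⟩⟩

variable (lam)

/-- The charts of the model. -/
noncomputable def modelChart (C : Cell) : chartScheme lam C.1 ⟶ Proj (coordGrading lam) :=
  Spec.map (CommRingCat.ofHom (awayHom (lam := lam) C.2)) ≫
    Proj.awayι _ (cellSection lam C.1) (cellSection_mem lam C.1) (cellWeight_snd_pos C.2)

instance isIso_awayHom (C : Cell) :
    IsIso (CommRingCat.ofHom (awayHom (lam := lam) C.2)) :=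
  (ConcreteCategory.isIso_iff_bijective _).2 (awayHom_bijective C.2)

instance isOpenImmersion_modelChart (C : Cell) : IsOpenImmersion (modelChart lam C) := by
  unfold modelChart
  infer_instance

theorem modelChart_toSpec (C : Cell) : modelChart lam C ≫ modelToSpec lam =
    Spec.map (CommRingCat.ofHom (algebraMap F (chartRing lam C.1))) := by
  rw [modelChart, modelToSpec, Category.assoc, Proj.awayι_toSpecZero_assoc, ← Spec.map_comp,
    ← Spec.map_comp, ← CommRingCat.ofHom_comp, ← CommRingCat.ofHom_comp]
  congr 2
  refine RingHom.ext fun r => Subtype.ext ?_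
  change (awayHom C.2 (fromZeroRingHom _ _ (constHom lam r)) :
    TorusRing lam) = algebraMap F (TorusRing lam) r
  rw [val_awayHom, awayEval_fromZero]
  exact (sectionEval (sectionSpace lam)).commutes r

/-- The section of a face is a multiple of the section of the cone, so one basic open set contains
the other. Compatibility can be tested after evaluation on V_λ. -/
theorem faceMap_modelChart (C C' : Cell) (h : C'.1 ⊆ C.1) :
    faceMap lam h ≫ modelChart lam C = modelChart lam C' := by
  obtain ⟨x, hx, hxw⟩ := exists_cellWeight_add h
  have hmul : cellSection lam C'.1 = cellSection lam C.1 * polytopeSection lam (.ofAdd ⟨x, hx⟩) := by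
    rw [cellSection, cellSection, ← map_mul]
    congr 1
    exact congrArg Multiplicative.ofAdd (Subtype.ext hxw)
  have h1 := Proj.SpecMap_awayMap_awayι (coordGrading lam) (cellSection_mem lam C.1)
    (cellWeight_snd_pos C.2) (polytopeSection_mem lam ⟨x, hx⟩) hmul
  rw [modelChart, modelChart, faceMap, ← Category.assoc, ← Spec.map_comp]
  have h2 : CommRingCat.ofHom (awayHom (lam := lam) C.2) ≫
      CommRingCat.ofHom (Subalgebra.inclusion (chartRing_anti lam h)).toRingHom =
      CommRingCat.ofHom (awayMap (coordGrading lam) (polytopeSection_mem lam ⟨x, hx⟩) hmul) ≫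
        CommRingCat.ofHom (awayHom (lam := lam) C'.2) := by
    rw [← CommRingCat.ofHom_comp, ← CommRingCat.ofHom_comp]
    congr 1
    refine RingHom.ext fun z => Subtype.ext ?_
    exact (awayEval_awayMap _ (cellSection_mem lam C.1) (polytopeSection_mem lam ⟨x, hx⟩) hmul
      (isUnit_coordEval_cellSection lam C'.1) z).symm
  rw [h2, Spec.map_comp, Category.assoc, h1]
  have hd : (cellWeight C'.1).2 = (cellWeight C.1).2 + x.2 := congrArg Prod.snd hxw
  congr 1

theorem mem_range_modelChart (C : Cell) (x : Proj (coordGrading lam)) :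
    x ∈ Set.range (modelChart lam C) ↔ x ∈ Proj.basicOpen (coordGrading lam) (cellSection lam C.1) := by
  have h : (modelChart lam C).opensRange =
      Proj.basicOpen (coordGrading lam) (cellSection lam C.1) := by
    exact (Scheme.Hom.opensRange_comp_of_isIso (Spec.map (CommRingCat.ofHom (awayHom C.2)))
      (Proj.awayι _ (cellSection lam C.1) (cellSection_mem lam C.1)
        (cellWeight_snd_pos C.2))).trans (Proj.opensRange_awayι _ _ _ _)
  rw [← h]
  rfl

end Model

end FiniteHypergeometric

namespace FiniteHypergeometric

/-! ### The charts cover, and the affine surface is dense -/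

section Completion

variable {F : Type u} [Field F] {lam : F}

/-- For the maximal cell of a vertex whose facets include all those through x, large multiples of x
beat the weight on the other facets, while on the facets of the cell the weight has slack zero. -/
theorem exists_nsmul_eq_cellWeight_add {x : (Fin 3 → ℤ) × ℕ} (hx : x ∈ polytopeMonoid)
    (hn : 0 < x.2) : ∃ i, ∃ k : ℕ, ∃ y ∈ polytopeMonoid, k • x = cellWeight (maxCell i) + y := by
  obtain ⟨i, hi⟩ := exists_maxCell_of_mem hx hn
  obtain ⟨w, hw⟩ : ∃ w, w = cellWeight (maxCell i) := ⟨_, rfl⟩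
  obtain ⟨k, hk, hk'⟩ : ∃ k : ℕ, w.2 ≤ k ∧ ∀ c, slack c w ≤ k := by
    refine ⟨w.2 + ∑ c, (slack c w).natAbs, by omega, fun c => ?_⟩
    have := Finset.single_le_sum (f := fun c => (slack c w).natAbs)
      (fun _ _ => Nat.zero_le _) (Finset.mem_univ c)
    omega
  have hy : k • x = w + (k • x.1 - w.1, k * x.2 - w.2) := by
    refine Prod.ext ?_ ?_
    · simp
    · have : w.2 ≤ k * x.2 := hk.trans (Nat.le_mul_of_pos_right _ hn)
      change k * x.2 = w.2 + (k * x.2 - w.2)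
      omega
  refine ⟨i, k, _, fun c => ?_, hw ▸ hy⟩
  rw [← hw]
  have h1 := congrArg (slack c) hy
  rw [map_add, map_nsmul, nsmul_eq_mul] at h1
  by_cases hc : c ∈ maxCell i
  · have h2 := (slack_cellWeight_eq_zero (isCell_maxCell i)).2 hc
    rw [← hw] at h2
    have h3 := mul_nonneg (Int.natCast_nonneg k) (hx c)
    linarith
  · have h2 := hk' c
    have h3 : 1 ≤ slack c x := hi c hc
    have h4 := mul_le_mul_of_nonneg_left h3 (Int.natCast_nonneg k)
    linarith

/-- A homogeneous prime outside all eight charts contains their sections, hence a power of every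
monomial of positive degree, hence the irrelevant ideal. -/
theorem exists_mem_range_modelChart (x : Proj (coordGrading lam)) :
    ∃ i : Fin 8, x ∈ Set.range (modelChart lam ⟨maxCell i, isCell_maxCell i⟩) := by
  by_contra hx
  have H : ∀ i, cellSection lam (maxCell i) ∈ x.asHomogeneousIdeal.toIdeal := fun i =>
    by_contra fun h => hx ⟨i, (mem_range_modelChart _ _ _).2 ((Proj.mem_basicOpen _ _ _).2 h)⟩
  have hprime : (x.asHomogeneousIdeal).toIdeal.IsPrime := x.isPrime
  refine x.not_irrelevant_le fun a ha => ?_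
  have hpoly : ∀ y : polytopeMonoid, 0 < y.1.2 →
      polytopeSection lam (.ofAdd y) ∈ x.asHomogeneousIdeal.toIdeal := by
    intro y hy
    obtain ⟨i, k, z, hz, h⟩ := exists_nsmul_eq_cellWeight_add y.2 hy
    refine hprime.mem_of_pow_mem k ?_
    have h1 : polytopeSection lam (.ofAdd y) ^ k = cellSection lam (maxCell i) *
        polytopeSection lam (.ofAdd ⟨z, hz⟩) := by
      rw [cellSection, ← map_pow, ← map_mul]
      congr 1
      exact congrArg Multiplicative.ofAdd (Subtype.ext h)
    rw [h1]
    exact Ideal.mul_mem_right _ _ (H i)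
  classical
  rw [← DirectSum.sum_support_decompose (coordGrading lam) a]
  refine Ideal.sum_mem _ fun n _ => ?_
  by_cases hn : n = 0
  · subst hn
    rw [show (DirectSum.decompose (coordGrading lam) a 0 : CoordRing lam) = 0 from ha]
    exact Ideal.zero_mem _
  · have h1 := exists_sum_polytopeSection (DirectSum.decompose (coordGrading lam) a n).2
    refine (Submodule.span_le (p := x.asHomogeneousIdeal.toIdeal.restrictScalars F)).2 ?_ h1
    rintro _ ⟨y, hy, rfl⟩
    exact hpoly y (by omega)

theorem isCell_affineCell : IsCell affineCell := isCell_maxCell 0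

theorem surfaceRingEquiv_algebraMap (hlam : lam ≠ 0) (r : F) :
    surfaceRingEquiv hlam (algebraMap F _ r) = algebraMap F _ r := by
  refine Subtype.ext ?_
  change Ideal.Quotient.mk _ (toLaurent (MvPolynomial.C r)) = _
  rw [show toLaurent (MvPolynomial.C r : MvPolynomial (Fin 3) F) = algebraMap F _ r from
    toLaurent.commutes r]
  rfl

/-- The inverse of the restriction of functions from the affine surface to `V_λ`. -/
noncomputable def extendToSurface (hlam : lam ≠ 0) : chartRing lam affineCell →+* SurfaceRing lam :=
  (surfaceRingEquiv hlam).symm.toRingHom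

theorem extendToSurface_bijective (hlam : lam ≠ 0) : Function.Bijective (extendToSurface hlam) :=
  (surfaceRingEquiv hlam).symm.bijective

/-- The affine surface as a chart. -/
noncomputable def surfaceToChart (hlam : lam ≠ 0) : surface lam ⟶ chartScheme lam affineCell :=
  Spec.map (CommRingCat.ofHom (extendToSurface hlam))

theorem isIso_surfaceToChart (hlam : lam ≠ 0) : IsIso (surfaceToChart hlam) := by
  have : IsIso (CommRingCat.ofHom (extendToSurface hlam)) :=
    (ConcreteCategory.isIso_iff_bijective _).2 (extendToSurface_bijective hlam)
  unfold surfaceToChart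
  infer_instance

theorem torusToSurface_surfaceToChart (hlam : lam ≠ 0) :
    torusToSurface lam ≫ surfaceToChart hlam = torusToChart lam affineCell := by
  rw [torusToSurface, surfaceToChart, torusToChart, ← Spec.map_comp, ← CommRingCat.ofHom_comp]
  congr 2
  refine RingHom.ext fun b => ?_
  obtain ⟨a, rfl⟩ := (surfaceRingEquiv hlam).surjective b
  change restrict lam ((surfaceRingEquiv hlam).symm (surfaceRingEquiv hlam a)) = _
  rw [RingEquiv.symm_apply_apply]
  rfl

variable (lam) in
-- All these maps factor through the chart of the empty cell, which is a face of every cone.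
theorem torusToChart_modelChart (C C' : Cell) :
    torusToChart lam C.1 ≫ modelChart lam C = torusToChart lam C'.1 ≫ modelChart lam C' := by
  have hcell : IsCell ∅ := by decide
  have key : ∀ C : Cell, torusToChart lam C.1 ≫ modelChart lam C =
      torusToChart lam ∅ ≫ modelChart lam ⟨∅, hcell⟩ := by
    intro C
    rw [← faceMap_modelChart lam C ⟨∅, hcell⟩ (Finset.empty_subset _), ← Category.assoc]
    congr 1
    rw [torusToChart, torusToChart, faceMap, ← Spec.map_comp, ← CommRingCat.ofHom_comp]
    rfl
  rw [key C, key C']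

theorem denseRange_torusToChart (C : Finset (Fin 2 × Fin 3)) :
    DenseRange (torusToChart lam C) := by
  refine (PrimeSpectrum.denseRange_comap_iff_ker_le_nilRadical
    (chartRing lam C).val.toRingHom).2 ?_
  rw [(RingHom.injective_iff_ker_eq_bot _).1 Subtype.val_injective]
  exact bot_le

/-- The completion of the affine surface. -/
noncomputable def model (hlam : lam ≠ 0) : Completion lam where
  X := Proj (coordGrading lam)
  π := modelToSpec lam
  proper := isProper_modelToSpec lam
  chart := modelChart lam
  chart_open := isOpenImmersion_modelChart lam
  chart_over := modelChart_toSpec lam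
  chart_face := faceMap_modelChart lam
  chart_cover x := by
    obtain ⟨i, hi⟩ := exists_mem_range_modelChart x
    exact ⟨_, hi⟩
  ι := surfaceToChart hlam ≫ modelChart lam ⟨affineCell, isCell_affineCell⟩
  ι_open := by
    have := isIso_surfaceToChart hlam
    infer_instance
  ι_dense := by
    rw [DenseRange, dense_iff_inter_open]
    rintro U hU ⟨x, hx⟩
    -- V_λ is dense in each chart, because the chart ring is a subring of its coordinate ring, and
    -- its points lie in S_λ.
    obtain ⟨i, z, rfl⟩ := exists_mem_range_modelChart x
    obtain ⟨_, hz, v, rfl⟩ := dense_iff_inter_open.1 (denseRange_torusToChart (maxCell i))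
      (modelChart lam ⟨maxCell i, isCell_maxCell i⟩ ⁻¹' U)
      (hU.preimage (modelChart lam ⟨maxCell i, isCell_maxCell i⟩).continuous) ⟨z, hx⟩
    refine ⟨_, hz, torusToSurface lam v, ?_⟩
    have h := torusToChart_modelChart lam ⟨affineCell, isCell_affineCell⟩
      ⟨maxCell i, isCell_maxCell i⟩
    rw [← torusToSurface_surfaceToChart hlam, Category.assoc] at h
    have h2 := congrArg (fun f => f v) h
    simpa only [Scheme.Hom.comp_apply] using h2
  ι_over := by
    rw [Category.assoc, modelChart_toSpec, surfaceToChart, ← Spec.map_comp,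
      ← CommRingCat.ofHom_comp]
    congr 2
    refine RingHom.ext fun r => ?_
    exact (surfaceRingEquiv hlam).symm_apply_eq.2 (surfaceRingEquiv_algebraMap hlam r).symm
  ι_torus C := by
    rw [← Category.assoc, torusToSurface_surfaceToChart]
    exact torusToChart_modelChart lam ⟨affineCell, isCell_affineCell⟩ C

end Completion

end FiniteHypergeometric

namespace FiniteHypergeometric

/-! ### Rational points in charts -/

section Points

attribute [local irreducible] cellWeight

open HomogeneousLocalization

variable {F : Type u} [Field F] {lam : F}

/-- The value of a monomial at a rational point of a chart. -/
noncomputable def chartValue {C : Finset (Fin 2 × Fin 3)} (φ : chartRing lam C →ₐ[F] F)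
    (m : dualCone C) : F :=
  φ (chartMonomial lam C (.ofAdd m))

section ChartValue

variable {C : Finset (Fin 2 × Fin 3)} (φ : chartRing lam C →ₐ[F] F)

theorem chartValue_zero : chartValue φ 0 = 1 := by
  rw [chartValue, ofAdd_zero, map_one, map_one]

theorem chartValue_add (m m' : dualCone C) :
    chartValue φ (m + m') = chartValue φ m * chartValue φ m' := by
  rw [chartValue, ofAdd_add, map_mul, map_mul]
  rfl

theorem chartValue_nsmul (k : ℕ) (m : dualCone C) :
    chartValue φ (k • m) = chartValue φ m ^ k := by
  rw [chartValue, ofAdd_nsmul, map_pow, map_pow]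
  rfl

/-- Some multiple of m exceeds m' along all rays of C, so the monomial of m' divides a power of that
of m in the chart. -/
theorem chartValue_ne_zero {m m' : dualCone C} (hm : chartValue φ m ≠ 0)
    (h : ∀ c ∈ C, ray c ⬝ᵥ (m : Fin 3 → ℤ) = 0 → ray c ⬝ᵥ (m' : Fin 3 → ℤ) = 0) :
    chartValue φ m' ≠ 0 := by
  obtain ⟨k, hk⟩ : ∃ k : ℕ, ∀ c, ray c ⬝ᵥ (m' : Fin 3 → ℤ) ≤ k := by
    refine ⟨∑ c, (ray c ⬝ᵥ (m' : Fin 3 → ℤ)).natAbs, fun c => ?_⟩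
    have := Finset.single_le_sum (f := fun c => (ray c ⬝ᵥ (m' : Fin 3 → ℤ)).natAbs)
      (fun _ _ => Nat.zero_le _) (Finset.mem_univ c)
    omega
  have hmem : k • (m : Fin 3 → ℤ) - (m' : Fin 3 → ℤ) ∈ dualCone C := by
    intro c hc
    rw [dotProduct_sub, dotProduct_smul, nsmul_eq_mul, sub_nonneg]
    have h0 := m.2 c hc
    by_cases hc0 : ray c ⬝ᵥ (m : Fin 3 → ℤ) = 0
    · rw [h c hc hc0, hc0, mul_zero]
    · have h1 : 1 ≤ ray c ⬝ᵥ (m : Fin 3 → ℤ) := lt_of_le_of_ne h0 (Ne.symm hc0)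
      have h2 := mul_le_mul_of_nonneg_left h1 (Int.natCast_nonneg k)
      linarith [hk c]
  have hsum : k • m = m' + ⟨_, hmem⟩ := Subtype.ext (by
    change k • (m : Fin 3 → ℤ) = m' + (k • (m : Fin 3 → ℤ) - m')
    abel)
  intro h0
  have h1 := chartValue_nsmul φ k m
  rw [hsum, chartValue_add, h0, zero_mul] at h1
  exact pow_ne_zero k hm h1.symm

theorem sum_coordCoeff_mul_chartValue {e : Fin 2 ⊕ Fin 3} (he : ∀ c ∈ C, ¬ Involves c e) :
    ∑ o, coordCoeff lam o *
      chartValue φ ⟨coordExponent o - coordExponent e, coordExponent_sub_mem he o⟩ = 0 :=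
  sum_coordCoeff_mul_chartHom he φ

theorem chartValue_ext {φ φ' : chartRing lam C →ₐ[F] F}
    (h : ∀ m, chartValue φ m = chartValue φ' m) : φ = φ' :=
  chartHom_ext fun m => h m.toAdd

end ChartValue

/-- The rational point of the completed surface given by a point of a chart. -/
noncomputable def pointOf (hlam : lam ≠ 0) (C : Cell) (φ : chartRing lam C.1 →ₐ[F] F) :
    (model hlam).RationalPoints :=
  ⟨Spec.map (CommRingCat.ofHom φ.toRingHom) ≫ modelChart lam C, by
    change (_ ≫ _) ≫ modelToSpec lam = _
    rw [Category.assoc, modelChart_toSpec, ← Spec.map_comp, ← CommRingCat.ofHom_comp]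
    have h : φ.toRingHom.comp (algebraMap F (chartRing lam C.1)) = RingHom.id F :=
      RingHom.ext fun r => φ.commutes r
    exact (congrArg (fun f => Spec.map (CommRingCat.ofHom f)) h).trans (Spec.map_id _)⟩

theorem pointOf_injective (hlam : lam ≠ 0) (C : Cell) : Function.Injective (pointOf hlam C) := by
  intro φ φ' h
  have h1 := congrArg Subtype.val h
  have h2 := Spec.map_injective ((cancel_mono (modelChart lam C)).1 h1)
  have h3 : φ.toRingHom = φ'.toRingHom := congrArg CommRingCat.Hom.hom h2
  exact AlgHom.ext fun x => DFunLike.congr_fun h3 x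

/-- Spec F is a single point, so a section factors through an open chart as soon as its image lies
there. -/
theorem mem_range_pointOf {hlam : lam ≠ 0} (C : Cell) (s : (model hlam).RationalPoints) :
    s ∈ Set.range (pointOf hlam C) ↔
      s.1 (⊥ : PrimeSpectrum F) ∈ Set.range (modelChart lam C) := by
  constructor
  · rintro ⟨φ, rfl⟩
    exact ⟨_, (Scheme.Hom.comp_apply _ _ _).symm⟩
  · intro hs
    have hr : Set.range s.1 ⊆ Set.range (modelChart lam C) := by
      rintro _ ⟨p, rfl⟩
      rw [Subsingleton.elim p (⊥ : PrimeSpectrum F)]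
      exact hs
    let l := IsOpenImmersion.lift (modelChart lam C) s.1 hr
    have hl : l ≫ modelChart lam C = s.1 := IsOpenImmersion.lift_fac _ _ _
    obtain ⟨g, hg⟩ : ∃ g, Spec.map g = l := Spec.map_surjective l
    have hg2 : Spec.map g ≫ Spec.map (CommRingCat.ofHom (algebraMap F (chartRing lam C.1))) =
        𝟙 _ := by
      rw [← modelChart_toSpec, ← Category.assoc, hg, hl]
      exact s.2
    rw [← Spec.map_comp, ← Spec.map_id] at hg2
    have hg3 := congrArg CommRingCat.Hom.hom (Spec.map_injective hg2)
    let φ : chartRing lam C.1 →ₐ[F] F :=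
      { g.hom with commutes' := fun r => DFunLike.congr_fun hg3 r }
    refine ⟨φ, Subtype.ext ?_⟩
    rw [← hl, ← hg]
    rfl

theorem exists_eq_pointOf {hlam : lam ≠ 0} (s : (model hlam).RationalPoints) :
    ∃ C φ, s = pointOf hlam C φ := by
  obtain ⟨i, hi⟩ := exists_mem_range_modelChart (s.1 (⊥ : PrimeSpectrum F))
  obtain ⟨φ, hφ⟩ := (mem_range_pointOf ⟨maxCell i, isCell_maxCell i⟩ s).2 hi
  exact ⟨_, φ, hφ.symm⟩

/-- The exponent of the transition function between the charts of two cones. -/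
def transition (C C' : Finset (Fin 2 × Fin 3)) : Fin 3 → ℤ :=
  (cellWeight C).2 • (cellWeight C').1 - (cellWeight C').2 • (cellWeight C).1

theorem ray_transition (C C' : Finset (Fin 2 × Fin 3)) (c : Fin 2 × Fin 3) :
    ray c ⬝ᵥ transition C C' =
      (cellWeight C).2 * slack c (cellWeight C') - (cellWeight C').2 * slack c (cellWeight C) := by
  have h : ∀ x : (Fin 3 → ℤ) × ℕ, slack c x = ray c ⬝ᵥ x.1 + x.2 * supportNumber c := fun _ => rfl
  rw [transition, dotProduct_sub, dotProduct_smul, dotProduct_smul, h, h, nsmul_eq_mul,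
    nsmul_eq_mul]
  ring

theorem transition_mem {C : Finset (Fin 2 × Fin 3)} (hC : IsCell C) (C' : Finset (Fin 2 × Fin 3)) :
    transition C C' ∈ dualCone C := by
  intro c hc
  rw [ray_transition, (slack_cellWeight_eq_zero hC).2 hc, mul_zero, sub_zero]
  exact mul_nonneg (Int.natCast_nonneg _) (slack_cellWeight_nonneg _ _)

theorem ray_transition_eq_zero {C C' : Finset (Fin 2 × Fin 3)} (hC : IsCell C) (hC' : IsCell C')
    {c : Fin 2 × Fin 3} (hc : c ∈ C) : ray c ⬝ᵥ transition C C' = 0 ↔ c ∈ C' := by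
  rw [ray_transition, (slack_cellWeight_eq_zero hC).2 hc, mul_zero, sub_zero, mul_eq_zero,
    slack_cellWeight_eq_zero hC', or_iff_right]
  exact_mod_cast (cellWeight_snd_pos hC).ne'

theorem awayHom_isLocalizationElem (C C' : Cell) :
    awayHom C.2 (Away.isLocalizationElem (cellSection_mem lam C.1) (cellSection_mem lam C'.1)) =
      chartMonomial lam C.1 (.ofAdd ⟨transition C.1 C'.1, transition_mem C.2 _⟩) := by
  have h1 := awayEval_mk (isUnit_coordEval_cellSection lam C.1) (cellSection_mem lam C.1)
    (cellWeight C'.1).2 (cellSection lam C'.1 ^ (cellWeight C.1).2)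
    (by convert! SetLike.pow_mem_graded (cellWeight C.1).2 (cellSection_mem lam C'.1) using 2
        exact mul_comm _ _)
  rw [map_pow, coordEval_cellSection, coordEval_cellSection, ← character_nsmul (cellWeight C.1).2] at h1
  have h2 := eq_character_sub lam h1
  rw [← transition] at h2
  exact Subtype.ext h2

/-- Inside chart C the chart C' is the nonvanishing locus of the degree zero quotient of powers of
the two cell sections, which is the transition monomial. -/
theorem pointOf_mem_range_iff {hlam : lam ≠ 0} (C C' : Cell) (φ : chartRing lam C.1 →ₐ[F] F) :
    pointOf hlam C φ ∈ Set.range (pointOf hlam C') ↔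
      chartValue φ ⟨transition C.1 C'.1, transition_mem C.2 _⟩ ≠ 0 := by
  refine (mem_range_pointOf _ _).trans ((mem_range_modelChart _ _ _).trans ?_)
  have h1 : (pointOf hlam C φ).1 (⊥ : PrimeSpectrum F) =
      Proj.awayι _ (cellSection lam C.1) (cellSection_mem lam C.1) (cellWeight_snd_pos C.2)
        (Spec.map (CommRingCat.ofHom (awayHom (lam := lam) C.2))
          (Spec.map (CommRingCat.ofHom φ.toRingHom) (⊥ : PrimeSpectrum F))) := by
    change (Spec.map (CommRingCat.ofHom φ.toRingHom) ≫ Spec.map (CommRingCat.ofHom (awayHom (lam := lam) C.2)) ≫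
      Proj.awayι _ (cellSection lam C.1) (cellSection_mem lam C.1) (cellWeight_snd_pos C.2)) _ = _
    exact (Scheme.Hom.comp_apply _ _ _).trans (Scheme.Hom.comp_apply _ _ _)
  have h2 := Proj.awayι_preimage_basicOpen (coordGrading lam) (cellSection_mem lam C.1)
    (cellWeight_snd_pos C.2) (cellSection_mem lam C'.1) (cellWeight_snd_pos C'.2)
  rw [h1]
  have h3 := SetLike.ext_iff.1 h2 (Spec.map (CommRingCat.ofHom (awayHom (lam := lam) C.2))
          (Spec.map (CommRingCat.ofHom φ.toRingHom) (⊥ : PrimeSpectrum F)))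
  refine h3.trans ?_
  change ¬ (φ (awayHom C.2 _) ∈ (⊥ : Ideal F)) ↔ _
  rw [awayHom_isLocalizationElem, Ideal.mem_bot]
  rfl

/-- Only the set of rays along which a monomial vanishes matters, so simpler monomials may replace
the transition monomial. -/
theorem pointOf_mem_range_iff_of_ray {hlam : lam ≠ 0} {C C' : Cell}
    {φ : chartRing lam C.1 →ₐ[F] F} {m : dualCone C.1}
    (hm : ∀ c ∈ C.1, ray c ⬝ᵥ (m : Fin 3 → ℤ) = 0 ↔ c ∈ C'.1) :
    pointOf hlam C φ ∈ Set.range (pointOf hlam C') ↔ chartValue φ m ≠ 0 := by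
  rw [pointOf_mem_range_iff]
  constructor
  · exact fun h => chartValue_ne_zero φ h fun c hc h0 =>
      (hm c hc).2 ((ray_transition_eq_zero C.2 C'.2 hc).1 h0)
  · exact fun h => chartValue_ne_zero φ h fun c hc h0 =>
      (ray_transition_eq_zero C.2 C'.2 hc).2 ((hm c hc).1 h0)

end Points

end FiniteHypergeometric

namespace FiniteHypergeometric

/-! ### A stratification of the rational points -/

/-- The cells consisting of a full row or a full column. -/
def lineCell : Fin 2 ⊕ Fin 3 → Finset (Fin 2 × Fin 3)
  | .inl i => {(i, 0), (i, 1), (i, 2)}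
  | .inr j => {(0, j), (1, j)}

theorem isCell_lineCell (o : Fin 2 ⊕ Fin 3) : IsCell (lineCell o) := by
  revert o
  decide

/-- If an x- and a y-coordinate are nonzero, the remaining indices lie in the other row; if two
y-coordinates are, in the third column; if both x-coordinates are, there are none. -/
theorem exists_lineCell {e o : Fin 2 ⊕ Fin 3} (h : o ≠ e) :
    ∃ l, ∀ c, ¬ Involves c e → ¬ Involves c o → c ∈ lineCell l := by
  revert e o
  decide

theorem IsCell.exists_not_involves {C : Finset (Fin 2 × Fin 3)} (hC : IsCell C) :
    ∃ e, ∀ c ∈ C, ¬ Involves c e := by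
  revert C
  decide +kernel

/-- The chart of a row or column. -/
abbrev lineChart (o : Fin 2 ⊕ Fin 3) : Cell := ⟨lineCell o, isCell_lineCell o⟩

section Strata

attribute [local irreducible] cellWeight

variable {F : Type u} [Field F] {lam : F}

/-- In the linear relation between the five coordinates a single nonzero term cannot cancel, so at
least two coordinates are nonzero at every rational point. -/
theorem exists_mem_range_lineChart {hlam : lam ≠ 0} (s : (model hlam).RationalPoints) :
    ∃ l, s ∈ Set.range (pointOf hlam (lineChart l)) := by
  obtain ⟨C, φ, rfl⟩ := exists_eq_pointOf s
  obtain ⟨e, he⟩ := C.2.exists_not_involves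
  obtain ⟨o, hoe, ho⟩ : ∃ o, o ≠ e ∧
      chartValue φ ⟨coordExponent o - coordExponent e, coordExponent_sub_mem he o⟩ ≠ 0 := by
    by_contra! H
    have h := sum_coordCoeff_mul_chartValue φ he
    rw [Finset.sum_eq_single e (fun o _ hoe => by rw [H o hoe, mul_zero]) (by simp)] at h
    have h0 : (⟨coordExponent e - coordExponent e, coordExponent_sub_mem he e⟩ : dualCone C.1) = 0 :=
      Subtype.ext (sub_self _)
    rw [h0, chartValue_zero, mul_one] at h
    exact coordCoeff_ne_zero hlam e h
  obtain ⟨l, hl⟩ := exists_lineCell hoe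
  refine ⟨l, (pointOf_mem_range_iff C (lineChart l) φ).2 (chartValue_ne_zero φ ho fun c hc h0 => ?_)⟩
  exact (ray_transition_eq_zero C.2 (isCell_lineCell l) hc).2
    (hl c (he c hc) ((ray_coordExponent c e o (he c hc)).2.1 h0))

/-! ### The charts of rows -/

/-- The basis dual to the rays of a row. -/
def dualBasis : Fin 2 → Fin 3 → Fin 3 → ℤ
  | 0, 0 => ![0, 1, 0]
  | 0, 1 => ![1, 0, 0]
  | 0, 2 => ![0, 0, 1]
  | 1, 0 => ![-1, 1, -1]
  | 1, 1 => ![2, -1, -1]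
  | 1, 2 => ![-1, -1, 4]

theorem ray_dualBasis (i : Fin 2) (k l : Fin 3) :
    ray (i, k) ⬝ᵥ dualBasis i l = if k = l then 1 else 0 := by
  revert i k l
  decide

theorem mem_lineCell_inl {i : Fin 2} {c : Fin 2 × Fin 3} :
    c ∈ lineCell (.inl i) ↔ ∃ k, c = (i, k) := by
  revert i c
  decide

theorem dualBasis_mem (i : Fin 2) (l : Fin 3) : dualBasis i l ∈ dualCone (lineCell (.inl i)) := by
  intro c hc
  obtain ⟨k, rfl⟩ := mem_lineCell_inl.1 hc
  rw [ray_dualBasis]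
  split_ifs <;> simp

theorem sum_ray_smul_dualBasis (i : Fin 2) (m : Fin 3 → ℤ) :
    ∑ k, (ray (i, k) ⬝ᵥ m) • dualBasis i k = m := by
  funext a
  fin_cases i <;> fin_cases a <;>
    simp [Fin.sum_univ_three, dotProduct, ray, dualBasis] <;> ring

theorem sum_toNat_smul_dualBasis {i : Fin 2} (m : dualCone (lineCell (.inl i))) :
    ∑ k, (ray (i, k) ⬝ᵥ (m : Fin 3 → ℤ)).toNat •
      (⟨dualBasis i k, dualBasis_mem i k⟩ : dualCone (lineCell (.inl i))) = m := by
  refine Subtype.ext ?_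
  rw [AddSubmonoidClass.coe_finsetSum]
  refine Eq.trans (Finset.sum_congr rfl fun k _ => ?_) (sum_ray_smul_dualBasis i m)
  have h := Int.toNat_of_nonneg (m.2 (i, k) (mem_lineCell_inl.2 ⟨k, rfl⟩))
  conv_rhs => rw [← h]
  exact (natCast_zsmul _ _).symm

/-- The rays of a row form a lattice basis, so the exponent monoid of its chart is free on the dual
basis. -/
theorem chartValue_eq_prod {i : Fin 2} (φ : chartRing lam (lineCell (.inl i)) →ₐ[F] F)
    (m : dualCone (lineCell (.inl i))) :
    chartValue φ m = ∏ k, chartValue φ ⟨dualBasis i k, dualBasis_mem i k⟩ ^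
      (ray (i, k) ⬝ᵥ (m : Fin 3 → ℤ)).toNat := by
  conv_lhs => rw [← sum_toNat_smul_dualBasis m]
  simp only [Fin.sum_univ_three, Fin.prod_univ_three, chartValue_add, chartValue_nsmul]

theorem lineCell_inl_not_involves (i : Fin 2) :
    ∀ c ∈ lineCell (.inl i), ¬ Involves c (.inl (1 - i)) := by
  revert i
  decide

variable (lam) in
/-- The rational points of the chart of a row, in coordinates. -/
def rowPoints (i : Fin 2) : Set (Fin 3 → F) :=
  {t | ∑ o, coordCoeff lam o *
    ∏ k, t k ^ (ray (i, k) ⬝ᵥ (coordExponent o - coordExponent (.inl (1 - i)))).toNat = 0}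

theorem rowCoordinates_mem {i : Fin 2} (φ : chartRing lam (lineCell (.inl i)) →ₐ[F] F) :
    (fun k => chartValue φ ⟨dualBasis i k, dualBasis_mem i k⟩) ∈ rowPoints lam i := by
  have h := sum_coordCoeff_mul_chartValue φ (lineCell_inl_not_involves i)
  simp only [chartValue_eq_prod φ ⟨coordExponent _ - _, _⟩] at h
  exact h

theorem rowCoordinates_bijective (hlam : lam ≠ 0) (i : Fin 2) : Function.Bijective
    fun φ : chartRing lam (lineCell (.inl i)) →ₐ[F] F =>
      (⟨fun k => chartValue φ ⟨dualBasis i k, dualBasis_mem i k⟩, rowCoordinates_mem φ⟩ :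
        rowPoints lam i) := by
  constructor
  · intro φ φ' h
    refine chartValue_ext fun m => ?_
    rw [chartValue_eq_prod, chartValue_eq_prod φ']
    exact Finset.prod_congr rfl fun k _ =>
      congrArg (· ^ _) (congrFun (congrArg Subtype.val h) k)
  · rintro ⟨t, ht⟩
    let h : Multiplicative (dualCone (lineCell (.inl i))) →* F :=
      { toFun := fun m => ∏ k, t k ^ (ray (i, k) ⬝ᵥ (m.toAdd : Fin 3 → ℤ)).toNat
        map_one' := by simp
        map_mul' := fun m m' => by
          rw [← Finset.prod_mul_distrib]
          refine Finset.prod_congr rfl fun k _ => ?_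
          have hk : (i, k) ∈ lineCell (.inl i) := mem_lineCell_inl.2 ⟨k, rfl⟩
          rw [← pow_add, ← Int.toNat_add (m.toAdd.2 _ hk) (m'.toAdd.2 _ hk), ← dotProduct_add]
          rfl }
    obtain ⟨φ, hφ⟩ := exists_chartHom hlam (lineCell_inl_not_involves i) h ht
    refine ⟨φ, Subtype.ext (funext fun k => (hφ _).trans ?_)⟩
    change ∏ l, t l ^ (ray (i, l) ⬝ᵥ dualBasis i k).toNat = t k
    simp only [ray_dualBasis]
    rw [Finset.prod_eq_single k]
    · simp
    · intro l _ hl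
      simp [hl]
    · simp

theorem card_rowPoints_zero :
    Nat.card (rowPoints lam 0) = Nat.card (surfacePoints (lam⁻¹ : F)) := by
  -- The first row lists its rays in the directions y, x, z, so t 0 is y and t 1 is x.
  let e : (Fin 3 → F) ≃ F × F × F :=
    { toFun := fun t => (t 1, t 0, t 2)
      invFun := fun v => ![v.2.1, v.1, v.2.2]
      left_inv := fun t => by
        funext k
        fin_cases k <;> rfl
      right_inv := fun v => rfl }
  refine Nat.card_congr (e.subtypeEquiv fun t => ?_)
  change (∑ o, _ = 0) ↔ (t 0 ^ 2 - t 1 * t 0 * t 2 + t 1 ^ 3 + t 2 ^ 5 - lam⁻¹ = 0)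
  rw [sum_coord, ← neg_eq_zero (a := t 0 ^ 2 - _ + _ + _ - _)]
  simp [Fin.prod_univ_three, coordCoeff, coordExponent, ray, dotProduct, Fin.sum_univ_three]
  ring_nf

theorem mem_rowPoints_one {t : Fin 3 → F} : t ∈ rowPoints lam 1 ↔
    1 + lam⁻¹ * (t 0 ^ 15 * t 1 ^ 10 * t 2 ^ 6) = t 0 + t 1 + t 2 := by
  change (∑ o, _ = 0) ↔ _
  rw [sum_coord, ← sub_eq_zero (b := t 0 + t 1 + t 2)]
  simp [Fin.prod_univ_three, coordCoeff, coordExponent, ray, dotProduct, Fin.sum_univ_three]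
  ring_nf

/-- The points of the chart of the second row outside of the torus. -/
def boundaryPoints (F : Type u) [Field F] : Set (Fin 3 → F) :=
  {t | t 0 * t 1 * t 2 = 0 ∧ t 0 + t 1 + t 2 = 1}

theorem mem_rowPoints_one_and_iff (t : Fin 3 → F) :
    (t ∈ rowPoints lam 1 ∧ t 0 * t 1 * t 2 = 0) ↔ t ∈ boundaryPoints F := by
  rw [mem_rowPoints_one, boundaryPoints, Set.mem_ofPred_eq, and_comm]
  refine and_congr_right fun h => ?_
  have h1 : t 0 ^ 15 * t 1 ^ 10 * t 2 ^ 6 = 0 := by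
    rw [show t 0 ^ 15 * t 1 ^ 10 * t 2 ^ 6 = t 0 * t 1 * t 2 * (t 0 ^ 14 * t 1 ^ 9 * t 2 ^ 5) by ring,
      h, zero_mul]
  rw [h1, mul_zero, add_zero, eq_comm]

/-- Three lines in a plane forming a triangle: 3 q points, less the three vertices, which would be
counted twice. -/
theorem card_boundaryPoints [Fintype F] :
    Nat.card (boundaryPoints F) + 3 = 3 * Fintype.card F := by
  -- On the line t k = 0 only the points with t (k + 1) ≠ 0 are listed; by the cyclic order each
  -- vertex is listed exactly once.
  let g : Fin 3 × Fˣ → Fin 3 → F := fun x i =>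
    if i = x.1 then 0 else if i = x.1 + 1 then x.2 else 1 - x.2
  have hg : ∀ x, g x ∈ boundaryPoints F := by
    rintro ⟨k, v⟩
    fin_cases k <;> simp [g, boundaryPoints]
  have hinj : Function.Injective g := by
    rintro ⟨k, v⟩ ⟨k', v'⟩ h
    have h0 := congrFun h 0
    have h1 := congrFun h 1
    have h2 := congrFun h 2
    have hv := v.ne_zero
    have hv' := v'.ne_zero
    fin_cases k <;> fin_cases k' <;> simp [g] at h0 h1 h2 <;>
      simp_all [Units.ext_iff]
  have hsurj : ∀ t ∈ boundaryPoints F, ∃ x, g x = t := by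
    rintro t ⟨h0, h1⟩
    have key : ∀ k, t k = 0 → t (k + 1) ≠ 0 → ∃ x, g x = t := by
      intro k hk hk'
      refine ⟨(k, Units.mk0 _ hk'), funext fun i => ?_⟩
      fin_cases k <;> fin_cases i <;> simp [g] at hk ⊢ <;> simp [hk, ← h1]
    by_cases a0 : t 0 = 0
    · by_cases a1 : t 1 = 0
      · refine key 1 a1 fun a2 => ?_
        change t 2 = 0 at a2
        simp [a0, a1, a2] at h1
      · exact key 0 a0 a1
    · by_cases a2 : t 2 = 0
      · exact key 2 a2 a0
      · have a1 : t 1 = 0 := by simpa [a0, a2] using h0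
        exact key 1 a1 a2
  have hcard : Nat.card (boundaryPoints F) = Nat.card (Fin 3 × Fˣ) :=
    (Nat.card_congr (Equiv.ofBijective (fun x => (⟨g x, hg x⟩ : boundaryPoints F))
      ⟨fun x y h => hinj (congrArg Subtype.val h), fun t => by
        obtain ⟨x, hx⟩ := hsurj t t.2
        exact ⟨x, Subtype.ext hx⟩⟩)).symm
  classical
  rw [hcard, Nat.card_prod, Nat.card_eq_fintype_card, Nat.card_eq_fintype_card, Fintype.card_fin,
    Fintype.card_units]
  have := Fintype.card_pos (α := F)
  omega

/-- The product of the three coordinates has order 1 along every ray of the second row, so it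
vanishes exactly off the torus; the two row cones share no ray. -/
theorem pointOf_row_one_mem_iff {hlam : lam ≠ 0}
    (φ : chartRing lam (lineCell (.inl 1)) →ₐ[F] F) :
    pointOf hlam (lineChart (.inl 1)) φ ∈ Set.range (pointOf hlam (lineChart (.inl 0))) ↔
      chartValue φ ⟨dualBasis 1 0, dualBasis_mem 1 0⟩ * chartValue φ ⟨dualBasis 1 1, dualBasis_mem 1 1⟩ *
        chartValue φ ⟨dualBasis 1 2, dualBasis_mem 1 2⟩ ≠ 0 := by
  rw [← chartValue_add, ← chartValue_add]
  refine pointOf_mem_range_iff_of_ray ?_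
  decide

end Strata

end FiniteHypergeometric

namespace FiniteHypergeometric

section Columns

attribute [local irreducible] cellWeight

variable {F : Type u} [Field F] {lam : F}

/-! ### The charts of columns -/

/-- Two indices different from a given one. -/
def otherIndex : Fin 3 → Fin 2 → Fin 3
  | 0, 0 => 1
  | 0, 1 => 2
  | 1, 0 => 0
  | 1, 1 => 2
  | 2, 0 => 0
  | 2, 1 => 1

/-- The generator of the lattice orthogonal to the rays of a column. -/
def columnGenerator (j : Fin 3) : Fin 3 → ℤ :=
  coordExponent (.inr (otherIndex j 0)) - coordExponent (.inr (otherIndex j 1))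

/-- A linear form with odd value at the generator. -/
def columnParity : Fin 3 → Fin 3 → ℤ
  | 0 => ![1, 0, 0]
  | 1 => ![0, 0, 1]
  | 2 => ![1, 0, 0]

theorem odd_columnParity (j : Fin 3) : Odd (columnParity j ⬝ᵥ columnGenerator j) := by
  revert j
  decide

/-- The exponent vector `m` is orthogonal to the rays of a column. -/
def ColumnOrthogonal (j : Fin 3) (m : Fin 3 → ℤ) : Prop :=
  ray (0, j) ⬝ᵥ m = 0 ∧ ray (1, j) ⬝ᵥ m = 0

instance (j : Fin 3) (m : Fin 3 → ℤ) : Decidable (ColumnOrthogonal j m) :=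
  inferInstanceAs (Decidable (_ ∧ _))

theorem ColumnOrthogonal.exists_eq_smul {j : Fin 3} {m : Fin 3 → ℤ} (h : ColumnOrthogonal j m) :
    ∃ t : ℤ, m = t • columnGenerator j := by
  obtain ⟨h0, h1⟩ := h
  fin_cases j
  · simp [ray, dotProduct, Fin.sum_univ_three] at h0 h1
    -- The three generators are (3, 0, -5), (0, 2, -5) and (-3, 2, 0); orthogonality makes the
    -- coordinate being divided a multiple of 3 or 2.
    refine ⟨m 0 / 3, funext fun a => ?_⟩
    fin_cases a <;> simp [columnGenerator, otherIndex, coordExponent] <;> omega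
  · simp [ray, dotProduct, Fin.sum_univ_three] at h0 h1
    refine ⟨m 1 / 2, funext fun a => ?_⟩
    fin_cases a <;> simp [columnGenerator, otherIndex, coordExponent] <;> omega
  · simp [ray, dotProduct, Fin.sum_univ_three] at h0 h1
    refine ⟨m 1 / 2, funext fun a => ?_⟩
    fin_cases a <;> simp [columnGenerator, otherIndex, coordExponent] <;> omega

theorem lineCell_inr_not_involves (j : Fin 3) (k : Fin 2) :
    ∀ c ∈ lineCell (.inr j), ¬ Involves c (.inr (otherIndex j k)) := by
  revert j k
  decide

theorem columnOrthogonal_coordExponent_sub (j : Fin 3) (o : Fin 2 ⊕ Fin 3) :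
    ColumnOrthogonal j (coordExponent o - coordExponent (.inr (otherIndex j 1))) ↔
      o = .inr (otherIndex j 0) ∨ o = .inr (otherIndex j 1) := by
  revert j o
  decide

/-- Orders are nonnegative on the dual cone, so a sum has order zero only if both summands do. This
makes extension by zero multiplicative. -/
theorem columnOrthogonal_add {j : Fin 3} {m m' : Fin 3 → ℤ} (hm : m ∈ dualCone (lineCell (.inr j)))
    (hm' : m' ∈ dualCone (lineCell (.inr j))) :
    ColumnOrthogonal j (m + m') ↔ ColumnOrthogonal j m ∧ ColumnOrthogonal j m' := by
  have h0 : (0, j) ∈ lineCell (.inr j) := by simp [lineCell]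
  have h1 : (1, j) ∈ lineCell (.inr j) := by simp [lineCell]
  have a0 := hm _ h0
  have a1 := hm _ h1
  have b0 := hm' _ h0
  have b1 := hm' _ h1
  simp only [ColumnOrthogonal, dotProduct_add]
  omega

theorem otherIndex_ne (j : Fin 3) : otherIndex j 0 ≠ otherIndex j 1 := by
  revert j
  decide

theorem sum_coordCoeff_column (j : Fin 3) {v : Fin 2 ⊕ Fin 3 → F}
    (hv : ∀ o, ¬ (o = .inr (otherIndex j 0) ∨ o = .inr (otherIndex j 1)) → v o = 0) :
    ∑ o, coordCoeff lam o * v o = -v (.inr (otherIndex j 0)) - v (.inr (otherIndex j 1)) := by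
  rw [Finset.sum_eq_add_of_mem _ _ (Finset.mem_univ _) (Finset.mem_univ _)
    (Sum.inr_injective.ne (otherIndex_ne j))]
  · simp only [coordCoeff]
    ring
  · rintro o - ⟨h0, h1⟩
    rw [hv o (by tauto), mul_zero]

/-- Where both x-coordinates and y_{j+1} vanish, the relation says that the other two y-coordinates
have ratio -1. `columnParity` extends this sign from the generator to a character of the whole
lattice, and all remaining monomials are sent to zero. -/
theorem exists_columnHom (hlam : lam ≠ 0) (j : Fin 3) :
    ∃ φ : chartRing lam (lineCell (.inr j)) →ₐ[F] F, ∀ m, chartValue φ m =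
      if ColumnOrthogonal j m then (-1) ^ (columnParity j ⬝ᵥ (m : Fin 3 → ℤ)) else 0 := by
  let h : Multiplicative (dualCone (lineCell (.inr j))) →* F :=
    { toFun := fun m => if ColumnOrthogonal j m.toAdd then
        (-1) ^ (columnParity j ⬝ᵥ (m.toAdd : Fin 3 → ℤ)) else 0
      map_one' := by simp [ColumnOrthogonal]
      map_mul' := fun m m' => by
        have h1 := columnOrthogonal_add m.toAdd.2 m'.toAdd.2
        rw [toAdd_mul, AddSubmonoid.coe_add]
        simp only [h1, dotProduct_add]
        rw [zpow_add₀ (neg_ne_zero.2 one_ne_zero)]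
        split_ifs <;> simp_all }
  obtain ⟨φ, hφ⟩ := exists_chartHom hlam (lineCell_inr_not_involves j 1) h (by
    change ∑ o, coordCoeff lam o *
      (if ColumnOrthogonal j (coordExponent o - coordExponent (.inr (otherIndex j 1))) then
        (-1) ^ (columnParity j ⬝ᵥ (coordExponent o - coordExponent (.inr (otherIndex j 1))))
        else 0) = 0
    rw [sum_coordCoeff_column j fun o ho => if_neg fun h =>
      ho ((columnOrthogonal_coordExponent_sub j o).1 h)]
    rw [if_pos ((columnOrthogonal_coordExponent_sub j _).2 (Or.inl rfl)),
      if_pos ((columnOrthogonal_coordExponent_sub j _).2 (Or.inr rfl)), sub_self, dotProduct_zero,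
      ← columnGenerator, (odd_columnParity j).neg_one_zpow]
    simp)
  exact ⟨φ, fun m => hφ _⟩

/-- The point of the chart of a column outside of the charts of the rows. -/
noncomputable def columnHom (hlam : lam ≠ 0) (j : Fin 3) :
    chartRing lam (lineCell (.inr j)) →ₐ[F] F :=
  (exists_columnHom hlam j).choose

theorem chartValue_columnHom (hlam : lam ≠ 0) (j : Fin 3) (m : dualCone (lineCell (.inr j))) :
    chartValue (columnHom hlam j) m =
      if ColumnOrthogonal j m then (-1) ^ (columnParity j ⬝ᵥ (m : Fin 3 → ℤ)) else 0 :=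
  (exists_columnHom hlam j).choose_spec m

theorem columnGenerator_mem (j : Fin 3) : columnGenerator j ∈ dualCone (lineCell (.inr j)) :=
  coordExponent_sub_mem (lineCell_inr_not_involves j 1) _

theorem chartValue_columnGenerator {j : Fin 3} {φ : chartRing lam (lineCell (.inr j)) →ₐ[F] F}
    (hφ : ∀ m : dualCone (lineCell (.inr j)), ¬ ColumnOrthogonal j m → chartValue φ m = 0) :
    chartValue φ ⟨columnGenerator j, columnGenerator_mem j⟩ = -1 := by
  have h := sum_coordCoeff_mul_chartValue φ (lineCell_inr_not_involves j 1)
  rw [sum_coordCoeff_column j fun o ho => hφ _ fun h =>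
    ho ((columnOrthogonal_coordExponent_sub j o).1 h)] at h
  have h0 : (⟨coordExponent (.inr (otherIndex j 1)) - coordExponent (.inr (otherIndex j 1)),
      coordExponent_sub_mem (lineCell_inr_not_involves j 1) _⟩ : dualCone (lineCell (.inr j))) = 0 :=
    Subtype.ext (sub_self _)
  rw [h0, chartValue_zero] at h
  change -chartValue φ ⟨columnGenerator j, columnGenerator_mem j⟩ - 1 = 0 at h
  linear_combination -h

theorem chartValue_smul_columnGenerator {j : Fin 3} {φ : chartRing lam (lineCell (.inr j)) →ₐ[F] F}
    (hφ : ∀ m : dualCone (lineCell (.inr j)), ¬ ColumnOrthogonal j m → chartValue φ m = 0)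
    (m : dualCone (lineCell (.inr j))) {t : ℤ} (ht : (m : Fin 3 → ℤ) = t • columnGenerator j) :
    chartValue φ m = (-1) ^ t := by
  have hnat : ∀ n : ℕ, chartValue φ (n • ⟨columnGenerator j, columnGenerator_mem j⟩) =
      (-1) ^ n := fun n => by rw [chartValue_nsmul, chartValue_columnGenerator hφ]
  obtain ⟨n, rfl | rfl⟩ := t.eq_nat_or_neg
  · rw [zpow_natCast, ← hnat n]
    congr 1
    exact Subtype.ext (ht.trans (natCast_zsmul _ _))
  · have h1 : m + n • ⟨columnGenerator j, columnGenerator_mem j⟩ = 0 := by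
      refine Subtype.ext ?_
      change (m : Fin 3 → ℤ) + n • columnGenerator j = 0
      rw [ht, neg_smul, natCast_zsmul, neg_add_cancel]
    have h2 := chartValue_add φ m (n • ⟨columnGenerator j, columnGenerator_mem j⟩)
    rw [h1, chartValue_zero, hnat] at h2
    rw [zpow_neg, zpow_natCast]
    exact eq_inv_of_mul_eq_one_left h2.symm

theorem eq_columnHom {hlam : lam ≠ 0} {j : Fin 3}
    {φ : chartRing lam (lineCell (.inr j)) →ₐ[F] F}
    (hφ : ∀ m : dualCone (lineCell (.inr j)), ¬ ColumnOrthogonal j m → chartValue φ m = 0) :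
    φ = columnHom hlam j := by
  refine chartValue_ext fun m => ?_
  by_cases hm : ColumnOrthogonal j m
  · obtain ⟨t, ht⟩ := hm.exists_eq_smul
    rw [chartValue_smul_columnGenerator hφ m ht, chartValue_smul_columnGenerator (fun m hm => ?_) m ht]
    rw [chartValue_columnHom, if_neg hm]
  · rw [hφ m hm, chartValue_columnHom, if_neg hm]

variable (lam) in
/-- The exceptional points of the completed surface. -/
noncomputable def columnPoint (hlam : lam ≠ 0) (j : Fin 3) : (model hlam).RationalPoints :=
  pointOf hlam (lineChart (.inr j)) (columnHom hlam j)

/-- Every other row or column misses a ray of column j, so the transition monomial is not orthogonal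
to the column and vanishes at the point. -/
theorem columnPoint_notMem {hlam : lam ≠ 0} {j : Fin 3} {l : Fin 2 ⊕ Fin 3} (hl : l ≠ .inr j) :
    columnPoint lam hlam j ∉ Set.range (pointOf hlam (lineChart l)) := by
  have hj : ¬ ((0, j) ∈ lineCell l ∧ (1, j) ∈ lineCell l) := by
    revert j l
    decide
  rw [columnPoint, pointOf_mem_range_iff, not_not, chartValue_columnHom, if_neg]
  rintro ⟨h0, h1⟩
  exact hj ⟨(ray_transition_eq_zero (isCell_lineCell (.inr j)) (isCell_lineCell l)
    (by simp [lineCell])).1 h0, (ray_transition_eq_zero (isCell_lineCell (.inr j))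
      (isCell_lineCell l) (by simp [lineCell])).1 h1⟩

theorem columnPoint_injective (hlam : lam ≠ 0) : Function.Injective (columnPoint lam hlam) := by
  intro j j' h
  by_contra hne
  refine columnPoint_notMem (hlam := hlam) (j := j) (l := .inr j')
    (fun h => hne (Sum.inr_injective h).symm) ?_
  rw [h]
  exact ⟨_, rfl⟩

theorem mem_lineCell_of_ne {i : Fin 2} {j : Fin 3} {c : Fin 2 × Fin 3}
    (hc : c ∈ lineCell (.inr j)) (hne : c ≠ (i, j)) : c ∈ lineCell (.inl (1 - i)) := by
  revert i j c
  decide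

/-- A monomial that is nonzero at s and has positive order along `ray (i, j)` would place s in the
chart of the other row 1 - i. Hence only monomials orthogonal to the column are nonzero at s, and
the relation fixes their values. -/
theorem eq_columnPoint {hlam : lam ≠ 0} {s : (model hlam).RationalPoints} {j : Fin 3}
    (hs : s ∈ Set.range (pointOf hlam (lineChart (.inr j))))
    (hrow : ∀ i, s ∉ Set.range (pointOf hlam (lineChart (.inl i)))) :
    s = columnPoint lam hlam j := by
  obtain ⟨φ, rfl⟩ := hs
  rw [columnPoint]
  congr 1
  refine eq_columnHom fun m hm => ?_
  by_contra hne
  have key : ∀ i : Fin 2, ray (i, j) ⬝ᵥ (m : Fin 3 → ℤ) = 0 := by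
    intro i
    by_contra hi
    have htrans : chartValue φ ⟨transition (lineCell (.inr j)) (lineCell (.inl (1 - i))),
        transition_mem (isCell_lineCell _) _⟩ ≠ 0 :=
      chartValue_ne_zero φ hne fun c hc h0 =>
        (ray_transition_eq_zero (isCell_lineCell (.inr j)) (isCell_lineCell (.inl (1 - i))) hc).2
          (mem_lineCell_of_ne hc fun h => hi (h ▸ h0))
    exact hrow (1 - i) ((pointOf_mem_range_iff (lineChart (.inr j)) (lineChart (.inl (1 - i))) φ).2
      htrans)
  exact hm ⟨key 0, key 1⟩

/-! ### Counting points -/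

variable (lam) in
/-- The points of the second row outside of the affine surface. -/
def outerPoints (hlam : lam ≠ 0) : Set (model hlam).RationalPoints :=
  pointOf hlam (lineChart (.inl 1)) '' {φ |
    chartValue φ ⟨dualBasis 1 0, dualBasis_mem 1 0⟩ * chartValue φ ⟨dualBasis 1 1, dualBasis_mem 1 1⟩ *
      chartValue φ ⟨dualBasis 1 2, dualBasis_mem 1 2⟩ = 0}

theorem univ_eq_union (hlam : lam ≠ 0) : (Set.univ : Set (model hlam).RationalPoints) =
    Set.range (pointOf hlam (lineChart (.inl 0))) ∪
      (outerPoints lam hlam ∪ Set.range (columnPoint lam hlam)) := by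
  refine (Set.eq_univ_of_forall fun s => ?_).symm
  by_cases h0 : s ∈ Set.range (pointOf hlam (lineChart (.inl 0)))
  · exact Or.inl h0
  by_cases h1 : s ∈ Set.range (pointOf hlam (lineChart (.inl 1)))
  · obtain ⟨φ, rfl⟩ := h1
    exact Or.inr (Or.inl ⟨φ, by_contra fun h => h0 ((pointOf_row_one_mem_iff φ).2 h), rfl⟩)
  have hrow : ∀ i, s ∉ Set.range (pointOf hlam (lineChart (.inl i))) :=
    Fin.forall_fin_two.2 ⟨h0, h1⟩
  obtain ⟨l | j, hl⟩ := exists_mem_range_lineChart s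
  · exact absurd hl (hrow l)
  · exact Or.inr (Or.inr ⟨j, (eq_columnPoint hl hrow).symm⟩)

theorem card_outerPoints [Fintype F] (hlam : lam ≠ 0) :
    (outerPoints lam hlam).ncard + 3 = 3 * Fintype.card F := by
  rw [outerPoints, Set.ncard_image_of_injective _ (pointOf_injective hlam _),
    ← card_boundaryPoints (F := F), ← Nat.card_coe_set_eq]
  congr 1
  let e := Equiv.ofBijective _ (rowCoordinates_bijective hlam 1)
  refine Nat.card_congr ((e.subtypeEquiv (q := fun t => t.1 0 * t.1 1 * t.1 2 = 0)
    fun φ => Iff.rfl).trans ((Equiv.subtypeSubtypeEquivSubtypeInter _ _).trans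
      (Equiv.subtypeEquivRight mem_rowPoints_one_and_iff)))

theorem card_range_pointOf_row_zero (hlam : lam ≠ 0) :
    (Set.range (pointOf hlam (lineChart (.inl 0)))).ncard =
      Nat.card (surfacePoints (lam⁻¹ : F)) := by
  rw [← Nat.card_coe_set_eq, Nat.card_range_of_injective (pointOf_injective hlam _),
    ← card_rowPoints_zero]
  exact Nat.card_congr (Equiv.ofBijective _ (rowCoordinates_bijective hlam 0))

theorem finite_rationalPoints [Finite F] (hlam : lam ≠ 0) : Finite (model hlam).RationalPoints := by
  have hrow : ∀ i, Finite (chartRing lam (lineCell (.inl i)) →ₐ[F] F) := fun i =>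
    Finite.of_injective _ (rowCoordinates_bijective hlam i).1
  have := hrow 0
  have := hrow 1
  rw [← Set.finite_univ_iff, univ_eq_union hlam]
  exact (Set.finite_range _).union (((Set.toFinite _).image _).union (Set.finite_range _))

/-- The three strata are disjoint: the affine surface, the 3 q - 3 points of the triangle, and the
three column points. -/
theorem card_rationalPoints [Fintype F] (hlam : lam ≠ 0) :
    Nat.card (model hlam).RationalPoints =
      Nat.card (surfacePoints (lam⁻¹ : F)) + 3 * Fintype.card F := by
  have := finite_rationalPoints hlam
  have hfin : ∀ s : Set (model hlam).RationalPoints, s.Finite := fun s => Set.toFinite s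
  have h1 : Disjoint (outerPoints lam hlam) (Set.range (columnPoint lam hlam)) := by
    rw [Set.disjoint_left]
    rintro _ ⟨φ, -, rfl⟩ ⟨j, hj⟩
    exact columnPoint_notMem (hlam := hlam) (j := j) (l := .inl 1) Sum.inl_ne_inr (by
      rw [hj]
      exact ⟨φ, rfl⟩)
  have h2 : Disjoint (Set.range (pointOf hlam (lineChart (.inl 0))))
      (outerPoints lam hlam ∪ Set.range (columnPoint lam hlam)) := by
    rw [Set.disjoint_right]
    rintro _ (⟨φ, hφ, rfl⟩ | ⟨j, rfl⟩) h
    · exact (pointOf_row_one_mem_iff φ).1 h hφ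
    · exact columnPoint_notMem (l := .inl 0) Sum.inl_ne_inr h
  have h3 : (Set.range (columnPoint lam hlam)).ncard = 3 := by
    rw [← Nat.card_coe_set_eq, Nat.card_range_of_injective (columnPoint_injective hlam),
      Nat.card_eq_fintype_card, Fintype.card_fin]
  rw [← Set.ncard_univ, univ_eq_union hlam, Set.ncard_union_eq h2 (hfin _) (hfin _),
    Set.ncard_union_eq h1 (hfin _) (hfin _), h3,
    card_range_pointOf_row_zero, card_outerPoints]

end Columns

end FiniteHypergeometric

theorem corollary1p6 {F : Type u} [Field F] [Fintype F]
    (hq : (Fintype.card F).Coprime 30)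
    (ψ : AddChar F ℂ) (hψ : ψ ≠ 1)
    (ω : MulChar F ℂ) (hω : ∀ χ : MulChar F ℂ, χ ∈ Subgroup.zpowers ω) :
    (∀ lam : F, lam ≠ 0 → 2 ^ 14 * 3 ^ 9 * 5 ^ 5 * lam ≠ 1 →
      ∃ S : FiniteHypergeometric.Completion lam,
        Finite S.RationalPoints ∧
        (Nat.card S.RationalPoints : ℂ) =
          (Fintype.card F : ℂ) ^ 2 + 3 * (Fintype.card F : ℂ) + 1 +
            (Fintype.card F : ℂ) *
              FiniteHypergeometric.surfaceData.H ψ ω (2 ^ 14 * 3 ^ 9 * 5 ^ 5 * lam)) ∧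
    ∀ t : F, t ≠ 0 → ∃ n : ℤ, FiniteHypergeometric.surfaceData.H ψ ω t = n := by
  refine ⟨fun lam hlam _ => ⟨FiniteHypergeometric.model hlam,
    FiniteHypergeometric.finite_rationalPoints hlam, ?_⟩,
    FiniteHypergeometric.exists_int_hypergeometric hq hψ hω⟩
  have h := FiniteHypergeometric.card_surfacePoints hq hψ hω (Units.mk0 lam hlam)
  rw [Units.val_mk0] at h
  rw [FiniteHypergeometric.card_rationalPoints, Nat.cast_add, h]
  push_cast
  ring
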